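/- Let $d\ge 1$. For exponents $p,q\in[1,\infty]$ and a measurable $F:\mathbb R\times\mathbb R^d\to\mathbb C$ write $\|F\|_{L^p_tL^q_x}=\big\|\,t\mapsto\|F(t,\cdot)\|_{L^q(\mathbb R^d)}\big\|_{L^p(\mathbb R)}$. (i) (Strichartz estimates for orthonormal functions.) Let $p,q\in[1,\infty]$ satisfy $$\frac2p+\frac dq=d,\qquad 1\le q<1+\frac{2}{d-1}$$ (with $2/\infty=0$, and $1+2/(d-1)=\infty$ if $d=1$). Then there is a constant $C>0$, depending only on $d,p,q$, such that for every (possibly infinite) orthonormal system $(f_j)$ in $L^2(\mathbb R^d)$ and all complex numbers $(\nu_j)$ with $\sum_j|\nu_j|^{2q/(q+1)}<\infty$, the series $\sum_j\nu_j|(e^{it\Delta}f_j)(x)|^2$ converges absolutely for almost every $t\in\mathbb R$ and almost every $x\in\mathbb R^d$, and $$\Big\|\sum_j\nu_j\,|e^{it\Delta}f_j|^2\Big\|_{L^p_tL^q_x(\mathbb R\times\mathbb R^d)}\le C\Big(\sum_j|\nu_j|^{\frac{2q}{q+1}}\Big)^{\frac{q+1}{2q}} .$$ (ii) (Schatten bound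 with space-time norms.) Let $S=\{(\omega,\xi)\in\mathbb R\times\mathbb R^d:\ \omega=-|\xi|^2\}$ be the paraboloid with the measure $d\mu(\omega,\xi)=(1+4|\xi|^2)^{-1/2}d\sigma(\omega,\xi)$, where $d\sigma$ is the surface measure. Let $\mathcal E_Sf(t,x)=(2\pi)^{-(d+1)/2}\int_S e^{i(t\omega+x\cdot\xi)}f(\omega,\xi)\,d\mu(\omega,\xi)$ be the extension operator and $T_S=\mathcal E_S(\mathcal E_S)^*$. Let $p,q\in[1,\infty)$ satisfy $$\frac2p+\frac dq=1,\qquad q>d+1 .$$ Then there is a constant $C>0$, depending only on $d,p,q$, such that for all $W_1,W_2\in L^p_tL^q_x(\mathbb R\times\mathbb R^d)$ the operators $W_1\mathcal E_S$ and $\overline{W_2}\,\mathcal E_S$ (defined on $L^1(S,d\mu)\cap L^2(S,d\mu)$) extend to bounded operators from $L^2(S,d\mu)$ to $L^2(\mathbb R\times\mathbb R^d)$, the operator $W_1T_SW_2=(W_1\mathcal E_S)(\overline{W_2}\,\mathcal E_S)^*$ on $L^2(\mathbb R\times\mathbb R^d)$ is compact, and $$\|W_1T_SW_2\|_{\mathfrak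 S^q(L^2(\mathbb R\times\mathbb R^d))}\le C\,\|W_1\|_{L^p_tL^q_x}\,\|W_2\|_{L^p_tL^q_x},$$ where $\|T\|_{\mathfrak S^q}=(\sum_n\mu_n(T)^q)^{1/q}$ and $\mu_n(T)$ are the non-zero eigenvalues of $\sqrt{T^*T}$, repeated according to multiplicity. -/

import Mathlib

open MeasureTheory
open scoped ENNReal FourierTransform InnerProductSpace

noncomputable section

namespace OrthonormalStrichartz

/-- The space `ℝ^d` with its Euclidean norm. -/
abbrev Space (d : ℕ) : Type := EuclideanSpace ℝ (Fin d)

/-- Space-time `ℝ × ℝ^d`, with points `(t, x)` and Lebesgue measure `dt dx`. -/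
abbrev SpaceTime (d : ℕ) : Type := ℝ × Space d

/-- The mixed norm `‖F‖_{L^p_t L^q_x(ℝ × ℝ^d)}`, with values in `[0, ∞]`. -/
def mixedNorm {d : ℕ} (p q : ℝ≥0∞) (F : SpaceTime d → ℂ) : ℝ≥0∞ :=
  eLpNorm (fun t : ℝ => eLpNorm (fun x : Space d => F (t, x)) q volume) p volume

/-- `F ∈ L^p_t L^q_x(ℝ × ℝ^d)`. -/
def MemMixedLp {d : ℕ} (p q : ℝ≥0∞) (F : SpaceTime d → ℂ) : Prop :=
  AEStronglyMeasurable F volume ∧ mixedNorm p q F < ∞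

/-! ### The free Schrödinger group -/

/-- The symbol of `e^{itΔ}`. Mathlib's Fourier transform has the kernel `e^{-2πi x·ξ}`,
so `-Δ` is the multiplier `(2π|ξ|)²`. -/
def schrodingerSymbol {d : ℕ} (t : ℝ) (ξ : Space d) : ℂ :=
  Complex.exp (-Complex.I * ((t * (2 * Real.pi * ‖ξ‖) ^ 2 : ℝ) : ℂ))

theorem memLp_schrodingerSymbol {d : ℕ} (t : ℝ) :
    MemLp (schrodingerSymbol (d := d) t) ∞ volume := by
  refine memLp_top_of_bound (C := 1) ?_ (Filter.Eventually.of_forall fun ξ => ?_)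
  · apply Continuous.aestronglyMeasurable
    unfold schrodingerSymbol
    fun_prop
  · have h : -Complex.I * ((t * (2 * Real.pi * ‖ξ‖) ^ 2 : ℝ) : ℂ)
        = ((-(t * (2 * Real.pi * ‖ξ‖) ^ 2) : ℝ) : ℂ) * Complex.I := by
      push_cast; ring
    rw [schrodingerSymbol, h, Complex.norm_exp_ofReal_mul_I]

/-- `e^{itΔ} f` for `f ∈ L²(ℝ^d)`: the Fourier multiplier with symbol `e^{-it(2π|ξ|)²}`. -/
def schrodinger {d : ℕ} (t : ℝ) (f : Lp ℂ 2 (volume : Measure (Space d))) :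
    Lp ℂ 2 (volume : Measure (Space d)) :=
  𝓕⁻ (((memLp_schrodingerSymbol t).toLp (schrodingerSymbol (d := d) t) •
    𝓕 f : Lp ℂ 2 (volume : Measure (Space d))))

/-! ### The paraboloid and its extension operator -/

/-- The parametrization `ξ ↦ (-|ξ|², ξ)` of the paraboloid
`S = {(ω, ξ) ∈ ℝ × ℝ^d : ω = -|ξ|²}`. -/
def paraboloidParam {d : ℕ} (ξ : Space d) : SpaceTime d := (-‖ξ‖ ^ 2, ξ)

/-- The surface measure `dσ` of the paraboloid, as a measure on `ℝ × ℝ^d` carried by `S`;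
the area element of the graph of `φ(ξ) = -|ξ|²` is `(1 + |∇φ(ξ)|²)^{1/2} dξ`. -/
def surfaceMeasure (d : ℕ) : Measure (SpaceTime d) :=
  ((volume : Measure (Space d)).withDensity
    fun ξ => ENNReal.ofReal (Real.sqrt (1 + 4 * ‖ξ‖ ^ 2))).map paraboloidParam

/-- The measure `dμ(ω, ξ) = (1 + 4|ξ|²)^{-1/2} dσ(ω, ξ)` on the paraboloid. -/
def paraboloidMeasure (d : ℕ) : Measure (SpaceTime d) :=
  (surfaceMeasure d).withDensity
    fun z => ENNReal.ofReal (Real.sqrt (1 + 4 * ‖z.2‖ ^ 2))⁻¹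

/-- The extension operator of the paraboloid,
`E_S f(t, x) = (2π)^{-(d+1)/2} ∫_S e^{i(tω + x·ξ)} f(ω, ξ) dμ(ω, ξ)` for `f ∈ L¹(S, dμ)`. -/
def extension {d : ℕ} (f : SpaceTime d → ℂ) (z : SpaceTime d) : ℂ :=
  (((2 * Real.pi) ^ (-((d : ℝ) + 1) / 2) : ℝ) : ℂ) *
    ∫ w : SpaceTime d,
      Complex.exp (Complex.I * ((z.1 * w.1 + ⟪z.2, w.2⟫_ℝ : ℝ) : ℂ)) * f w ∂(paraboloidMeasure d)

/-- `A` is the operator `W E_S`: the bounded operator from `L²(S, dμ)` to `L²(ℝ × ℝ^d)` with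
`A f = W · E_S f` for all `f` in the dense subspace `L¹(S, dμ) ∩ L²(S, dμ)`. There is at most one
such operator. -/
def IsWeightedExtension {d : ℕ} (W : SpaceTime d → ℂ)
    (A : Lp ℂ 2 (paraboloidMeasure d) →L[ℂ] Lp ℂ 2 (volume : Measure (SpaceTime d))) : Prop :=
  ∀ f : Lp ℂ 2 (paraboloidMeasure d), Integrable f (paraboloidMeasure d) →
    A f =ᵐ[volume] fun z => W z * extension f z

/-- `B` is the operator `W₁ T_S W₂` on `L²(ℝ × ℝ^d)`, where `T_S = E_S (E_S)^*`, that is,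
`B = (W₁ E_S) (conj W₂ E_S)^*`. There is at most one such operator. -/
def IsSandwich {d : ℕ} (W₁ W₂ : SpaceTime d → ℂ)
    (B : Lp ℂ 2 (volume : Measure (SpaceTime d)) →L[ℂ]
      Lp ℂ 2 (volume : Measure (SpaceTime d))) : Prop :=
  ∃ A₁ A₂ : Lp ℂ 2 (paraboloidMeasure d) →L[ℂ] Lp ℂ 2 (volume : Measure (SpaceTime d)),
    IsWeightedExtension W₁ A₁ ∧
    IsWeightedExtension (fun z => starRingEnd ℂ (W₂ z)) A₂ ∧
    B = A₁.comp (ContinuousLinearMap.adjoint A₂)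

/-! ### Schatten norms -/

/-- The multiplicity of `s > 0` as a singular value of `T`, i.e. as an eigenvalue of `√(T^*T)`:
the dimension of the eigenspace of `T^*T` for the eigenvalue `s²`. -/
def singularMultiplicity {H : Type*} [NormedAddCommGroup H] [InnerProductSpace ℂ H]
    [CompleteSpace H] (T : H →L[ℂ] H) (s : ℝ) : ℕ :=
  Module.finrank ℂ (Module.End.eigenspace
    (((ContinuousLinearMap.adjoint T).comp T : H →L[ℂ] H) : H →ₗ[ℂ] H) ((s ^ 2 : ℝ) : ℂ))

/-- The Schatten norm `(∑ₙ μₙ(T)^α)^{1/α} ∈ [0, ∞]` of a compact operator `T`, the sum being over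
the non-zero singular values of `T`, repeated according to multiplicity. -/
def schattenNorm {H : Type*} [NormedAddCommGroup H] [InnerProductSpace ℂ H]
    [CompleteSpace H] (α : ℝ) (T : H →L[ℂ] H) : ℝ≥0∞ :=
  (∑' s : {s : ℝ // 0 < s},
    (singularMultiplicity T s : ℝ≥0∞) * ENNReal.ofReal (s : ℝ) ^ α) ^ (1 / α)

end OrthonormalStrichartz

end

/-! Both statements come from one weighted estimate. For `A f = W · e^{itΔ} f` with `W ∈ L^p_t
L^q_x`, `2/p + d/q = 1`, `q > d + 1`, and orthonormal `f_j`, one has `∑ ‖A f_j‖^{2q} ≤ C^q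
‖W‖^{2q}`; in other words `A` lies in the Schatten class of order `2q`.

The estimate is proved for the adjoint. For `g` in space-time `L²`, `‖A^* g‖²` is the pairing of `g`
with `W T W g`, where `T` has the free Schrödinger kernel, of modulus comparable to `|t -
s|^{-d/2}`. A factor `e^{-ε|ξ|²}` regularizes the kernel to a Gaussian with complex parameter `b = ε
- 4π² i (t - s)`. By duality in `ℓ^q` it is enough to bound `∑ ν_j ⟨g_j, W T W g_j⟩` when `∑
ν_j^{q'} ≤ 1`. This sum is embedded in an analytic family that inserts a power of `|b|`, replaces
`W` by complex powers of itself and of its spatial norm at time `t`, and replaces `ν_j` by complex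
powers.

On `Re z = 0` the `x`-dependence of the weight has modulus one. The Gaussian is then a Fourier
multiplier bounded by one in `x`, and the Hardy-Littlewood-Sobolev inequality in `t` gives an
operator bound. On `Re z = 1` the kernel is square integrable, again by Hardy-Littlewood-Sobolev in
`t`, so the operator is Hilbert-Schmidt. The three lines lemma at `z = 2/q` returns the original sum
(`TameWeight.norm_sum_pairing_le`). The limit `ε → 0` is monotone, because the pairing is the
integral of `e^{-ε|ξ|²}` against a square. `OrthoBound.of_adjoint` passes from `A^*` back to `A`,
and truncation with scaling removes the boundedness assumptions on the weight
(`exists_weighted_bound`).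

For (i), the weight `√V` and Hölder's inequality in `j` bound `∫ V ∑ |ν_j| |e^{itΔ} f_j|²`, and the
converse Hölder inequality in mixed norms (`lintegral_rpow_le_of_pairing_le`) concludes. The case `q
= 1`, `p = ∞` is conservation of the `L²` norm. For (ii), the Fourier transform embeds `L²(S, dμ)`
isometrically into `L²(ℝ^d)` so that `E_S` becomes a multiple of the free evolution
(`exists_extension_isometry`). Both factors of `W₁ T_S W₂` then satisfy the `2q` bound, and
Cauchy-Schwarz yields order `q` (`schattenNorm_comp_adjoint_le`). -/

namespace OrthonormalStrichartz

/-! ### Sums over orthonormal families -/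

section OrthoBound

variable {H K : Type*} [NormedAddCommGroup H] [InnerProductSpace ℂ H]
  [NormedAddCommGroup K] [InnerProductSpace ℂ K]

/-- The sums `∑ⱼ ‖A fⱼ‖ ^ s` over finite orthonormal families are bounded by `C`. -/
def OrthoBound (A : H →L[ℂ] K) (s C : ℝ) : Prop :=
  ∀ (n : ℕ) (f : Fin n → H), Orthonormal ℂ f → ∑ j, ‖A (f j)‖ ^ s ≤ C

theorem OrthoBound.sum_le {A : H →L[ℂ] K} {s C : ℝ} (h : OrthoBound A s C) {ι : Type*} [Fintype ι]
    {f : ι → H} (hf : Orthonormal ℂ f) : ∑ j, ‖A (f j)‖ ^ s ≤ C := by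
  have := h _ (f ∘ (Fintype.equivFin ι).symm) (hf.comp _ (Equiv.injective _))
  rw [← (Fintype.equivFin ι).symm.sum_comp]
  exact this

variable [CompleteSpace K]

/-- An orthonormal family on which `‖A f‖ ≥ δ` has at most `C / δ^s` members. If it cannot be
prolonged, `A` has norm at most `δ` on the orthogonal complement of its span, so `A` is within `δ`
of a finite-rank operator. -/
theorem OrthoBound.isCompactOperator {A : H →L[ℂ] K} {s C : ℝ} (hs : 0 < s)
    (h : OrthoBound A s C) : IsCompactOperator A := by
  have key : ∀ δ : ℝ, 0 < δ → ∃ T : H →L[ℂ] K, IsCompactOperator T ∧ ‖T - A‖ ≤ δ := by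
    intro δ hδ
    let P : ℕ → Prop := fun n => ∃ f : Fin n → H, Orthonormal ℂ f ∧ ∀ j, δ ≤ ‖A (f j)‖
    -- A length that is attained but not exceeded: otherwise induction gives families of every
    -- length, against the bound `C / δ^s`.
    have hP : ∃ n, P n ∧ ¬ P (n + 1) := by
      by_contra! hcon
      have hall : ∀ n, P n := by
        intro n
        induction n with
        | zero => exact ⟨Fin.elim0, ⟨fun i => i.elim0, fun i => i.elim0⟩, fun i => i.elim0⟩
        | succ n ih => exact hcon n ih
      obtain ⟨n, hn⟩ := exists_nat_gt (C / δ ^ s)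
      obtain ⟨f, hf, hfδ⟩ := hall n
      have h1 := h n f hf
      have h2 : (n : ℝ) * δ ^ s ≤ ∑ j, ‖A (f j)‖ ^ s := by
        calc (n : ℝ) * δ ^ s = ∑ _j : Fin n, δ ^ s := by simp
          _ ≤ _ := Finset.sum_le_sum fun j _ => Real.rpow_le_rpow hδ.le (hfδ j) hs.le
      rw [div_lt_iff₀ (Real.rpow_pos_of_pos hδ s)] at hn
      linarith
    obtain ⟨n, ⟨f, hf, hfδ⟩, hn⟩ := hP
    set F : Submodule ℂ H := Submodule.span ℂ (Set.range f) with hF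
    have : FiniteDimensional ℂ F := FiniteDimensional.span_of_finite ℂ (Set.finite_range f)
    have hsmall : ∀ v ∈ Fᗮ, ‖A v‖ ≤ δ * ‖v‖ := by
      intro v hv
      by_cases hv0 : v = 0
      · simp [hv0]
      by_contra! hcon
      apply hn
      have hvn : 0 < ‖v‖ := norm_pos_iff.2 hv0
      refine ⟨Matrix.vecCons ((‖v‖⁻¹ : ℂ) • v) f, ?_, ?_⟩
      · rw [orthonormal_vecCons_iff]
        refine ⟨?_, fun i => ?_, hf⟩
        · rw [norm_smul]; simp [hvn.ne']
        · rw [inner_smul_left, Submodule.inner_left_of_mem_orthogonal (K := F)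
            (Submodule.subset_span (Set.mem_range_self i)) hv, mul_zero]
      · intro j
        refine Fin.cases ?_ (fun i => ?_) j
        · simp only [Matrix.cons_val_zero, map_smul, norm_smul, norm_inv, Complex.norm_real,
            norm_norm]
          rw [inv_mul_eq_div, le_div_iff₀ hvn]
          exact hcon.le
        · simpa using hfδ i
    refine ⟨A ∘L F.starProjection, ?_, ?_⟩
    · have h1 : IsCompactOperator (id : F → F) :=
        (isCompactOperator_id_iff_finiteDimensional (𝕜 := ℂ)).2 this
      have h2 := (h1.comp_clm F.orthogonalProjectionOnto).clm_comp (A ∘L F.subtypeL)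
      exact h2
    · refine ContinuousLinearMap.opNorm_le_bound _ hδ.le fun v => ?_
      have h1 : (A ∘L F.starProjection - A) v = - A (v - F.starProjection v) := by
        simp
      rw [h1, norm_neg]
      refine (hsmall _ (Submodule.sub_starProjection_mem_orthogonal v)).trans ?_
      refine mul_le_mul_of_nonneg_left ?_ hδ.le
      have h2 := Submodule.starProjection_norm_le (Fᗮ)
      have h3 : v - F.starProjection v = Fᗮ.starProjection v := by
        rw [Submodule.starProjection_orthogonal]; simp
      rw [h3]
      exact (ContinuousLinearMap.le_opNorm _ _).trans
        (by simpa using mul_le_mul_of_nonneg_right h2 (norm_nonneg v))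
  choose! T hT hTA using key
  refine isCompactOperator_of_tendsto (l := Filter.atTop)
    (F := fun n : ℕ => T (1 / ((n : ℝ) + 1))) (f := A) ?_ (Filter.Eventually.of_forall fun n =>
      hT _ (by positivity))
  rw [tendsto_iff_norm_sub_tendsto_zero]
  exact squeeze_zero (fun n => norm_nonneg _) (fun n => hTA _ (by positivity))
    tendsto_one_div_add_atTop_nhds_zero_nat

variable [CompleteSpace H]

/-- `A` and `A^*` have the same singular values. The argument stays in finite dimension: `A^*A`,
compressed to the span of the given family, is diagonalized; the normalized images of the
eigenvectors are test vectors for `A^*`; Jensen's inequality then passes from the eigenbasis to an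
arbitrary orthonormal family, which is where `q ≥ 1` enters. -/
theorem OrthoBound.of_adjoint {A : H →L[ℂ] K} {q C : ℝ} (hq : 1 ≤ q)
    (h : OrthoBound (ContinuousLinearMap.adjoint A) (2 * q) C) : OrthoBound A (2 * q) C := by
  intro n f hf
  set F : Submodule ℂ H := Submodule.span ℂ (Set.range f) with hF
  have : FiniteDimensional ℂ F := FiniteDimensional.span_of_finite ℂ (Set.finite_range f)
  have : CompleteSpace F := FiniteDimensional.complete ℂ F
  set A' : F →L[ℂ] K := A ∘L F.subtypeL with hA'
  set N : F →L[ℂ] F := ContinuousLinearMap.adjoint A' ∘L A' with hN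
  have hNin : ∀ v w : F, ⟪v, N w⟫_ℂ = ⟪A v, A w⟫_ℂ := by
    intro v w
    simp [hN, hA', ContinuousLinearMap.adjoint_inner_right]
  have hsym : (N : F →ₗ[ℂ] F).IsSymmetric := by
    intro v w
    have h1 := hNin v w
    have h2 := hNin w v
    rw [← inner_conj_symm]
    simp only [ContinuousLinearMap.coe_coe]
    rw [h1, h2, inner_conj_symm]
  set u := hsym.eigenvectorBasis rfl with hu
  set Λ := hsym.eigenvalues rfl with hΛ
  have hNu : ∀ k, N (u k) = (Λ k : ℂ) • u k := fun k => hsym.apply_eigenvectorBasis rfl k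
  have huo : Orthonormal ℂ u := u.orthonormal
  have hAA : ∀ k l, ⟪A (u k), A (u l)⟫_ℂ = (Λ l : ℂ) * (if k = l then 1 else 0) := by
    intro k l
    rw [← hNin, hNu, inner_smul_right, orthonormal_iff_ite.1 huo]
  have hΛA : ∀ k, Λ k = ‖A (u k)‖ ^ 2 := by
    intro k
    have := hAA k k
    rw [inner_self_eq_norm_sq_to_K] at this
    simp only [if_true, mul_one] at this
    apply Complex.ofReal_injective
    push_cast
    exact this.symm
  have hΛ0 : ∀ k, 0 ≤ Λ k := fun k => by rw [hΛA]; positivity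
  -- For `Λ_k > 0` the vectors `Λ_k^{-1/2} A u_k` are orthonormal in `K`, and pairing their images
  -- under `A^*` with `u_k` gives `√Λ_k`, a lower bound for the norm.
  have key : ∑ k, Λ k ^ q ≤ C := by
    let ι := {k // 0 < Λ k}
    let g : ι → K := fun k => ((Real.sqrt (Λ k) : ℂ)⁻¹) • A (u k)
    have hg : Orthonormal ℂ g := by
      rw [orthonormal_iff_ite]
      rintro ⟨k, hk⟩ ⟨l, hl⟩
      simp only [g, inner_smul_left, inner_smul_right, hAA]
      by_cases hkl : k = l
      · subst hkl
        have h1 : (Λ k : ℂ) = (Real.sqrt (Λ k) : ℂ) * (Real.sqrt (Λ k) : ℂ) := by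
          rw [← Complex.ofReal_mul, Real.mul_self_sqrt hk.le]
        have h2 : (Real.sqrt (Λ k) : ℂ) ≠ 0 := by
          exact_mod_cast (Real.sqrt_pos.2 hk).ne'
        rw [h1]
        simp only [map_inv₀, Complex.conj_ofReal, mul_one, if_true]
        field_simp
      · have hkl' : ¬ ((⟨k, hk⟩ : ι) = ⟨l, hl⟩) := fun h => hkl (congrArg Subtype.val h)
        simp [hkl, hkl']
    have h1 := h.sum_le hg
    refine le_trans ?_ h1
    have h2 : ∑ k, Λ k ^ q = ∑ k : ι, Λ k ^ q := by
      rw [← Finset.sum_subtype (Finset.univ.filter fun k => 0 < Λ k) (by simp)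
        (fun k => Λ k ^ q), Finset.sum_filter]
      refine Finset.sum_congr rfl fun k _ => ?_
      split_ifs with hk
      · rfl
      · rw [le_antisymm (not_lt.1 hk) (hΛ0 k), Real.zero_rpow (by linarith)]
    rw [h2]
    refine Finset.sum_le_sum fun k _ => ?_
    have hk := k.2
    have h3 : Real.sqrt (Λ k) ≤ ‖ContinuousLinearMap.adjoint A (g k)‖ := by
      have h4 : ⟪(u k : H), ContinuousLinearMap.adjoint A (g k)⟫_ℂ = (Real.sqrt (Λ k) : ℂ) := by
        rw [ContinuousLinearMap.adjoint_inner_right]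
        simp only [g, inner_smul_right, hAA, if_true, mul_one]
        have h1 : (Λ k : ℂ) = (Real.sqrt (Λ k) : ℂ) * (Real.sqrt (Λ k) : ℂ) := by
          rw [← Complex.ofReal_mul, Real.mul_self_sqrt hk.le]
        have h2 : (Real.sqrt (Λ k) : ℂ) ≠ 0 := by
          exact_mod_cast (Real.sqrt_pos.2 hk).ne'
        rw [h1]
        field_simp
      have h5 := norm_inner_le_norm (𝕜 := ℂ) (u k : H) (ContinuousLinearMap.adjoint A (g k))
      rw [h4, Complex.norm_real, Real.norm_of_nonneg (Real.sqrt_nonneg _)] at h5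
      have h6 : ‖(u k : H)‖ = 1 := huo.1 k
      simpa [h6] using h5
    calc Λ k ^ q = Real.sqrt (Λ k) ^ (2 * q) := by
          rw [Real.rpow_mul (Real.sqrt_nonneg _)]
          norm_cast
          rw [Real.sq_sqrt hk.le]
      _ ≤ _ := Real.rpow_le_rpow (Real.sqrt_nonneg _) h3 (by linarith)
  refine le_trans ?_ key
  have hmem : ∀ j, f j ∈ F := fun j => Submodule.subset_span ⟨j, rfl⟩
  let f' : Fin n → F := fun j => ⟨f j, hmem j⟩
  have hf' : Orthonormal ℂ f' := by
    rw [orthonormal_iff_ite] at hf ⊢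
    exact hf
  -- Jensen for `x ↦ x^q` with the probability weights `|⟨u_k, f_j⟩|²`. Summing over `j` afterwards,
  -- Bessel's inequality bounds the total weight of each `k` by one.
  have hJ : ∀ j, ‖A (f j)‖ ^ (2 * q) ≤ ∑ k, ‖⟪u k, f' j⟫_ℂ‖ ^ 2 * Λ k ^ q := by
    intro j
    have h1 : ∑ k, ‖⟪u k, f' j⟫_ℂ‖ ^ 2 = 1 := by
      rw [u.sum_sq_norm_inner_right, hf'.1 j]; norm_num
    have h2 : ‖A (f j)‖ ^ 2 = ∑ k, ‖⟪u k, f' j⟫_ℂ‖ ^ 2 * Λ k := by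
      have h3 := u.sum_inner_mul_inner (f' j) (N (f' j))
      have h4 : ∀ k, ⟪f' j, u k⟫_ℂ * ⟪u k, N (f' j)⟫_ℂ = ((‖⟪u k, f' j⟫_ℂ‖ ^ 2 * Λ k : ℝ) : ℂ) := by
        intro k
        have h5 : ⟪u k, N (f' j)⟫_ℂ = (Λ k : ℂ) * ⟪u k, f' j⟫_ℂ := by
          have := hsym (u k) (f' j)
          simp only [ContinuousLinearMap.coe_coe] at this
          rw [← this, hNu, inner_smul_left, Complex.conj_ofReal]
        rw [h5, ← inner_conj_symm (f' j)]
        push_cast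
        rw [← Complex.conj_mul']
        ring
      simp_rw [h4] at h3
      rw [hNin, inner_self_eq_norm_sq_to_K] at h3
      have : (f' j : H) = f j := rfl
      rw [this] at h3
      apply Complex.ofReal_injective
      rw [Complex.ofReal_sum]
      push_cast at h3 ⊢
      exact h3.symm
    rw [Real.rpow_mul (norm_nonneg _)]
    norm_cast
    rw [h2]
    exact Real.rpow_arith_mean_le_arith_mean_rpow _ _ _ (fun k _ => by positivity) h1
      (fun k _ => hΛ0 k) hq
  calc ∑ j, ‖A (f j)‖ ^ (2 * q) ≤ ∑ j, ∑ k, ‖⟪u k, f' j⟫_ℂ‖ ^ 2 * Λ k ^ q :=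
        Finset.sum_le_sum fun j _ => hJ j
    _ = ∑ k, (∑ j, ‖⟪f' j, u k⟫_ℂ‖ ^ 2) * Λ k ^ q := by
        rw [Finset.sum_comm]
        refine Finset.sum_congr rfl fun k _ => ?_
        rw [Finset.sum_mul]
        refine Finset.sum_congr rfl fun j _ => ?_
        rw [norm_inner_symm]
    _ ≤ ∑ k, 1 * Λ k ^ q := by
        refine Finset.sum_le_sum fun k _ => ?_
        refine mul_le_mul_of_nonneg_right ?_ (Real.rpow_nonneg (hΛ0 k) _)
        refine (hf'.sum_inner_products_le (x := u k) (s := Finset.univ)).trans ?_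
        rw [huo.1 k]; norm_num
    _ = _ := by simp

/-- Singular vectors are admissible test families: if the `e` are orthonormal eigenvectors of `B^*B`
for eigenvalues `s²`, the vectors `s⁻¹ B e` are orthonormal too and `⟨s⁻¹ B e, B e⟩ = s`. Finitely
many singular values suffice, the full sum being a supremum. -/
theorem schattenNorm_le_of_forall_orthonormal {B : H →L[ℂ] H} {q D : ℝ} (hq : 0 < q)
    (h : ∀ (n : ℕ) (e g : Fin n → H), Orthonormal ℂ e → Orthonormal ℂ g →
      ∑ j, ‖⟪g j, B (e j)⟫_ℂ‖ ^ q ≤ D) :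
    schattenNorm q B ≤ ENNReal.ofReal D ^ (1 / q) := by
  rw [schattenNorm]
  refine ENNReal.rpow_le_rpow ?_ (by positivity)
  rw [ENNReal.tsum_eq_iSup_sum]
  refine iSup_le fun S => ?_
  set N : H →L[ℂ] H := (ContinuousLinearMap.adjoint B).comp B with hN
  have hNin : ∀ v w : H, ⟪v, N w⟫_ℂ = ⟪B v, B w⟫_ℂ := by
    intro v w
    simp [hN, ContinuousLinearMap.adjoint_inner_right]
  have hsym : (N : H →ₗ[ℂ] H).IsSymmetric := by
    intro v w
    have h1 := hNin v w
    have h2 := hNin w v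
    rw [← inner_conj_symm]
    simp only [ContinuousLinearMap.coe_coe]
    rw [h1, h2, inner_conj_symm]
  let V : S → Submodule ℂ H := fun s =>
    Module.End.eigenspace (N : H →ₗ[ℂ] H) (((s : ℝ) ^ 2 : ℝ) : ℂ)
  have hV : OrthogonalFamily ℂ (fun s : S => V s) fun s => (V s).subtypeₗᵢ := by
    refine hsym.orthogonalFamily_eigenspaces.comp
      (γ := S) (f := fun s : S => (((s : ℝ) ^ 2 : ℝ) : ℂ)) ?_
    intro s s' hss
    have h1 : ((s : ℝ) ^ 2) = ((s' : ℝ) ^ 2) := Complex.ofReal_injective hss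
    have h2 := (pow_left_inj₀ s.1.2.le s'.1.2.le (by norm_num)).1 h1
    exact Subtype.ext (Subtype.ext h2)
  have hb : ∀ s : S, ∃ b : Fin (singularMultiplicity B s) → V s, Orthonormal ℂ b := by
    intro s
    by_cases hfin : FiniteDimensional ℂ (V s)
    · exact ⟨stdOrthonormalBasis ℂ (V s), (stdOrthonormalBasis ℂ (V s)).orthonormal⟩
    -- An infinite-dimensional eigenspace has `finrank` zero, so it contributes nothing and the
    -- empty family serves.
    · have h0 : singularMultiplicity B s = 0 := Module.finrank_of_not_finite hfin
      rw [h0]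
      exact ⟨Fin.elim0, ⟨fun i => i.elim0, fun i => i.elim0⟩⟩
  choose b hb using hb
  let ι := (s : S) × Fin (singularMultiplicity B s)
  let e : ι → H := fun a => (b a.1 a.2 : H)
  have he : Orthonormal ℂ e := hV.orthonormal_sigma_orthonormal hb
  have hNe : ∀ a : ι, N (e a) = (((a.1 : ℝ) ^ 2 : ℝ) : ℂ) • e a := fun a =>
    Module.End.mem_eigenspace_iff.1 (b a.1 a.2).2
  have hpos : ∀ a : ι, 0 < ((a.1 : S) : ℝ) := fun a => a.1.1.2
  let g : ι → H := fun a => ((((a.1 : ℝ)⁻¹ : ℝ)) : ℂ) • B (e a)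
  classical
  have hBB : ∀ a c : ι, ⟪B (e a), B (e c)⟫_ℂ =
      (((c.1 : ℝ) ^ 2 : ℝ) : ℂ) * (if a = c then 1 else 0) := by
    intro a c
    rw [← hNin, hNe, inner_smul_right, orthonormal_iff_ite.1 he]
  have hg : Orthonormal ℂ g := by
    rw [orthonormal_iff_ite]
    intro a c
    simp only [g, inner_smul_left, inner_smul_right, hBB]
    by_cases hac : a = c
    · subst hac
      have := (hpos a).ne'
      have h2 : (((a.1 : S) : ℝ) : ℂ) ≠ 0 := by exact_mod_cast this
      simp only [if_true, mul_one, map_inv₀, Complex.conj_ofReal, Complex.ofReal_inv,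
        Complex.ofReal_pow]
      field_simp
    · simp [hac]
  have hgB : ∀ a, ‖⟪g a, B (e a)⟫_ℂ‖ = (a.1 : ℝ) := by
    intro a
    have h2 : (((a.1 : S) : ℝ) : ℂ) ≠ 0 := by exact_mod_cast (hpos a).ne'
    have : ⟪g a, B (e a)⟫_ℂ = (((a.1 : S) : ℝ) : ℂ) := by
      simp only [g, inner_smul_left, hBB, if_true, mul_one, map_inv₀, Complex.conj_ofReal,
        Complex.ofReal_inv, Complex.ofReal_pow]
      field_simp
    rw [this, Complex.norm_real, Real.norm_of_nonneg (hpos a).le]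
  have h1 : ∑ a : ι, ((a.1 : S) : ℝ) ^ q ≤ D := by
    have h2 := h _ (e ∘ (Fintype.equivFin ι).symm) (g ∘ (Fintype.equivFin ι).symm)
      (he.comp _ (Equiv.injective _)) (hg.comp _ (Equiv.injective _))
    rw [← (Fintype.equivFin ι).symm.sum_comp]
    simpa [hgB] using h2
  calc ∑ s ∈ S, (singularMultiplicity B s : ℝ≥0∞) * ENNReal.ofReal (s : ℝ) ^ q
      = ENNReal.ofReal (∑ a : ι, ((a.1 : S) : ℝ) ^ q) := by
        rw [Fintype.sum_sigma, ENNReal.ofReal_sum_of_nonneg, ← Finset.sum_coe_sort]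
        · refine Finset.sum_congr rfl fun s _ => ?_
          rw [ENNReal.ofReal_rpow_of_pos s.1.2]
          simp [ENNReal.ofReal_mul]
        · intro s _
          exact Finset.sum_nonneg fun i _ => Real.rpow_nonneg s.1.2.le _
    _ ≤ ENNReal.ofReal D := ENNReal.ofReal_le_ofReal h1

/-- Hölder's inequality for Schatten classes, `2q` times `2q` into `q`: `⟨g, A₁ A₂^* e⟩ = ⟨A₁^* g,
A₂^* e⟩`, followed by Cauchy-Schwarz in `K` and then in the summation index. -/
theorem schattenNorm_comp_adjoint_le {A₁ A₂ : K →L[ℂ] H} {q C₁ C₂ : ℝ} (hq : 1 ≤ q)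
    (h₁ : OrthoBound A₁ (2 * q) C₁) (h₂ : OrthoBound A₂ (2 * q) C₂) :
    schattenNorm q (A₁.comp (ContinuousLinearMap.adjoint A₂)) ≤
      ENNReal.ofReal (Real.sqrt C₁ * Real.sqrt C₂) ^ (1 / q) := by
  refine schattenNorm_le_of_forall_orthonormal (by linarith) fun n e g he hg => ?_
  have h₁' : OrthoBound (ContinuousLinearMap.adjoint A₁) (2 * q) C₁ :=
    OrthoBound.of_adjoint hq (by rwa [ContinuousLinearMap.adjoint_adjoint])
  have h₂' : OrthoBound (ContinuousLinearMap.adjoint A₂) (2 * q) C₂ :=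
    OrthoBound.of_adjoint hq (by rwa [ContinuousLinearMap.adjoint_adjoint])
  have hpow : ∀ v : K, (‖v‖ ^ q) ^ 2 = ‖v‖ ^ (2 * q) := by
    intro v
    rw [← Real.rpow_natCast, ← Real.rpow_mul (norm_nonneg _), mul_comm]
    norm_num
  calc ∑ j, ‖⟪g j, (A₁.comp (ContinuousLinearMap.adjoint A₂)) (e j)⟫_ℂ‖ ^ q
      ≤ ∑ j, ‖ContinuousLinearMap.adjoint A₁ (g j)‖ ^ q *
          ‖ContinuousLinearMap.adjoint A₂ (e j)‖ ^ q := by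
        refine Finset.sum_le_sum fun j _ => ?_
        rw [← Real.mul_rpow (norm_nonneg _) (norm_nonneg _)]
        refine Real.rpow_le_rpow (norm_nonneg _) ?_ (by linarith)
        rw [ContinuousLinearMap.comp_apply, ← ContinuousLinearMap.adjoint_inner_left]
        exact norm_inner_le_norm _ _
    _ ≤ Real.sqrt (∑ j, (‖ContinuousLinearMap.adjoint A₁ (g j)‖ ^ q) ^ 2) *
        Real.sqrt (∑ j, (‖ContinuousLinearMap.adjoint A₂ (e j)‖ ^ q) ^ 2) :=
        Real.sum_mul_le_sqrt_mul_sqrt _ _ _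
    _ ≤ _ := by
        simp_rw [hpow]
        exact mul_le_mul (Real.sqrt_le_sqrt (h₁' n g hg)) (Real.sqrt_le_sqrt (h₂' n e he))
          (Real.sqrt_nonneg _) (Real.sqrt_nonneg _)

end OrthoBound

/-! ### The one-dimensional Hardy-Littlewood-Sobolev inequality on the diagonal -/

theorem lintegral_comp_abs_eq (g : ℝ → ℝ≥0∞) :
    ∫⁻ s : ℝ, g |s| = 2 * ∫⁻ s in Set.Ioi (0 : ℝ), g s := by
  have h1 : ∫⁻ s in Set.Ioi (0 : ℝ), g |s| = ∫⁻ s in Set.Ioi (0 : ℝ), g s :=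
    setLIntegral_congr_fun measurableSet_Ioi fun s hs => by
      rw [abs_of_pos (Set.mem_Ioi.1 hs)]
  have h2 : ∫⁻ s in Set.Iio (0 : ℝ), g |s| = ∫⁻ s in Set.Ioi (0 : ℝ), g s := by
    rw [← h1]
    have := (Measure.measurePreserving_neg (volume : Measure ℝ)).setLIntegral_comp_preimage_emb
      (MeasurableEquiv.neg ℝ).measurableEmbedding (fun s => g |s|) (Set.Ioi (0 : ℝ))
    simpa using this
  rw [← lintegral_add_compl _ (measurableSet_Ioi (a := (0 : ℝ))), h1, Set.compl_Ioi,
    setLIntegral_congr Iio_ae_eq_Iic.symm, h2, two_mul]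

theorem lintegral_abs_rpow_near {γ : ℝ} (hγ1 : γ < 1) {ρ : ℝ} (hρ : 0 < ρ) (t : ℝ) :
    ∫⁻ s in {s : ℝ | |t - s| < ρ}, ‖t - s‖ₑ ^ (-γ) =
      ENNReal.ofReal (2 * (ρ ^ (1 - γ) / (1 - γ))) := by
  have hm : MeasurableSet {s : ℝ | |t - s| < ρ} :=
    measurableSet_lt (by fun_prop) measurable_const
  rw [← lintegral_indicator hm]
  let g : ℝ → ℝ≥0∞ := fun a => (Set.Iio ρ).indicator (fun a => ENNReal.ofReal a ^ (-γ)) a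
  have h1 : ∀ s, ({s : ℝ | |t - s| < ρ}.indicator (fun s => ‖t - s‖ₑ ^ (-γ)) s) = g |t - s| := by
    intro s
    simp only [g, Set.indicator, Set.mem_ofPred_eq, Set.mem_Iio]
    rw [← ofReal_norm, Real.norm_eq_abs]
  simp_rw [h1]
  rw [lintegral_sub_left_eq_self (fun a => g |a|) t, lintegral_comp_abs_eq]
  rw [ENNReal.ofReal_mul (by norm_num), ENNReal.ofReal_ofNat]
  congr 1
  simp only [g]
  rw [setLIntegral_indicator measurableSet_Iio, Set.inter_comm, Set.Ioi_inter_Iio]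
  have h2 : ∫ s in (0 : ℝ)..ρ, s ^ (-γ) = ρ ^ (1 - γ) / (1 - γ) := by
    rw [integral_rpow (Or.inl (by linarith)), Real.zero_rpow (by linarith)]
    ring_nf
  have h3 : IntervalIntegrable (fun s : ℝ => s ^ (-γ)) volume 0 ρ :=
    intervalIntegral.intervalIntegrable_rpow' (by linarith)
  rw [← h2, intervalIntegral.integral_of_le hρ.le, ofReal_integral_eq_lintegral_ofReal
    ((intervalIntegrable_iff_integrableOn_Ioc_of_le hρ.le).1 h3),
    setLIntegral_congr Ioo_ae_eq_Ioc]
  · refine setLIntegral_congr_fun measurableSet_Ioc fun s hs => ?_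
    rw [ENNReal.ofReal_rpow_of_pos hs.1]
  · filter_upwards [ae_restrict_mem measurableSet_Ioc] with s hs using Real.rpow_nonneg hs.1.le _

theorem lintegral_abs_rpow_far {ρ : ℝ} (hρ : 0 < ρ) (t : ℝ) :
    ∫⁻ s in {s : ℝ | |t - s| < ρ}ᶜ, ‖t - s‖ₑ ^ (-2 : ℝ) = ENNReal.ofReal (2 * ρ⁻¹) := by
  have hm : MeasurableSet {s : ℝ | |t - s| < ρ} :=
    measurableSet_lt (by fun_prop) measurable_const
  rw [← lintegral_indicator hm.compl]
  let g : ℝ → ℝ≥0∞ := fun a => (Set.Ici ρ).indicator (fun a => ENNReal.ofReal a ^ (-2 : ℝ)) a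
  have h1 : ∀ s, ({s : ℝ | |t - s| < ρ}ᶜ.indicator (fun s => ‖t - s‖ₑ ^ (-2 : ℝ)) s) =
      g |t - s| := by
    intro s
    simp only [g, Set.indicator, Set.mem_compl_iff, Set.mem_ofPred_eq, Set.mem_Ici, not_lt]
    rw [← ofReal_norm, Real.norm_eq_abs]
  simp_rw [h1]
  rw [lintegral_sub_left_eq_self (fun a => g |a|) t, lintegral_comp_abs_eq]
  rw [ENNReal.ofReal_mul (by norm_num), ENNReal.ofReal_ofNat]
  congr 1
  simp only [g]
  have h0 : Set.Ici ρ ∩ Set.Ioi 0 = Set.Ici ρ :=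
    Set.inter_eq_left.2 fun s hs => lt_of_lt_of_le hρ hs
  rw [setLIntegral_indicator measurableSet_Ici, h0]
  have h2 : ∫ s in Set.Ioi ρ, s ^ (-2 : ℝ) = ρ⁻¹ := by
    rw [integral_Ioi_rpow_of_lt (by norm_num) hρ]
    norm_num
    rw [Real.rpow_neg_one]
  rw [← h2, ofReal_integral_eq_lintegral_ofReal
    (integrableOn_Ioi_rpow_of_lt (by norm_num) hρ), ← setLIntegral_congr Ioi_ae_eq_Ici]
  · refine setLIntegral_congr_fun measurableSet_Ioi fun s hs => ?_
    rw [ENNReal.ofReal_rpow_of_pos (hρ.trans hs)]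
  · filter_upwards [ae_restrict_mem measurableSet_Ioi] with s hs using
      Real.rpow_nonneg (hρ.trans hs).le _

/-- Near `t` the minimum is replaced by `a` and the singularity is integrable since `γ < 1`; away
from `t` it is replaced by `h`, and Hölder's inequality applies. -/
theorem lintegral_min_mul_rpow_le {γ : ℝ} (hγ0 : 0 < γ) (hγ1 : γ < 1) {h : ℝ → ℝ≥0∞}
    (hh : Measurable h) {a n : ℝ} (ha : 0 < a) (hn : 0 < n)
    (hI : ∫⁻ s, h s ^ (2 / (2 - γ)) ≤ ENNReal.ofReal (n ^ (2 / (2 - γ)))) (t : ℝ) :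
    ∫⁻ s, min (h s) (ENNReal.ofReal a) * ‖t - s‖ₑ ^ (-γ) ≤
      ENNReal.ofReal ((2 / (1 - γ) + 2) * (a ^ (2 / (2 - γ) - 1) * n ^ (2 - 2 / (2 - γ)))) := by
  set r : ℝ := 2 / (2 - γ) with hr
  have h2γ : 0 < 2 - γ := by linarith
  have hr0 : 0 < r := by positivity
  have hrγ : r * γ = 2 * r - 2 := by
    rw [hr]; field_simp; ring
  -- The radius that balances the near part `a ρ^{1-γ}` against the far part `n ρ^{-γ/2}`.
  set ρ : ℝ := (n / a) ^ r with hρd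
  have hna : 0 < n / a := by positivity
  have hρ : 0 < ρ := Real.rpow_pos_of_pos hna r
  have hm : MeasurableSet {s : ℝ | |t - s| < ρ} :=
    measurableSet_lt (by fun_prop) measurable_const
  rw [← lintegral_add_compl _ hm]
  have hk : Measurable fun s : ℝ => ‖t - s‖ₑ ^ (-γ) := by fun_prop
  have hnear : ∫⁻ s in {s : ℝ | |t - s| < ρ}, min (h s) (ENNReal.ofReal a) * ‖t - s‖ₑ ^ (-γ) ≤
      ENNReal.ofReal (2 / (1 - γ) * (a ^ (r - 1) * n ^ (2 - r))) := by
    calc _ ≤ ∫⁻ s in {s : ℝ | |t - s| < ρ}, ENNReal.ofReal a * ‖t - s‖ₑ ^ (-γ) :=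
          lintegral_mono fun s => by gcongr; exact min_le_right _ _
      _ = ENNReal.ofReal (a * (2 * (ρ ^ (1 - γ) / (1 - γ)))) := by
          rw [lintegral_const_mul _ hk, lintegral_abs_rpow_near hγ1 hρ, ENNReal.ofReal_mul ha.le]
      _ = _ := by
          congr 1
          have : a * ρ ^ (1 - γ) = a ^ (r - 1) * n ^ (2 - r) := by
            rw [hρd, ← Real.rpow_mul hna.le, show r * (1 - γ) = 2 - r by linarith,
              Real.div_rpow hn.le ha.le]
            have h1 : a ^ (r - 1) = a / a ^ (2 - r) := by
              rw [eq_div_iff (by positivity), ← Real.rpow_add ha]; norm_num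
            rw [h1]; field_simp
          rw [← this]; ring
  have hfar : ∫⁻ s in {s : ℝ | |t - s| < ρ}ᶜ, min (h s) (ENNReal.ofReal a) * ‖t - s‖ₑ ^ (-γ) ≤
      ENNReal.ofReal (2 * (a ^ (r - 1) * n ^ (2 - r))) := by
    have hr1 : 1 < r := by rw [hr, lt_div_iff₀ h2γ]; linarith
    -- With the conjugate exponent `2/γ` the kernel becomes `|t - s|^{-2}`, integrable at infinity
    -- whatever `γ` is.
    have hconj : r.HolderConjugate (2 / γ) := by
      rw [Real.holderConjugate_iff]
      refine ⟨hr1, ?_⟩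
      rw [hr]; field_simp; ring
    calc _ ≤ ∫⁻ s in {s : ℝ | |t - s| < ρ}ᶜ, (h * fun s => ‖t - s‖ₑ ^ (-γ)) s :=
          lintegral_mono fun s => by
            simp only [Pi.mul_apply]
            gcongr; exact min_le_left _ _
      _ ≤ (∫⁻ s in {s : ℝ | |t - s| < ρ}ᶜ, h s ^ r) ^ (1 / r) *
          (∫⁻ s in {s : ℝ | |t - s| < ρ}ᶜ, (‖t - s‖ₑ ^ (-γ)) ^ (2 / γ)) ^ (1 / (2 / γ)) :=
          ENNReal.lintegral_mul_le_Lp_mul_Lq _ hconj hh.aemeasurable hk.aemeasurable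
      _ ≤ ENNReal.ofReal n * ENNReal.ofReal (2 * ρ⁻¹) ^ (γ / 2) := by
          gcongr
          · calc (∫⁻ s in {s : ℝ | |t - s| < ρ}ᶜ, h s ^ r) ^ (1 / r)
                ≤ (ENNReal.ofReal (n ^ r)) ^ (1 / r) := by
                  gcongr
                  exact (setLIntegral_le_lintegral _ _).trans hI
              _ = _ := by
                rw [ENNReal.ofReal_rpow_of_nonneg (by positivity) (by positivity),
                  ← Real.rpow_mul hn.le]
                congr 1
                rw [mul_one_div_cancel hr0.ne', Real.rpow_one]
          · rw [one_div_div]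
            refine ENNReal.rpow_le_rpow (le_of_eq ?_) (by positivity)
            rw [← lintegral_abs_rpow_far hρ t]
            refine lintegral_congr fun s => ?_
            rw [← ENNReal.rpow_mul]
            congr 1
            field_simp
      _ ≤ _ := by
          rw [ENNReal.ofReal_rpow_of_pos (by positivity), ← ENNReal.ofReal_mul hn.le]
          refine ENNReal.ofReal_le_ofReal ?_
          have h2 : (2 : ℝ) ^ (γ / 2) ≤ 2 := by
            calc (2 : ℝ) ^ (γ / 2) ≤ 2 ^ (1 : ℝ) :=
                  Real.rpow_le_rpow_of_exponent_le (by norm_num) (by linarith)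
              _ = 2 := by norm_num
          have h3 : n * (ρ⁻¹) ^ (γ / 2) = a ^ (r - 1) * n ^ (2 - r) := by
            rw [hρd, ← Real.rpow_neg hna.le, ← Real.rpow_mul hna.le,
              show -r * (γ / 2) = 1 - r by linarith, Real.div_rpow hn.le ha.le]
            have h1 : a ^ (r - 1) = (a ^ (1 - r))⁻¹ := by
              rw [← Real.rpow_neg ha.le]; ring_nf
            have h4 : n ^ (2 - r) = n * n ^ (1 - r) := by
              nth_rewrite 2 [← Real.rpow_one n]
              rw [← Real.rpow_add hn]; ring_nf
            rw [h1, h4]; field_simp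
          rw [Real.mul_rpow (by norm_num) (by positivity)]
          calc n * (2 ^ (γ / 2) * (ρ⁻¹) ^ (γ / 2)) = 2 ^ (γ / 2) * (n * (ρ⁻¹) ^ (γ / 2)) := by ring
            _ ≤ 2 * (n * (ρ⁻¹) ^ (γ / 2)) := by gcongr
            _ = _ := by rw [h3]
  refine (add_le_add hnear hfar).trans (le_of_eq ?_)
  have : 0 < 1 - γ := by linarith
  rw [← ENNReal.ofReal_add (by positivity) (by positivity)]
  congr 1; ring

/-- The constant in the Hardy-Littlewood-Sobolev inequality. -/
noncomputable def hlsConst (γ : ℝ) : ℝ := 2 * (2 / (1 - γ) + 2)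

theorem hlsConst_pos {γ : ℝ} (hγ1 : γ < 1) : 0 < hlsConst γ := by
  have : 0 < 1 - γ := by linarith
  rw [hlsConst]; positivity

/-- Only the diagonal form is needed, and symmetry makes it elementary. Where `h s ≤ h t`, the
factor `h s` is the minimum of the two, so the truncated bound at height `a = h t` gives `h(t)^{r-1}
n^{2-r}` for the inner integral. Multiplying by `h t` leaves `h(t)^r`, whose integral is `n^r`. -/
theorem hardy_littlewood_sobolev {γ : ℝ} (hγ0 : 0 < γ) (hγ1 : γ < 1) {h : ℝ → ℝ≥0∞}
    (hh : Measurable h) :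
    ∫⁻ t, ∫⁻ s, h t * h s * ‖t - s‖ₑ ^ (-γ) ≤
      ENNReal.ofReal (hlsConst γ) * (∫⁻ t, h t ^ (2 / (2 - γ))) ^ (2 - γ) := by
  set r : ℝ := 2 / (2 - γ) with hr
  have h2γ : 0 < 2 - γ := by linarith
  have hr0 : 0 < r := by positivity
  have h1γ : 0 < 1 - γ := by linarith
  have hr1 : 1 < r := by rw [hr, lt_div_iff₀ h2γ]; linarith
  have hr2 : r < 2 := by rw [hr, div_lt_iff₀ h2γ]; linarith
  have hC := hlsConst_pos hγ1
  set I := ∫⁻ t, h t ^ r with hI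
  by_cases hItop : I = ∞
  · rw [hItop, ENNReal.top_rpow_of_pos h2γ, ENNReal.mul_top (by simpa using hC)]
    exact le_top
  by_cases hI0 : I = 0
  · have h0 : ∀ᵐ t, h t = 0 := by
      have := (lintegral_eq_zero_iff (hh.pow_const r)).1 hI0
      filter_upwards [this] with t ht
      exact (ENNReal.rpow_eq_zero_iff_of_pos hr0).1 ht
    have : ∫⁻ t, ∫⁻ s, h t * h s * ‖t - s‖ₑ ^ (-γ) = 0 := by
      rw [lintegral_eq_zero_of_ae_eq_zero]
      filter_upwards [h0] with t ht
      simp [ht]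
    rw [this]; exact zero_le
  set n : ℝ := I.toReal ^ (1 / r) with hn
  have hIpos : 0 < I.toReal := ENNReal.toReal_pos hI0 hItop
  have hnpos : 0 < n := Real.rpow_pos_of_pos hIpos _
  have hnr : n ^ r = I.toReal := by
    rw [hn, ← Real.rpow_mul hIpos.le, one_div_mul_cancel hr0.ne', Real.rpow_one]
  have hIn : I = ENNReal.ofReal (n ^ r) := by rw [hnr, ENNReal.ofReal_toReal hItop]
  -- The half of the double integral in which the value at `t` is the larger one; the other half is
  -- its transpose.
  let k : ℝ → ℝ → ℝ≥0∞ := fun t s => h t * (min (h s) (h t) * ‖t - s‖ₑ ^ (-γ))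
  have hkm : Measurable (Function.uncurry k) := by
    simp only [k, Function.uncurry_def]
    fun_prop
  have hsplit : ∀ t s, h t * h s * ‖t - s‖ₑ ^ (-γ) ≤ k t s + k s t := by
    intro t s
    simp only [k]
    rw [enorm_sub_rev s t]
    rcases le_total (h s) (h t) with hle | hle
    · rw [min_eq_left hle, mul_assoc]; exact le_self_add
    · rw [min_eq_left hle, mul_comm (h t) (h s), mul_assoc (h s)]; exact le_add_self
  have hfin : ∀ᵐ t, h t ^ r < ∞ := ae_lt_top (hh.pow_const r) hItop
  have hk : ∫⁻ t, ∫⁻ s, k t s ≤ ENNReal.ofReal ((2 / (1 - γ) + 2) * n ^ (2 : ℝ)) := by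
    calc ∫⁻ t, ∫⁻ s, k t s
        ≤ ∫⁻ t, ENNReal.ofReal ((2 / (1 - γ) + 2) * n ^ (2 - r)) * h t ^ r := by
          refine lintegral_mono_ae ?_
          filter_upwards [hfin] with t ht
          have ht' : h t ≠ ∞ := by
            intro h1; rw [h1, ENNReal.top_rpow_of_pos hr0] at ht; exact lt_irrefl _ ht
          by_cases ht0 : h t = 0
          · simp [k, ht0]
          have ha : 0 < (h t).toReal := ENNReal.toReal_pos ht0 ht'
          simp only [k]
          rw [lintegral_const_mul _ (by fun_prop)]
          have h1 := lintegral_min_mul_rpow_le hγ0 hγ1 hh ha hnpos hIn.le t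
          rw [ENNReal.ofReal_toReal ht', ← hr] at h1
          refine (mul_le_mul_right h1 _).trans (le_of_eq ?_)
          nth_rewrite 1 [← ENNReal.ofReal_toReal ht']
          nth_rewrite 3 [← ENNReal.ofReal_toReal ht']
          rw [ENNReal.ofReal_rpow_of_pos ha, ← ENNReal.ofReal_mul ha.le,
            ← ENNReal.ofReal_mul (by positivity)]
          congr 1
          have h4 : (h t).toReal ^ r = (h t).toReal * (h t).toReal ^ (r - 1) := by
            nth_rewrite 2 [← Real.rpow_one (h t).toReal]
            rw [← Real.rpow_add ha]; ring_nf
          rw [h4]; ring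
      _ = _ := by
          rw [lintegral_const_mul _ (hh.pow_const r), ← hI, hIn,
            ← ENNReal.ofReal_mul (by positivity)]
          congr 1
          rw [mul_assoc, ← Real.rpow_add hnpos]
          ring_nf
  calc ∫⁻ t, ∫⁻ s, h t * h s * ‖t - s‖ₑ ^ (-γ)
      ≤ ∫⁻ t, ∫⁻ s, (k t s + k s t) := lintegral_mono fun t => lintegral_mono fun s => hsplit t s
    _ = ∫⁻ t, ((∫⁻ s, k t s) + ∫⁻ s, k s t) := by
        refine lintegral_congr fun t => ?_
        exact lintegral_add_left (hkm.comp (measurable_prodMk_left (x := t))) _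
    _ = (∫⁻ t, ∫⁻ s, k t s) + ∫⁻ t, ∫⁻ s, k s t := by
        exact lintegral_add_left hkm.lintegral_prod_right' _
    _ = 2 * ∫⁻ t, ∫⁻ s, k t s := by
        rw [lintegral_lintegral_swap (f := fun t s => k s t)
          (hkm.comp measurable_swap).aemeasurable, two_mul]
    _ ≤ 2 * ENNReal.ofReal ((2 / (1 - γ) + 2) * n ^ (2 : ℝ)) := by gcongr
    _ = _ := by
        rw [hIn, ENNReal.ofReal_rpow_of_pos (by positivity), ← ENNReal.ofReal_mul hC.le,
          ← Real.rpow_mul hnpos.le, show r * (2 - γ) = 2 by rw [hr]; field_simp,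
          ← ENNReal.ofReal_ofNat, ← ENNReal.ofReal_mul (by norm_num), hlsConst]
        congr 1; ring


/-! ### The Fourier transform on `L¹ ∩ L²` -/

section Fourier

variable {d : ℕ}

/-- The `L²` transform agrees with the transform of tempered distributions, and the integral
transform satisfies the same duality formula against Schwartz functions. Testing against smooth
functions of compact support identifies the two. -/
theorem fourierInv_ae_eq (F : Lp ℂ 2 (volume : Measure (Space d))) (hF : Integrable F volume) :
    (𝓕⁻ F : Lp ℂ 2 (volume : Measure (Space d))) =ᵐ[volume] 𝓕⁻ (F : Space d → ℂ) := by
  have hcont : Continuous (𝓕⁻ (F : Space d → ℂ)) :=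
    VectorFourier.fourierIntegral_continuous Real.continuous_fourierChar
      (by simp only [LinearMap.neg_apply, innerₗ_apply_apply]; fun_prop) hF
  refine ae_eq_of_integral_contDiff_smul_eq ((Lp.memLp _).locallyIntegrable (by norm_num))
    hcont.locallyIntegrable fun g hg hgs => ?_
  have hg₁ : HasCompactSupport (Complex.ofRealCLM ∘ g) := hgs.comp_left rfl
  have hg₂ : ContDiff ℝ (⊤ : ℕ∞) (Complex.ofRealCLM ∘ g) := by fun_prop
  set G := hg₁.toSchwartzMap hg₂ with hG
  have h1 := congrArg (fun T => T G) (Lp.fourierInv_toTemperedDistribution_eq F)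
  simp only [TemperedDistribution.fourierInv_apply, Lp.toTemperedDistribution_apply] at h1
  have h2 : ∫ x, 𝓕⁻ (G : Space d → ℂ) x • F x = ∫ x, G x • 𝓕⁻ (F : Space d → ℂ) x := by
    have := VectorFourier.integral_fourierIntegral_smul_eq_flip (μ := (volume : Measure (Space d)))
      (ν := (volume : Measure (Space d))) (L := -innerₗ (Space d)) Real.continuous_fourierChar
      (by simp only [LinearMap.neg_apply, innerₗ_apply_apply]; fun_prop)
      (G.integrable (μ := volume)) hF
    have hflip : (-innerₗ (Space d)).flip = -innerₗ (Space d) := by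
      ext x y; simp [real_inner_comm]
    rw [hflip] at this
    exact this
  have h3 : ∀ x, (𝓕⁻ G : SchwartzMap (Space d) ℂ) x = 𝓕⁻ (G : Space d → ℂ) x := fun x => by
    rw [SchwartzMap.fourierInv_coe]
  simp_rw [h3] at h1
  rw [h2] at h1
  simpa [hG] using h1.symm

theorem fourier_ae_eq (F : Lp ℂ 2 (volume : Measure (Space d))) (hF : Integrable F volume) :
    (𝓕 F : Lp ℂ 2 (volume : Measure (Space d))) =ᵐ[volume] 𝓕 (F : Space d → ℂ) := by
  have hcont : Continuous (𝓕 (F : Space d → ℂ)) :=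
    VectorFourier.fourierIntegral_continuous Real.continuous_fourierChar
      (by simp only [innerₗ_apply_apply]; fun_prop) hF
  refine ae_eq_of_integral_contDiff_smul_eq ((Lp.memLp _).locallyIntegrable (by norm_num))
    hcont.locallyIntegrable fun g hg hgs => ?_
  have hg₁ : HasCompactSupport (Complex.ofRealCLM ∘ g) := hgs.comp_left rfl
  have hg₂ : ContDiff ℝ (⊤ : ℕ∞) (Complex.ofRealCLM ∘ g) := by fun_prop
  set G := hg₁.toSchwartzMap hg₂ with hG
  have h1 := congrArg (fun T => T G) (Lp.fourier_toTemperedDistribution_eq F)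
  simp only [TemperedDistribution.fourier_apply, Lp.toTemperedDistribution_apply] at h1
  have h2 : ∫ x, 𝓕 (G : Space d → ℂ) x • F x = ∫ x, G x • 𝓕 (F : Space d → ℂ) x := by
    have := VectorFourier.integral_fourierIntegral_smul_eq_flip (μ := (volume : Measure (Space d)))
      (ν := (volume : Measure (Space d))) (L := innerₗ (Space d)) Real.continuous_fourierChar
      (by simp only [innerₗ_apply_apply]; fun_prop) (G.integrable (μ := volume)) hF
    rw [flip_innerₗ] at this
    exact this
  have h3 : ∀ x, (𝓕 G : SchwartzMap (Space d) ℂ) x = 𝓕 (G : Space d → ℂ) x := fun x => by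
    rw [SchwartzMap.fourier_coe]
  simp_rw [h3] at h1
  rw [h2] at h1
  simpa [hG] using h1.symm

theorem eLpNorm_fourier_eq {φ : Space d → ℂ} (h1 : Integrable φ volume) (h2 : MemLp φ 2 volume) :
    eLpNorm (𝓕 φ) 2 volume = eLpNorm φ 2 volume := by
  have hφ : (h2.toLp φ : Space d → ℂ) =ᵐ[volume] φ := h2.coeFn_toLp
  have h3 := fourier_ae_eq (h2.toLp φ) (h1.congr hφ.symm)
  have h4 : 𝓕 (h2.toLp φ : Space d → ℂ) = 𝓕 φ := funext fun x => Real.fourier_congr_ae hφ x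
  rw [h4] at h3
  rw [← eLpNorm_congr_ae h3, ← eLpNorm_congr_ae hφ, ← Lp.enorm_def, ← Lp.enorm_def,
    ← ofReal_norm, ← ofReal_norm, Lp.norm_fourier_eq]

theorem continuous_fourier {φ : Space d → ℂ} (h1 : Integrable φ volume) : Continuous (𝓕 φ) :=
  VectorFourier.fourierIntegral_continuous Real.continuous_fourierChar
    (by simp only [innerₗ_apply_apply]; fun_prop) h1

end Fourier

/-! ### Gaussian kernels -/

section Gauss

variable {d : ℕ}

/-- The Fourier transform of `exp (-b |ξ|²)`. -/
noncomputable def gaussKernel (b : ℂ) (x : Space d) : ℂ :=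
  (Real.pi / b) ^ ((d / 2 : ℝ) : ℂ) * Complex.exp (-Real.pi ^ 2 * ‖x‖ ^ 2 / b)

theorem integral_gauss_mul_exp {b : ℂ} (hb : 0 < b.re) (w : Space d) :
    ∫ ξ : Space d, Complex.exp (-b * ‖ξ‖ ^ 2) *
      Complex.exp (((-2 * Real.pi * ⟪w, ξ⟫_ℝ : ℝ) : ℂ) * Complex.I) = gaussKernel b w := by
  have h := fourier_gaussian_innerProductSpace (V := Space d) hb w
  rw [Real.fourier_eq', finrank_euclideanSpace_fin] at h
  rw [gaussKernel]
  push_cast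
  rw [← h]
  refine integral_congr_ae (Filter.Eventually.of_forall fun ξ => ?_)
  simp only [smul_eq_mul, real_inner_comm]
  push_cast
  ring

/-- The dispersive estimate: `Re (1/b) ≥ 0`, so the exponential has modulus at most one. -/
theorem norm_gaussKernel_le {b : ℂ} (hb : 0 < b.re) (x : Space d) :
    ‖gaussKernel b x‖ ≤ (Real.pi / ‖b‖) ^ ((d : ℝ) / 2) := by
  rw [gaussKernel, norm_mul, Complex.norm_exp]
  have h1 : ‖((Real.pi : ℂ) / b) ^ ((d / 2 : ℝ) : ℂ)‖ = (Real.pi / ‖b‖) ^ ((d : ℝ) / 2) := by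
    rw [Complex.norm_cpow_real, norm_div, Complex.norm_real, Real.norm_of_nonneg Real.pi_pos.le]
  rw [h1]
  refine mul_le_of_le_one_right (by positivity) ?_
  rw [Real.exp_le_one_iff]
  have h2 : (-(Real.pi : ℂ) ^ 2 * (‖x‖ : ℂ) ^ 2 / b) =
      ((-(Real.pi ^ 2 * ‖x‖ ^ 2) : ℝ) : ℂ) * b⁻¹ := by push_cast; ring
  rw [h2, Complex.re_ofReal_mul, Complex.inv_re]
  have : 0 ≤ b.re / Complex.normSq b := div_nonneg hb.le (Complex.normSq_nonneg b)
  have h3 : 0 ≤ Real.pi ^ 2 * ‖x‖ ^ 2 := by positivity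
  nlinarith

theorem measurable_gaussKernel :
    Measurable fun z : ℂ × Space d => gaussKernel z.1 z.2 := by
  unfold gaussKernel
  fun_prop

theorem integrable_gauss {b : ℂ} (hb : 0 < b.re) :
    Integrable (fun ξ : Space d => Complex.exp (-b * ‖ξ‖ ^ 2)) volume := by
  simpa using GaussianFourier.integrable_cexp_neg_mul_sq_norm_add hb 0 (0 : Space d)

/-- Fubini's theorem for a weighted product of two oscillatory integrals. -/
theorem integral_mul_conj_integral_eq {Y E : Type*} [MeasurableSpace Y] [MeasurableSpace E]
    {μ : Measure Y} {ν : Measure E} [SFinite μ] [SFinite ν] {m : E → ℂ} (hm : Integrable m ν)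
    {χ : Y → E → ℂ} (hχ : Measurable (Function.uncurry χ)) (hχ1 : ∀ y ξ, ‖χ y ξ‖ ≤ 1)
    {Φ Ψ : Y → ℂ} (hΦ : Integrable Φ μ) (hΨ : Integrable Ψ μ) :
    ∫ ξ, m ξ * ((∫ y, Φ y * χ y ξ ∂μ) * starRingEnd ℂ (∫ y, Ψ y * χ y ξ ∂μ)) ∂ν =
      ∫ z : Y × Y, Φ z.1 * starRingEnd ℂ (Ψ z.2) *
        (∫ ξ, m ξ * (χ z.1 ξ * starRingEnd ℂ (χ z.2 ξ)) ∂ν) ∂(μ.prod μ) := by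
  have hconj : ∀ ξ, starRingEnd ℂ (∫ y, Ψ y * χ y ξ ∂μ) =
      ∫ y, starRingEnd ℂ (Ψ y) * starRingEnd ℂ (χ y ξ) ∂μ := by
    intro ξ
    rw [← integral_conj]
    simp
  have h1 : ∀ ξ, m ξ * ((∫ y, Φ y * χ y ξ ∂μ) * starRingEnd ℂ (∫ y, Ψ y * χ y ξ ∂μ)) =
      ∫ z : Y × Y, m ξ * ((Φ z.1 * χ z.1 ξ) * (starRingEnd ℂ (Ψ z.2) * starRingEnd ℂ (χ z.2 ξ)))
        ∂(μ.prod μ) := by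
    intro ξ
    rw [hconj, ← integral_prod_mul, integral_const_mul]
  simp_rw [h1]
  rw [integral_integral_swap]
  · refine integral_congr_ae (Filter.Eventually.of_forall fun z => ?_)
    simp only
    rw [← integral_const_mul]
    refine integral_congr_ae (Filter.Eventually.of_forall fun ξ => ?_)
    simp only
    ring
  · have hbase : Integrable (fun p : E × (Y × Y) => m p.1 * (Φ p.2.1 * starRingEnd ℂ (Ψ p.2.2)))
        (ν.prod (μ.prod μ)) := by
      have hΨc : Integrable (fun y => starRingEnd ℂ (Ψ y)) μ :=
        (LinearIsometryEquiv.integrable_comp_iff Complex.conjLIE).2 hΨ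
      have h2 : Integrable (fun z : Y × Y => Φ z.1 * starRingEnd ℂ (Ψ z.2)) (μ.prod μ) :=
        hΦ.mul_prod hΨc
      exact hm.mul_prod h2
    have hb : Integrable (fun p : E × (Y × Y) => (χ p.2.1 p.1 * starRingEnd ℂ (χ p.2.2 p.1)) *
        (m p.1 * (Φ p.2.1 * starRingEnd ℂ (Ψ p.2.2)))) (ν.prod (μ.prod μ)) := by
      refine hbase.bdd_mul (c := 1) ?_ (Filter.Eventually.of_forall fun p => ?_)
      · refine Measurable.aestronglyMeasurable ?_
        have h1 : Measurable fun p : E × (Y × Y) => χ p.2.1 p.1 :=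
          hχ.comp ((measurable_fst.comp measurable_snd).prodMk measurable_fst)
        have h2 : Measurable fun p : E × (Y × Y) => χ p.2.2 p.1 :=
          hχ.comp ((measurable_snd.comp measurable_snd).prodMk measurable_fst)
        exact h1.mul (Complex.continuous_conj.measurable.comp h2)
      · rw [norm_mul, RCLike.norm_conj]
        exact mul_le_one₀ (hχ1 _ _) (norm_nonneg _) (hχ1 _ _)
    refine hb.congr (Filter.Eventually.of_forall fun p => ?_)
    simp only [Function.uncurry]
    ring

/-- Convolution with the kernel is the Fourier multiplier `e^{-b|ξ|²}`, of modulus at most one,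
hence a contraction of `L²`. The bound is uniform in `b`, so the time variable is left for the
Hardy-Littlewood-Sobolev inequality. -/
theorem enorm_integral_gaussKernel_le {b : ℂ} (hb : 0 < b.re) {φ ψ : Space d → ℂ}
    (hφ1 : Integrable φ volume) (hφ2 : MemLp φ 2 volume)
    (hψ1 : Integrable ψ volume) (hψ2 : MemLp ψ 2 volume) :
    ‖∫ z : Space d × Space d, φ z.1 * starRingEnd ℂ (ψ z.2) * gaussKernel b (z.1 - z.2)‖ₑ ≤
      eLpNorm φ 2 volume * eLpNorm ψ 2 volume := by
  let χ : Space d → Space d → ℂ := fun x ξ =>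
    Complex.exp (((-2 * Real.pi * ⟪x, ξ⟫_ℝ : ℝ) : ℂ) * Complex.I)
  have hχ : Measurable (Function.uncurry χ) := by
    apply Continuous.measurable
    simp only [χ, Function.uncurry_def]
    fun_prop
  have hχ1 : ∀ x ξ, ‖χ x ξ‖ ≤ 1 := fun x ξ => (Complex.norm_exp_ofReal_mul_I _).le
  have key := integral_mul_conj_integral_eq (integrable_gauss (d := d) hb) hχ hχ1 hφ1 hψ1
  have hF : ∀ (φ : Space d → ℂ) ξ, ∫ y, φ y * χ y ξ = 𝓕 φ ξ := by
    intro φ ξ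
    rw [Real.fourier_eq']
    refine integral_congr_ae (Filter.Eventually.of_forall fun y => ?_)
    simp only [χ, smul_eq_mul]
    rw [mul_comm]
  have hK : ∀ z : Space d × Space d, ∫ ξ : Space d, Complex.exp (-b * ‖ξ‖ ^ 2) *
      (χ z.1 ξ * starRingEnd ℂ (χ z.2 ξ)) = gaussKernel b (z.1 - z.2) := by
    intro z
    rw [← integral_gauss_mul_exp hb]
    refine integral_congr_ae (Filter.Eventually.of_forall fun ξ => ?_)
    simp only [χ]
    rw [← Complex.exp_conj, ← Complex.exp_add, map_mul, Complex.conj_ofReal, Complex.conj_I,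
      inner_sub_left]
    congr 2
    push_cast
    ring
  simp_rw [hF, hK] at key
  rw [← Measure.volume_eq_prod] at key
  rw [← key]
  calc _ ≤ ∫⁻ ξ : Space d, ‖𝓕 φ ξ‖ₑ * ‖𝓕 ψ ξ‖ₑ := by
        refine (enorm_integral_le_lintegral_enorm _).trans (lintegral_mono fun ξ => ?_)
        rw [enorm_mul, enorm_mul]
        have h1 : ‖Complex.exp (-b * ‖ξ‖ ^ 2)‖ₑ ≤ 1 := by
          rw [← ofReal_norm, Complex.norm_exp]
          refine ENNReal.ofReal_le_one.2 (Real.exp_le_one_iff.2 ?_)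
          have : -b * (‖ξ‖ : ℂ) ^ 2 = ((‖ξ‖ ^ 2 : ℝ) : ℂ) * (-b) := by push_cast; ring
          rw [this, Complex.re_ofReal_mul, Complex.neg_re]
          nlinarith [sq_nonneg ‖ξ‖]
        have h2 : ‖starRingEnd ℂ (𝓕 ψ ξ)‖ₑ = ‖𝓕 ψ ξ‖ₑ := by
          rw [← ofReal_norm, ← ofReal_norm, RCLike.norm_conj]
        rw [h2]
        exact mul_le_of_le_one_left zero_le h1
    _ ≤ eLpNorm (𝓕 φ) 2 volume * eLpNorm (𝓕 ψ) 2 volume := by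
        have := ENNReal.lintegral_mul_le_Lp_mul_Lq (volume : Measure (Space d))
          (Real.HolderConjugate.two_two) (f := fun ξ => ‖𝓕 φ ξ‖ₑ) (g := fun ξ => ‖𝓕 ψ ξ‖ₑ)
          (continuous_fourier hφ1).enorm.measurable.aemeasurable
          (continuous_fourier hψ1).enorm.measurable.aemeasurable
        rw [eLpNorm_eq_lintegral_rpow_enorm_toReal (by norm_num) (by norm_num),
          eLpNorm_eq_lintegral_rpow_enorm_toReal (by norm_num) (by norm_num)]
        simpa using this
    _ = _ := by rw [eLpNorm_fourier_eq hφ1 hφ2, eLpNorm_fourier_eq hψ1 hψ2]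

end Gauss


/-! ### Complex interpolation for exponential families -/

section ThreeLines

variable {Y : Type*} [MeasurableSpace Y] {μ : Measure Y}

theorem norm_exp_mul_ofReal_le (z : ℂ) {x B : ℝ} (hx : |x| ≤ B) :
    ‖Complex.exp (z * x)‖ ≤ Real.exp (|z.re| * B) := by
  rw [Complex.norm_exp, Complex.re_mul_ofReal]
  refine Real.exp_le_exp.2 ((le_abs_self _).trans ?_)
  rw [abs_mul]
  gcongr

theorem integrable_mul_cexp {G : Y → ℂ} (hG : Integrable G μ) {L : Y → ℝ} (hL : Measurable L)
    {B : ℝ} (hB : ∀ y, G y ≠ 0 → |L y| ≤ B) (z : ℂ) :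
    Integrable (fun y => G y * Complex.exp (z * L y)) μ := by
  refine (hG.norm.const_mul (Real.exp (|z.re| * B))).mono'
    (hG.1.mul (by fun_prop : Measurable fun y => Complex.exp (z * L y)).aestronglyMeasurable)
    (Filter.Eventually.of_forall fun y => ?_)
  by_cases h0 : G y = 0
  · simp [h0]
  · rw [norm_mul, mul_comm]
    gcongr
    exact norm_exp_mul_ofReal_le z (hB y h0)

theorem differentiable_integral_mul_cexp {G : Y → ℂ} (hG : Integrable G μ) {L : Y → ℝ}
    (hL : Measurable L) {B : ℝ} (hB : ∀ y, G y ≠ 0 → |L y| ≤ B) :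
    Differentiable ℂ fun z => ∫ y, G y * Complex.exp (z * L y) ∂μ := by
  intro z
  have hmeas : ∀ w : ℂ, AEStronglyMeasurable (fun y => G y * Complex.exp (w * L y)) μ := fun w =>
    (integrable_mul_cexp hG hL hB w).1
  have key := hasDerivAt_integral_of_dominated_loc_of_deriv_le (μ := μ) (𝕜 := ℂ)
    (F := fun w y => G y * Complex.exp (w * L y))
    (F' := fun w y => G y * (Complex.exp (w * L y) * L y)) (x₀ := z)
    (s := Metric.ball z 1) (bound := fun y => ‖G y‖ * (Real.exp ((|z.re| + 1) * B) * B))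
    (Metric.ball_mem_nhds z one_pos) (Filter.Eventually.of_forall hmeas)
    (integrable_mul_cexp hG hL hB z)
    (hG.1.mul (by fun_prop : Measurable fun y =>
      Complex.exp (z * L y) * L y).aestronglyMeasurable)
    (Filter.Eventually.of_forall fun y w hw => ?_) (hG.norm.mul_const _)
    (Filter.Eventually.of_forall fun y w _ => ?_)
  · exact key.2.differentiableAt
  · by_cases h0 : G y = 0
    · simp [h0]
    have hBy := hB y h0
    have hB0 : 0 ≤ B := (abs_nonneg _).trans hBy
    rw [norm_mul, norm_mul, Complex.norm_real, Real.norm_eq_abs]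
    gcongr
    refine (norm_exp_mul_ofReal_le w hBy).trans (Real.exp_le_exp.2 ?_)
    gcongr
    have h1 : |w.re - z.re| ≤ 1 := by
      rw [← Complex.sub_re]
      refine (Complex.abs_re_le_norm _).trans ?_
      rw [Metric.mem_ball, dist_eq_norm] at hw
      exact hw.le
    have h2 := abs_add_le (w.re - z.re) z.re
    rw [sub_add_cancel] at h2
    linarith
  · have h1 : HasDerivAt (fun w : ℂ => w * (L y : ℂ)) (L y : ℂ) w := by
      simpa using (hasDerivAt_id w).mul_const (L y : ℂ)
    exact (h1.cexp).const_mul (G y)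

/-- Since each `L j` is bounded where `G j` is nonzero, the sum is entire in `z` and bounded on the
closed strip, as the three lines theorem requires. -/
theorem norm_sum_integral_le_interp {ι : Type*} [Fintype ι] {G : ι → Y → ℂ}
    (hG : ∀ j, Integrable (G j) μ) {L : ι → Y → ℝ} (hL : ∀ j, Measurable (L j)) {B : ι → ℝ}
    (hB : ∀ j y, G j y ≠ 0 → |L j y| ≤ B j) {M₀ M₁ : ℝ}
    (h₀ : ∀ z : ℂ, z.re = 0 → ‖∑ j, ∫ y, G j y * Complex.exp (z * L j y) ∂μ‖ ≤ M₀)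
    (h₁ : ∀ z : ℂ, z.re = 1 → ‖∑ j, ∫ y, G j y * Complex.exp (z * L j y) ∂μ‖ ≤ M₁)
    {τ : ℝ} (hτ0 : 0 ≤ τ) (hτ1 : τ ≤ 1) :
    ‖∑ j, ∫ y, G j y * Complex.exp (τ * L j y) ∂μ‖ ≤ M₀ ^ (1 - τ) * M₁ ^ τ := by
  set f : ℂ → ℂ := fun z => ∑ j, ∫ y, G j y * Complex.exp (z * L j y) ∂μ with hf
  have hfd : Differentiable ℂ f :=
    Differentiable.fun_sum fun j _ => differentiable_integral_mul_cexp (hG j) (hL j) (hB j)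
  have := Complex.HadamardThreeLines.norm_le_interp_of_mem_verticalClosedStrip₀₁' f (z := (τ : ℂ))
    (a := M₀) (b := M₁) ⟨by simpa using hτ0, by simpa using hτ1⟩ hfd.diffContOnCl ?_
    (fun z hz => h₀ z hz) (fun z hz => h₁ z hz)
  · simpa using this
  · refine ⟨∑ j, ∫ y, ‖G j y‖ * Real.exp |B j| ∂μ, ?_⟩
    rintro _ ⟨z, hz, rfl⟩
    simp only [Function.comp, hf]
    refine (norm_sum_le _ _).trans (Finset.sum_le_sum fun j _ => ?_)
    refine (norm_integral_le_integral_norm _).trans (integral_mono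
      (integrable_mul_cexp (hG j) (hL j) (hB j) z).norm ((hG j).norm.mul_const _) fun y => ?_)
    by_cases h0 : G j y = 0
    · simp [h0]
    simp only [norm_mul]
    gcongr
    refine (norm_exp_mul_ofReal_le z (hB j y h0)).trans (Real.exp_le_exp.2 ?_)
    have h1 : |z.re| ≤ 1 := abs_le.2 ⟨by linarith [hz.1], hz.2⟩
    calc |z.re| * B j ≤ |z.re| * |B j| := by gcongr; exact le_abs_self _
      _ ≤ 1 * |B j| := by gcongr
      _ = _ := one_mul _

end ThreeLines

/-! ### The Hilbert-Schmidt bound -/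

section HilbertSchmidt

variable {Y : Type*} [MeasurableSpace Y] {μ : Measure Y} 

theorem memLp_two_mul_conj_prod (f g : Lp ℂ 2 μ) :
    MemLp (fun z : Y × Y => f z.1 * starRingEnd ℂ (g z.2)) 2 (μ.prod μ) := by
  have hf := Lp.stronglyMeasurable f
  have hg := Lp.stronglyMeasurable g
  have hm : StronglyMeasurable fun z : Y × Y => f z.1 * starRingEnd ℂ (g z.2) :=
    (hf.comp_measurable measurable_fst).mul
      (Complex.continuous_conj.comp_stronglyMeasurable (hg.comp_measurable measurable_snd))
  refine (memLp_two_iff_integrable_sq_norm hm.aestronglyMeasurable).2 ?_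
  have h1 := ((memLp_two_iff_integrable_sq_norm hf.aestronglyMeasurable).1 (Lp.memLp f)).mul_prod
    ((memLp_two_iff_integrable_sq_norm hg.aestronglyMeasurable).1 (Lp.memLp g))
  refine h1.congr (Filter.Eventually.of_forall fun z => ?_)
  simp only [norm_mul, RCLike.norm_conj]
  ring

/-- The function `(y, y') ↦ f y * conj (g y')` as an element of `L²`. -/
noncomputable def tensorConj (f g : Lp ℂ 2 μ) : Lp ℂ 2 (μ.prod μ) :=
  (memLp_two_mul_conj_prod f g).toLp _

variable [SFinite μ]

theorem inner_tensorConj (f g : Lp ℂ 2 μ) :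
    ⟪tensorConj f f, tensorConj g g⟫_ℂ = ⟪f, g⟫_ℂ * ⟪g, f⟫_ℂ := by
  rw [L2.inner_def, L2.inner_def, L2.inner_def, ← integral_prod_mul]
  refine integral_congr_ae ?_
  filter_upwards [(memLp_two_mul_conj_prod f f).coeFn_toLp,
    (memLp_two_mul_conj_prod g g).coeFn_toLp] with z hz hz'
  simp only [tensorConj]
  rw [hz, hz']
  simp only [RCLike.inner_apply, map_mul, Complex.conj_conj]
  ring

theorem orthonormal_tensorConj {ι : Type*} {g : ι → Lp ℂ 2 μ} (hg : Orthonormal ℂ g) :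
    Orthonormal ℂ fun j => tensorConj (g j) (g j) := by
  classical
  rw [orthonormal_iff_ite] at hg ⊢
  intro i j
  rw [inner_tensorConj, hg, hg]
  by_cases h : i = j
  · simp [h]
  · simp [h]

/-- The diagonal matrix elements of a Hilbert-Schmidt kernel are its coefficients along the
orthonormal tensors `g_j ⊗ conj g_j`. Bessel's inequality makes them square summable, and
Cauchy-Schwarz pairs them with `a`. -/
theorem norm_sum_mul_integral_kernel_le {ι : Type*} [Fintype ι] {g : ι → Lp ℂ 2 μ}
    (hg : Orthonormal ℂ g) {k : Y × Y → ℂ} (hk : AEStronglyMeasurable k (μ.prod μ)) {N : ℝ}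
    (hN : 0 ≤ N) (hkN : ∫⁻ z, ‖k z‖ₑ ^ 2 ∂(μ.prod μ) ≤ ENNReal.ofReal (N ^ 2)) {a : ι → ℂ}
    (ha : ∑ j, ‖a j‖ ^ 2 ≤ 1) :
    ‖∑ j, a j * ∫ z, k z * (g j z.1 * starRingEnd ℂ (g j z.2)) ∂(μ.prod μ)‖ ≤ N := by
  have hkn : eLpNorm k 2 (μ.prod μ) ≤ ENNReal.ofReal N := by
    rw [eLpNorm_eq_lintegral_rpow_enorm_toReal (by norm_num) (by norm_num)]
    simp only [ENNReal.toReal_ofNat, ENNReal.rpow_ofNat]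
    calc _ ≤ (ENNReal.ofReal (N ^ 2)) ^ (1 / 2 : ℝ) := by gcongr
      _ = ENNReal.ofReal N := by
        rw [ENNReal.ofReal_rpow_of_nonneg (by positivity) (by norm_num), ← Real.sqrt_eq_rpow,
          Real.sqrt_sq hN]
  have hk2 : MemLp k 2 (μ.prod μ) := ⟨hk, hkn.trans_lt ENNReal.ofReal_lt_top⟩
  have hkc : MemLp (fun z => starRingEnd ℂ (k z)) 2 (μ.prod μ) := hk2.star
  set K : Lp ℂ 2 (μ.prod μ) := hkc.toLp _ with hK
  have hKn : ‖K‖ ≤ N := by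
    rw [hK, Lp.norm_toLp]
    refine ENNReal.toReal_le_of_le_ofReal hN (le_trans (le_of_eq ?_) hkn)
    refine eLpNorm_congr_norm_ae (Filter.Eventually.of_forall fun z => ?_)
    simp
  have hc : ∀ j, ∫ z, k z * (g j z.1 * starRingEnd ℂ (g j z.2)) ∂(μ.prod μ) =
      ⟪K, tensorConj (g j) (g j)⟫_ℂ := by
    intro j
    rw [L2.inner_def]
    refine integral_congr_ae ?_
    filter_upwards [(memLp_two_mul_conj_prod (g j) (g j)).coeFn_toLp, hkc.coeFn_toLp] with z h1 h2
    simp only [tensorConj, hK]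
    rw [h1, h2]
    simp only [RCLike.inner_apply, Complex.conj_conj]
    ring
  have hB := (orthonormal_tensorConj hg).sum_inner_products_le (x := K) (s := Finset.univ)
  simp_rw [hc]
  calc _ ≤ ∑ j, ‖a j‖ * ‖⟪K, tensorConj (g j) (g j)⟫_ℂ‖ := by
        refine (norm_sum_le _ _).trans (le_of_eq ?_)
        simp_rw [norm_mul]
    _ ≤ Real.sqrt (∑ j, ‖a j‖ ^ 2) * Real.sqrt (∑ j, ‖⟪K, tensorConj (g j) (g j)⟫_ℂ‖ ^ 2) :=
        Real.sum_mul_le_sqrt_mul_sqrt _ _ _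
    _ ≤ 1 * N := by
        refine mul_le_mul ?_ ?_ (Real.sqrt_nonneg _) zero_le_one
        · exact Real.sqrt_le_one.2 ha
        · refine (Real.sqrt_le_left hN).2 (le_trans ?_ (pow_le_pow_left₀ (norm_nonneg _) hKn 2))
          simp_rw [norm_inner_symm K]
          exact hB
    _ = N := one_mul N

end HilbertSchmidt

/-! ### Reordering of space-time products -/

section Reorder

variable {α β : Type*} [MeasureSpace α] [MeasureSpace β]
  [SFinite (volume : Measure α)] [SFinite (volume : Measure β)]

/-- The measurable equivalence `((a, b), (a', b')) ↦ ((a, a'), (b, b'))`. -/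
def prodProdComm (α β : Type*) [MeasurableSpace α] [MeasurableSpace β] :
    (α × β) × (α × β) ≃ᵐ (α × α) × (β × β) where
  toEquiv := Equiv.prodProdProdComm α β α β
  measurable_toFun := by
    change Measurable fun z : (α × β) × (α × β) => ((z.1.1, z.2.1), (z.1.2, z.2.2))
    fun_prop
  measurable_invFun := by
    change Measurable fun z : (α × α) × (β × β) => ((z.1.1, z.2.1), (z.1.2, z.2.2))
    fun_prop

theorem measurePreserving_prodProdComm :
    MeasurePreserving (prodProdComm α β) (volume : Measure ((α × β) × (α × β)))
      (volume : Measure ((α × α) × (β × β))) := by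
  have h1 := measurePreserving_prodAssoc (volume : Measure α) (volume : Measure β)
    (volume : Measure (α × β))
  have h2 := (MeasurePreserving.id (volume : Measure α)).prod
    (measurePreserving_prodAssoc (volume : Measure β) (volume : Measure α)
      (volume : Measure β)).symm
  have h3 := (MeasurePreserving.id (volume : Measure α)).prod
    ((Measure.measurePreserving_swap (μ := (volume : Measure β)) (ν := (volume : Measure α))).prod
      (MeasurePreserving.id (volume : Measure β)))
  have h4 := (MeasurePreserving.id (volume : Measure α)).prod
    (measurePreserving_prodAssoc (volume : Measure α) (volume : Measure β)
      (volume : Measure β))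
  have h5 := (measurePreserving_prodAssoc (volume : Measure α) (volume : Measure α)
    ((volume : Measure β).prod (volume : Measure β))).symm
  exact h5.comp (h4.comp (h3.comp (h2.comp h1)))

end Reorder


/-! ### The two endpoint estimates -/

section Endpoints

variable {d : ℕ}

/-- The complex parameter of the regularized Schrödinger kernel at time `τ`. -/
noncomputable def timeParam (ε τ : ℝ) : ℂ := ⟨ε, -(4 * Real.pi ^ 2 * τ)⟩

theorem timeParam_re (ε τ : ℝ) : (timeParam ε τ).re = ε := rfl

theorem continuous_timeParam (ε : ℝ) : Continuous (timeParam ε) := by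
  have : timeParam ε = fun τ => (ε : ℂ) + ((-(4 * Real.pi ^ 2 * τ) : ℝ) : ℂ) * Complex.I := by
    funext τ
    rw [timeParam]
    generalize -(4 * Real.pi ^ 2 * τ) = c
    apply Complex.ext <;> simp
  rw [this]
  fun_prop

/-- Negative powers of the regularized parameter are thereby dominated by those of `|τ|`, uniformly
in `ε`. -/
theorem abs_le_norm_timeParam (ε τ : ℝ) : |τ| ≤ ‖timeParam ε τ‖ := by
  refine le_trans ?_ (Complex.abs_im_le_norm _)
  simp only [timeParam, abs_neg, abs_mul]
  have h1 : 1 ≤ |(4 : ℝ)| * |Real.pi ^ 2| := by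
    rw [abs_of_pos (by norm_num), abs_of_pos (by positivity)]
    nlinarith [Real.pi_gt_three]
  nlinarith [abs_nonneg τ]

theorem le_norm_timeParam (ε τ : ℝ) : ε ≤ ‖timeParam ε τ‖ :=
  (le_abs_self _).trans (Complex.abs_re_le_norm (timeParam ε τ))

theorem norm_timeParam_pos {ε : ℝ} (hε : 0 < ε) (τ : ℝ) : 0 < ‖timeParam ε τ‖ :=
  hε.trans_le (le_norm_timeParam ε τ)

theorem norm_timeParam_le (ε τ : ℝ) : ‖timeParam ε τ‖ ≤ |ε| + 4 * Real.pi ^ 2 * |τ| := by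
  refine (Complex.norm_le_abs_re_add_abs_im _).trans (le_of_eq ?_)
  simp [timeParam, abs_mul]

theorem enorm_rpow_neg_of_norm_le {γ : ℝ} (hγ : 0 ≤ γ) {τ c : ℝ} (hc : 0 < c) (h : |τ| ≤ c) :
    ENNReal.ofReal (c ^ (-γ)) ≤ ‖τ‖ₑ ^ (-γ) := by
  rw [← ENNReal.ofReal_rpow_of_pos hc, ENNReal.rpow_neg, ENNReal.rpow_neg]
  refine ENNReal.inv_le_inv.2 (ENNReal.rpow_le_rpow ?_ hγ)
  rw [← ofReal_norm]
  exact ENNReal.ofReal_le_ofReal h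

/-- The operator-norm endpoint. -/
theorem enorm_integral_kernel_le_of_mixed {γ : ℝ} (hγ0 : 0 < γ) (hγ1 : γ < 1) {ε : ℝ}
    (hε : 0 < ε) {Φ Ψ g : SpaceTime d → ℂ} (hΦm : Measurable Φ) (hΨm : Measurable Ψ)
    (hg : Measurable g) (hΦ1 : Integrable Φ volume) (hΨ1 : Integrable Ψ volume)
    (hΦ2 : MemLp Φ 2 volume) (hΨ2 : MemLp Ψ 2 volume) {w : ℝ → ℝ≥0∞} (hw : Measurable w)
    (hΦg : ∀ P, ‖Φ P‖ₑ ≤ w P.1 * ‖g P‖ₑ) (hΨg : ∀ P, ‖Ψ P‖ₑ ≤ w P.1 * ‖g P‖ₑ)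
    (hg2 : ∫⁻ P, ‖g P‖ₑ ^ 2 ≤ 1) (hw1 : ∫⁻ t, w t ^ (2 / (1 - γ)) ≤ 1)
    {k : ℝ × ℝ → ℂ} (hkγ : ∀ z, ‖k z‖ₑ ≤ ‖z.1 - z.2‖ₑ ^ (-γ))
    (hInt : Integrable fun z : SpaceTime d × SpaceTime d => k (z.1.1, z.2.1) *
      (Φ z.1 * starRingEnd ℂ (Ψ z.2) * gaussKernel (timeParam ε (z.1.1 - z.2.1)) (z.1.2 - z.2.2))) :
    ‖∫ z : SpaceTime d × SpaceTime d, k (z.1.1, z.2.1) *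
      (Φ z.1 * starRingEnd ℂ (Ψ z.2) *
        gaussKernel (timeParam ε (z.1.1 - z.2.1)) (z.1.2 - z.2.2))‖ₑ ≤
      ENNReal.ofReal (hlsConst γ) := by
  have h1γ : 0 < 1 - γ := by linarith
  have h2γ : 0 < 2 - γ := by linarith
  set e := prodProdComm ℝ (Space d) with he
  have hmp : MeasurePreserving e volume volume := measurePreserving_prodProdComm
  let J : (ℝ × ℝ) × (Space d × Space d) → ℂ := fun y => k (y.1.1, y.1.2) *
    (Φ (y.1.1, y.2.1) * starRingEnd ℂ (Ψ (y.1.2, y.2.2)) *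
      gaussKernel (timeParam ε (y.1.1 - y.1.2)) (y.2.1 - y.2.2))
  have hJ : ∀ z : SpaceTime d × SpaceTime d, J (e z) = k (z.1.1, z.2.1) *
      (Φ z.1 * starRingEnd ℂ (Ψ z.2) *
        gaussKernel (timeParam ε (z.1.1 - z.2.1)) (z.1.2 - z.2.2)) := fun z => rfl
  have hJint : Integrable J volume := by
    rw [← hmp.integrable_comp_emb e.measurableEmbedding]
    exact hInt
  simp_rw [← hJ]
  rw [hmp.integral_comp e.measurableEmbedding J, Measure.volume_eq_prod, integral_prod _ hJint]
  let g2 : ℝ → ℝ≥0∞ := fun t => ∫⁻ x : Space d, ‖g (t, x)‖ₑ ^ 2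
  have hg2m : Measurable g2 :=
    Measurable.lintegral_prod_right' (f := fun P : ℝ × Space d => ‖g P‖ₑ ^ 2) (by fun_prop)
  -- The `L²_x` size of both test functions at time `t`. The contraction property in `x` reduces the
  -- whole estimate to the one-dimensional form in `h`.
  let h : ℝ → ℝ≥0∞ := fun t => w t * g2 t ^ (1 / 2 : ℝ)
  have hhm : Measurable h := hw.mul (hg2m.pow_const _)
  have hslice : ∀ {Θ : SpaceTime d → ℂ}, (∀ P, ‖Θ P‖ₑ ≤ w P.1 * ‖g P‖ₑ) →
      ∀ t, eLpNorm (fun x => Θ (t, x)) 2 volume ≤ h t := by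
    intro Θ hΘ t
    rw [eLpNorm_eq_lintegral_rpow_enorm_toReal (by norm_num) (by norm_num)]
    simp only [ENNReal.toReal_ofNat, ENNReal.rpow_ofNat]
    calc _ ≤ (∫⁻ x : Space d, w t ^ 2 * ‖g (t, x)‖ₑ ^ 2) ^ (1 / 2 : ℝ) := by
          gcongr with x
          rw [← mul_pow]
          exact pow_le_pow_left' (hΘ (t, x)) 2
      _ = h t := by
          rw [lintegral_const_mul _ (by fun_prop), ENNReal.mul_rpow_of_nonneg _ _ (by norm_num),
            ← ENNReal.rpow_natCast, ← ENNReal.rpow_mul]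
          norm_num
          rfl
  have hae1 : ∀ {Θ : SpaceTime d → ℂ}, Integrable Θ volume →
      ∀ᵐ t : ℝ, Integrable (fun x => Θ (t, x)) volume := fun {Θ} hΘ => hΘ.prod_right_ae
  have hae2 : ∀ {Θ : SpaceTime d → ℂ}, Measurable Θ → MemLp Θ 2 volume →
      ∀ᵐ t : ℝ, MemLp (fun x => Θ (t, x)) 2 volume := by
    intro Θ hΘm hΘ
    have h1 := (memLp_two_iff_integrable_sq_norm hΘm.aestronglyMeasurable).1 hΘ
    filter_upwards [h1.prod_right_ae] with t ht
    exact (memLp_two_iff_integrable_sq_norm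
      (hΘm.comp measurable_prodMk_left).aestronglyMeasurable).2 ht
  have hpt : ∀ᵐ y : ℝ × ℝ, ‖∫ x : Space d × Space d, J (y, x)‖ₑ ≤
      h y.1 * h y.2 * ‖y.1 - y.2‖ₑ ^ (-γ) := by
    have hA := (Measure.quasiMeasurePreserving_fst (μ := (volume : Measure ℝ))
      (ν := (volume : Measure ℝ))).ae ((hae1 hΦ1).and (hae2 hΦm hΦ2))
    have hB := (Measure.quasiMeasurePreserving_snd (μ := (volume : Measure ℝ))
      (ν := (volume : Measure ℝ))).ae ((hae1 hΨ1).and (hae2 hΨm hΨ2))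
    rw [Measure.volume_eq_prod]
    filter_upwards [hA, hB] with y hy1 hy2
    simp only [J]
    rw [integral_const_mul, enorm_mul, mul_comm]
    refine mul_le_mul' ?_ (hkγ _)
    refine (enorm_integral_gaussKernel_le (φ := fun x => Φ (y.1, x)) (ψ := fun x => Ψ (y.2, x))
      (by rw [timeParam_re]; exact hε) hy1.1 hy1.2 hy2.1 hy2.2).trans ?_
    exact mul_le_mul' (hslice hΦg _) (hslice hΨg _)
  have hhr : ∫⁻ t, h t ^ (2 / (2 - γ)) ≤ 1 := by
    -- In terms of exponents, `(2 - γ)/2 = (1 - γ)/2 + 1/2`: the product of `w ∈ L^{2/(1-γ)}` and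
    -- the `L²` function `√g2` lies in the Hardy-Littlewood-Sobolev space.
    have hconj : ((2 - γ) / (1 - γ)).HolderConjugate (2 - γ) := by
      rw [Real.holderConjugate_iff]
      refine ⟨?_, ?_⟩
      · rw [lt_div_iff₀ h1γ]; linarith
      · field_simp; ring
    calc ∫⁻ t, h t ^ (2 / (2 - γ))
        = ∫⁻ t, ((fun t => w t ^ (2 / (2 - γ))) * fun t => g2 t ^ (1 / (2 - γ))) t := by
          refine lintegral_congr fun t => ?_
          simp only [h, Pi.mul_apply]
          rw [ENNReal.mul_rpow_of_nonneg _ _ (by positivity), ← ENNReal.rpow_mul]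
          congr 2
          field_simp
      _ ≤ _ := ENNReal.lintegral_mul_le_Lp_mul_Lq _ hconj (hw.pow_const _).aemeasurable
          (hg2m.pow_const _).aemeasurable
      _ ≤ 1 * 1 := by
          gcongr
          · refine ENNReal.rpow_le_one ?_ (by positivity)
            refine le_trans (le_of_eq ?_) hw1
            refine lintegral_congr fun t => ?_
            rw [← ENNReal.rpow_mul]
            congr 1
            field_simp
          · refine ENNReal.rpow_le_one ?_ (by positivity)
            refine le_trans (le_of_eq ?_) hg2
            rw [Measure.volume_eq_prod, lintegral_prod _ (by fun_prop)]
            refine lintegral_congr fun t => ?_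
            rw [← ENNReal.rpow_mul, one_div_mul_cancel h2γ.ne', ENNReal.rpow_one]
      _ = 1 := one_mul 1
  calc _ ≤ ∫⁻ y : ℝ × ℝ, ‖∫ x : Space d × Space d, J (y, x)‖ₑ :=
        enorm_integral_le_lintegral_enorm _
    _ ≤ ∫⁻ y : ℝ × ℝ, h y.1 * h y.2 * ‖y.1 - y.2‖ₑ ^ (-γ) := lintegral_mono_ae hpt
    _ = ∫⁻ t, ∫⁻ s, h t * h s * ‖t - s‖ₑ ^ (-γ) := by
        rw [Measure.volume_eq_prod, lintegral_prod _ (by fun_prop)]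
    _ ≤ ENNReal.ofReal (hlsConst γ) * (∫⁻ t, h t ^ (2 / (2 - γ))) ^ (2 - γ) :=
        hardy_littlewood_sobolev hγ0 hγ1 hhm
    _ ≤ ENNReal.ofReal (hlsConst γ) * 1 := by
        gcongr
        exact ENNReal.rpow_le_one hhr h2γ.le
    _ = _ := mul_one _

/-- The Hilbert-Schmidt endpoint. -/
theorem lintegral_kernel_sq_le_of_mixed {γ : ℝ} (hγ0 : 0 < γ) (hγ1 : γ < 1)
    {A : SpaceTime d → ℂ} (hA : Measurable A) {w : ℝ → ℝ≥0∞} (hw : Measurable w)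
    (hAw : ∀ t, ∫⁻ x, ‖A (t, x)‖ₑ ^ 2 ≤ w t) (hw1 : ∫⁻ t, w t ^ (2 / (2 - γ)) ≤ 1)
    {k : SpaceTime d × SpaceTime d → ℂ} {c : ℝ≥0∞}
    (hk : ∀ z, ‖k z‖ₑ ^ 2 ≤ c * ‖z.1.1 - z.2.1‖ₑ ^ (-γ)) :
    ∫⁻ z : SpaceTime d × SpaceTime d, ‖k z * (A z.1 * A z.2)‖ₑ ^ 2 ≤
      c * ENNReal.ofReal (hlsConst γ) := by
  have h2γ : 0 < 2 - γ := by linarith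
  set e := prodProdComm ℝ (Space d) with he
  have hmp : MeasurePreserving e volume volume := measurePreserving_prodProdComm
  let J : (ℝ × ℝ) × (Space d × Space d) → ℝ≥0∞ := fun y => c * ‖y.1.1 - y.1.2‖ₑ ^ (-γ) *
    (‖A (y.1.1, y.2.1)‖ₑ ^ 2 * ‖A (y.1.2, y.2.2)‖ₑ ^ 2)
  have hJm : Measurable J := by
    simp only [J]
    fun_prop
  calc _ ≤ ∫⁻ z, J (e z) := by
        refine lintegral_mono fun z => ?_
        rw [enorm_mul, enorm_mul, mul_pow, mul_pow]
        exact mul_le_mul' (hk z) le_rfl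
    _ = ∫⁻ y, J y := hmp.lintegral_comp_emb e.measurableEmbedding J
    _ = ∫⁻ t, ∫⁻ s, ∫⁻ x : Space d × Space d, J ((t, s), x) := by
        rw [Measure.volume_eq_prod, lintegral_prod _ hJm.aemeasurable, Measure.volume_eq_prod,
          lintegral_prod]
        exact hJm.lintegral_prod_right'.aemeasurable
    -- The majorant of the kernel depends on the times only, so the two spatial integrals factor and
    -- each is bounded by `w`.
    _ ≤ ∫⁻ t, ∫⁻ s, c * (w t * w s * ‖t - s‖ₑ ^ (-γ)) := by
        refine lintegral_mono fun t => lintegral_mono fun s => ?_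
        simp only [J]
        rw [lintegral_const_mul _ (by fun_prop), Measure.volume_eq_prod,
          lintegral_prod_mul (f := fun x => ‖A (t, x)‖ₑ ^ 2) (g := fun x => ‖A (s, x)‖ₑ ^ 2)
            (by fun_prop) (by fun_prop)]
        calc _ ≤ c * ‖t - s‖ₑ ^ (-γ) * (w t * w s) := by
              gcongr
              · exact hAw t
              · exact hAw s
          _ = _ := by ring
    _ = c * ∫⁻ t, ∫⁻ s, w t * w s * ‖t - s‖ₑ ^ (-γ) := by
        rw [← lintegral_const_mul]
        · refine lintegral_congr fun t => ?_
          rw [lintegral_const_mul _ (by fun_prop)]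
        · exact Measurable.lintegral_prod_right'
            (f := fun y : ℝ × ℝ => w y.1 * w y.2 * ‖y.1 - y.2‖ₑ ^ (-γ)) (by fun_prop)
    _ ≤ c * (ENNReal.ofReal (hlsConst γ) * (∫⁻ t, w t ^ (2 / (2 - γ))) ^ (2 - γ)) := by
        gcongr
        exact hardy_littlewood_sobolev hγ0 hγ1 hw
    _ ≤ c * (ENNReal.ofReal (hlsConst γ) * 1) := by
        gcongr
        exact ENNReal.rpow_le_one hw1 h2γ.le
    _ = _ := by rw [mul_one]

end Endpoints


/-! ### Interpolation -/

section Interpolation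

/-- A weight `1_Ω exp ℓ` with bounded `ℓ` and bounded support, whose `L^q_x` norm at time `t` is at
most `exp (ω t)`, where `exp ω` is at most one in `L^p_t`. -/
structure TameWeight (d : ℕ) (p q : ℝ) where
  /-- the support -/
  Ω : Set (SpaceTime d)
  /-- the logarithm of the weight on its support -/
  ℓ : SpaceTime d → ℝ
  /-- the logarithm of a bound for the spatial norms -/
  ω : ℝ → ℝ
  /-- a bound for the support -/
  R : ℝ
  /-- a bound for the logarithms -/
  M : ℝ
  measurableSet_Ω : MeasurableSet Ω
  abs_fst_le : ∀ P ∈ Ω, |P.1| ≤ R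
  norm_snd_le : ∀ P ∈ Ω, ‖P.2‖ ≤ R
  measurable_ℓ : Measurable ℓ
  abs_ℓ_le : ∀ P, |ℓ P| ≤ M
  measurable_ω : Measurable ω
  abs_ω_le : ∀ t, |ω t| ≤ M
  slice_le : ∀ t, ∫⁻ x, Ω.indicator (fun P => ENNReal.ofReal (Real.exp (q * ℓ P))) (t, x) ≤
    ENNReal.ofReal (Real.exp (q * ω t))
  time_le : ∫⁻ t in Set.Icc (-R) R, ENNReal.ofReal (Real.exp (p * ω t)) ≤ 1

/-! ### Complex powers of a weight and the analytic family built from them -/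

namespace TameWeight

variable {d : ℕ} {p q : ℝ} (W : TameWeight d p q)

/-- The function `1_Ω exp (α ℓ + β ω)`. -/
noncomputable def power (α β : ℂ) : SpaceTime d → ℂ :=
  W.Ω.indicator fun P => Complex.exp (α * W.ℓ P + β * W.ω P.1)

/-- The weight itself. -/
noncomputable def weight : SpaceTime d → ℝ := W.Ω.indicator fun P => Real.exp (W.ℓ P)

theorem measurable_power (α β : ℂ) : Measurable (W.power α β) := by
  have h1 := W.measurable_ℓ
  have h2 := W.measurable_ω
  refine Measurable.indicator ?_ W.measurableSet_Ω
  fun_prop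

theorem measurable_weight : Measurable W.weight := by
  have h1 := W.measurable_ℓ
  refine Measurable.indicator ?_ W.measurableSet_Ω
  fun_prop

theorem power_one_zero (P : SpaceTime d) : W.power 1 0 P = (W.weight P : ℂ) := by
  by_cases hP : P ∈ W.Ω
  · simp [power, weight, Set.indicator_of_mem hP]
  · simp [power, weight, Set.indicator_of_notMem hP]

theorem norm_power (α β : ℂ) (P : SpaceTime d) :
    ‖W.power α β P‖ = W.Ω.indicator (fun P => Real.exp (α.re * W.ℓ P + β.re * W.ω P.1)) P := by
  by_cases hP : P ∈ W.Ω
  · simp [power, Set.indicator_of_mem hP, Complex.norm_exp]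
  · simp [power, Set.indicator_of_notMem hP]

/-- Conjugating the exponents under the outer conjugation keeps the second weight in the
sesquilinear form holomorphic in the parameters. -/
theorem conj_power (α β : ℂ) (P : SpaceTime d) :
    starRingEnd ℂ (W.power (starRingEnd ℂ α) (starRingEnd ℂ β) P) = W.power α β P := by
  by_cases hP : P ∈ W.Ω
  · simp [power, Set.indicator_of_mem hP, ← Complex.exp_conj]
  · simp [power, Set.indicator_of_notMem hP]

theorem norm_power_le (α β : ℂ) (P : SpaceTime d) :
    ‖W.power α β P‖ ≤ Real.exp (|α.re| * W.M + |β.re| * W.M) := by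
  rw [norm_power]
  by_cases hP : P ∈ W.Ω
  · rw [Set.indicator_of_mem hP]
    refine Real.exp_le_exp.2 (add_le_add ?_ ?_)
    · refine (le_abs_self _).trans ?_
      rw [abs_mul]
      exact mul_le_mul_of_nonneg_left (W.abs_ℓ_le P) (abs_nonneg _)
    · refine (le_abs_self _).trans ?_
      rw [abs_mul]
      exact mul_le_mul_of_nonneg_left (W.abs_ω_le P.1) (abs_nonneg _)
  · rw [Set.indicator_of_notMem hP]
    exact (Real.exp_pos _).le

theorem volume_Ω_lt_top : volume W.Ω < ∞ := by
  have h : W.Ω ⊆ Set.Icc (-W.R) W.R ×ˢ Metric.closedBall (0 : Space d) W.R := fun P hP =>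
    ⟨abs_le.1 (W.abs_fst_le P hP), by simpa using W.norm_snd_le P hP⟩
  exact (measure_mono h).trans_lt
    ((isCompact_Icc.prod (isCompact_closedBall _ _)).measure_lt_top)

theorem memLp_power_mul (α β : ℂ) (g : Lp ℂ 2 (volume : Measure (SpaceTime d))) :
    MemLp (fun P => W.power α β P * g P) 2 volume :=
  (Lp.memLp g).of_le_mul ((W.measurable_power α β).aestronglyMeasurable.mul
    (Lp.aestronglyMeasurable g)) (Filter.Eventually.of_forall fun P => by
      rw [norm_mul]
      exact mul_le_mul_of_nonneg_right (W.norm_power_le α β P) (norm_nonneg _))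

theorem integrable_power_mul (α β : ℂ) (g : Lp ℂ 2 (volume : Measure (SpaceTime d))) :
    Integrable (fun P => W.power α β P * g P) volume := by
  have h1 : Integrable (W.Ω.indicator fun P => W.power α β P * g P) volume := by
    rw [integrable_indicator_iff W.measurableSet_Ω]
    have : IsFiniteMeasure (volume.restrict W.Ω) := ⟨by simpa using W.volume_Ω_lt_top⟩
    exact ((W.memLp_power_mul α β g).restrict W.Ω).integrable (by norm_num)
  refine h1.congr (Filter.Eventually.of_forall fun P => ?_)
  by_cases hP : P ∈ W.Ω
  · simp [Set.indicator_of_mem hP]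
  · simp [Set.indicator_of_notMem hP, power]

theorem power_ne_zero {α β : ℂ} {P : SpaceTime d} (h : W.power α β P ≠ 0) : P ∈ W.Ω := by
  by_contra hP
  exact h (by simp [power, Set.indicator_of_notMem hP])

/-- The logarithm of the modulus of the time parameter on `Ω × Ω`. -/
theorem abs_log_norm_timeParam_le {ε : ℝ} (hε : 0 < ε) {P P' : SpaceTime d} (hP : P ∈ W.Ω)
    (hP' : P' ∈ W.Ω) : |Real.log ‖timeParam ε (P.1 - P'.1)‖| ≤
      |Real.log ε| + |Real.log (ε + 4 * Real.pi ^ 2 * (2 * W.R))| := by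
  have h0 := norm_timeParam_pos hε (P.1 - P'.1)
  have h1 : Real.log ε ≤ Real.log ‖timeParam ε (P.1 - P'.1)‖ :=
    Real.log_le_log hε (le_norm_timeParam _ _)
  have h2 : Real.log ‖timeParam ε (P.1 - P'.1)‖ ≤
      Real.log (ε + 4 * Real.pi ^ 2 * (2 * W.R)) := by
    refine Real.log_le_log h0 ((norm_timeParam_le _ _).trans ?_)
    rw [abs_of_pos hε]
    gcongr
    have := abs_sub P.1 P'.1
    linarith [W.abs_fst_le P hP, W.abs_fst_le P' hP']
  rw [abs_le]
  constructor
  · linarith [neg_abs_le (Real.log ε), abs_nonneg (Real.log (ε + 4 * Real.pi ^ 2 * (2 * W.R)))]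
  · linarith [le_abs_self (Real.log (ε + 4 * Real.pi ^ 2 * (2 * W.R))), abs_nonneg (Real.log ε)]

/-- The integrand of the analytic family, at the exponents `κ`, `α`, `β`. -/
noncomputable def familyIntegrand (ε : ℝ) (g : Lp ℂ 2 (volume : Measure (SpaceTime d)))
    (κ α β : ℂ) (z : SpaceTime d × SpaceTime d) : ℂ :=
  Complex.exp (κ * Real.log ‖timeParam ε (z.1.1 - z.2.1)‖) *
    (W.power α β z.1 * g z.1 *
      starRingEnd ℂ (W.power (starRingEnd ℂ α) (starRingEnd ℂ β) z.2 * g z.2) *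
      gaussKernel (timeParam ε (z.1.1 - z.2.1)) (z.1.2 - z.2.2))

theorem measurable_log_timeParam (ε : ℝ) :
    Measurable fun z : SpaceTime d × SpaceTime d =>
      Real.log ‖timeParam ε (z.1.1 - z.2.1)‖ := by
  have := (continuous_timeParam ε).measurable
  fun_prop

theorem measurable_gaussKernel_timeParam (ε : ℝ) :
    Measurable fun z : SpaceTime d × SpaceTime d =>
      gaussKernel (timeParam ε (z.1.1 - z.2.1)) (z.1.2 - z.2.2) := by
  have h := (continuous_timeParam ε).measurable
  exact measurable_gaussKernel.comp (f := fun z : SpaceTime d × SpaceTime d =>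
    (timeParam ε (z.1.1 - z.2.1), z.1.2 - z.2.2)) (by fun_prop)

theorem integrable_familyIntegrand {ε : ℝ} (hε : 0 < ε)
    (g : Lp ℂ 2 (volume : Measure (SpaceTime d))) (κ α β : ℂ) :
    Integrable (W.familyIntegrand ε g κ α β) volume := by
  have hgm := (Lp.stronglyMeasurable g).measurable
  have hconj : Measurable (starRingEnd ℂ) := Complex.continuous_conj.measurable
  have hbase : Integrable (fun z : SpaceTime d × SpaceTime d => (W.power α β z.1 * g z.1) *
      starRingEnd ℂ (W.power (starRingEnd ℂ α) (starRingEnd ℂ β) z.2 * g z.2)) volume := by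
    have h2 : Integrable (fun P => starRingEnd ℂ
        (W.power (starRingEnd ℂ α) (starRingEnd ℂ β) P * g P)) volume :=
      (LinearIsometryEquiv.integrable_comp_iff Complex.conjLIE).2 (W.integrable_power_mul _ _ g)
    exact (W.integrable_power_mul α β g).mul_prod h2
  set B := |Real.log ε| + |Real.log (ε + 4 * Real.pi ^ 2 * (2 * W.R))| with hBdef
  refine (hbase.norm.const_mul (Real.exp (|κ.re| * B) * (Real.pi / ε) ^ ((d : ℝ) / 2))).mono'
    ?_ (Filter.Eventually.of_forall fun z => ?_)
  · have h1 := measurable_log_timeParam (d := d) ε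
    have h2 := measurable_gaussKernel_timeParam (d := d) ε
    have h3 := W.measurable_power α β
    have h4 := W.measurable_power (starRingEnd ℂ α) (starRingEnd ℂ β)
    refine Measurable.aestronglyMeasurable ?_
    unfold familyIntegrand
    fun_prop
  · by_cases h0 : W.power α β z.1 * g z.1 *
      starRingEnd ℂ (W.power (starRingEnd ℂ α) (starRingEnd ℂ β) z.2 * g z.2) = 0
    · simp only [familyIntegrand]
      rw [h0]
      simp
    have hz1 : z.1 ∈ W.Ω := W.power_ne_zero (left_ne_zero_of_mul (left_ne_zero_of_mul h0))
    have hz2 : z.2 ∈ W.Ω := by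
      have h3 := right_ne_zero_of_mul h0
      rw [map_mul] at h3
      have h4 := left_ne_zero_of_mul h3
      rw [W.conj_power] at h4
      exact W.power_ne_zero h4
    rw [familyIntegrand, norm_mul, norm_mul _ (gaussKernel _ _)]
    have h5 := norm_exp_mul_ofReal_le κ (W.abs_log_norm_timeParam_le hε hz1 hz2)
    have h6 : ‖gaussKernel (timeParam ε (z.1.1 - z.2.1)) (z.1.2 - z.2.2)‖ ≤
        (Real.pi / ε) ^ ((d : ℝ) / 2) := by
      refine (norm_gaussKernel_le (by rw [timeParam_re]; exact hε) _).trans ?_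
      have := le_norm_timeParam ε (z.1.1 - z.2.1)
      gcongr
    calc _ ≤ Real.exp (|κ.re| * B) * (‖W.power α β z.1 * g z.1 *
          starRingEnd ℂ (W.power (starRingEnd ℂ α) (starRingEnd ℂ β) z.2 * g z.2)‖ *
          (Real.pi / ε) ^ ((d : ℝ) / 2)) := by gcongr
      _ = _ := by ring

/-- The pairing of the regularized operator with `g`. -/
noncomputable def pairing (ε : ℝ) (g : Lp ℂ 2 (volume : Measure (SpaceTime d))) : ℂ :=
  ∫ z : SpaceTime d × SpaceTime d, (W.weight z.1 * g z.1) *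
    starRingEnd ℂ (W.weight z.2 * g z.2) *
    gaussKernel (timeParam ε (z.1.1 - z.2.1)) (z.1.2 - z.2.2)

theorem familyIntegrand_zero_one_zero (ε : ℝ) (g : Lp ℂ 2 (volume : Measure (SpaceTime d))) :
    ∫ z, W.familyIntegrand ε g 0 1 0 z = W.pairing ε g := by
  refine integral_congr_ae (Filter.Eventually.of_forall fun z => ?_)
  simp [familyIntegrand, power_one_zero]

theorem familyIntegrand_eq (ε : ℝ) (g : Lp ℂ 2 (volume : Measure (SpaceTime d))) (κ α β : ℂ)
    (z : SpaceTime d × SpaceTime d) :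
    W.familyIntegrand ε g κ α β z =
      Complex.exp (κ * Real.log ‖timeParam ε (z.1.1 - z.2.1)‖) *
        gaussKernel (timeParam ε (z.1.1 - z.2.1)) (z.1.2 - z.2.2) *
        (W.power α β z.1 * W.power α β z.2) * (g z.1 * starRingEnd ℂ (g z.2)) := by
  rw [familyIntegrand, map_mul, W.conj_power]
  ring

theorem power_mul_exp (α β α' β' : ℂ) (P : SpaceTime d) :
    W.power α β P * Complex.exp (α' * W.ℓ P + β' * W.ω P.1) = W.power (α + α') (β + β') P := by
  by_cases hP : P ∈ W.Ω
  · simp only [power, Set.indicator_of_mem hP]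
    rw [← Complex.exp_add]
    congr 1; ring
  · simp [power, Set.indicator_of_notMem hP]

/-- Shifting the exponents multiplies the integrand by the exponential of an expression linear in
the shift. This puts the family in the form `G exp(zL)` used for the three lines argument. -/
theorem familyIntegrand_mul_exp (ε : ℝ) (g : Lp ℂ 2 (volume : Measure (SpaceTime d)))
    (κ α β κ' α' β' : ℂ) (z : SpaceTime d × SpaceTime d) :
    W.familyIntegrand ε g κ α β z * Complex.exp (κ' * Real.log ‖timeParam ε (z.1.1 - z.2.1)‖ +
      α' * (W.ℓ z.1 + W.ℓ z.2) + β' * (W.ω z.1.1 + W.ω z.2.1)) =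
    W.familyIntegrand ε g (κ + κ') (α + α') (β + β') z := by
  rw [familyIntegrand_eq, familyIntegrand_eq, ← W.power_mul_exp α β α' β' z.1,
    ← W.power_mul_exp α β α' β' z.2]
  have h1 : Complex.exp (κ' * Real.log ‖timeParam ε (z.1.1 - z.2.1)‖ +
      α' * (W.ℓ z.1 + W.ℓ z.2) + β' * (W.ω z.1.1 + W.ω z.2.1)) =
      Complex.exp (κ' * Real.log ‖timeParam ε (z.1.1 - z.2.1)‖) *
      Complex.exp (α' * W.ℓ z.1 + β' * W.ω z.1.1) *
      Complex.exp (α' * W.ℓ z.2 + β' * W.ω z.2.1) := by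
    rw [← Complex.exp_add, ← Complex.exp_add]
    congr 1; ring
  rw [h1, add_mul κ κ', Complex.exp_add (κ * _)]
  generalize Complex.exp (κ * _) = a₁
  generalize Complex.exp (κ' * _) = a₂
  generalize Complex.exp (α' * W.ℓ z.1 + _) = a₃
  generalize Complex.exp (α' * W.ℓ z.2 + _) = a₄
  ring

theorem familyIntegrand_ne_zero {ε : ℝ} {g : Lp ℂ 2 (volume : Measure (SpaceTime d))}
    {κ α β : ℂ} {z : SpaceTime d × SpaceTime d} (h : W.familyIntegrand ε g κ α β z ≠ 0) :
    z.1 ∈ W.Ω ∧ z.2 ∈ W.Ω := by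
  rw [familyIntegrand_eq] at h
  have h1 := right_ne_zero_of_mul (left_ne_zero_of_mul h)
  exact ⟨W.power_ne_zero (left_ne_zero_of_mul h1), W.power_ne_zero (right_ne_zero_of_mul h1)⟩

theorem norm_exp_mul_log {c : ℝ} (hc : 0 < c) (κ : ℂ) :
    ‖Complex.exp (κ * Real.log c)‖ = c ^ κ.re := by
  rw [Complex.norm_exp, Complex.re_mul_ofReal, Real.rpow_def_of_pos hc, mul_comm]

/-- With `α` imaginary the weight has modulus `exp (β.re ω)` on `Ω`, a function of time alone. The
value of `β.re` makes its power `2/(1-γ)` equal to `exp (p ω)`, which `time_le` controls. -/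
theorem norm_integral_family_le {γ : ℝ} (hγ0 : 0 < γ) (hγ1 : γ < 1) {ε : ℝ} (hε : 0 < ε)
    (g : Lp ℂ 2 (volume : Measure (SpaceTime d))) (hg : ‖g‖ = 1) {κ α β : ℂ}
    (hκ : κ.re = -γ) (hα : α.re = 0) (hβ : β.re = p * (1 - γ) / 2) :
    ‖∫ z, W.familyIntegrand ε g κ α β z‖ ≤ hlsConst γ := by
  have h1γ : 0 < 1 - γ := by linarith
  have hgm := (Lp.stronglyMeasurable g).measurable
  let w : ℝ → ℝ≥0∞ := (Set.Icc (-W.R) W.R).indicator fun t =>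
    ENNReal.ofReal (Real.exp (β.re * W.ω t))
  have hwm : Measurable w := by
    have := W.measurable_ω
    refine Measurable.indicator ?_ measurableSet_Icc
    fun_prop
  have hbound : ∀ α' β' : ℂ, α'.re = 0 → β'.re = β.re → ∀ P,
      ‖W.power α' β' P * g P‖ₑ ≤ w P.1 * ‖g P‖ₑ := by
    intro α' β' hα' hβ' P
    rw [enorm_mul]
    refine mul_le_mul' ?_ le_rfl
    by_cases hP : P ∈ W.Ω
    · have ht : P.1 ∈ Set.Icc (-W.R) W.R := abs_le.1 (W.abs_fst_le P hP)
      simp only [w, Set.indicator_of_mem ht]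
      rw [← ofReal_norm, norm_power, Set.indicator_of_mem hP, hα', hβ', zero_mul, zero_add]
    · simp [power, Set.indicator_of_notMem hP]
  have key := enorm_integral_kernel_le_of_mixed (d := d) hγ0 hγ1 hε
    (Φ := fun P => W.power α β P * g P)
    (Ψ := fun P => W.power (starRingEnd ℂ α) (starRingEnd ℂ β) P * g P) (g := g)
    ((W.measurable_power _ _).mul hgm) ((W.measurable_power _ _).mul hgm) hgm
    (W.integrable_power_mul _ _ g) (W.integrable_power_mul _ _ g) (W.memLp_power_mul _ _ g)
    (W.memLp_power_mul _ _ g) hwm (hbound _ _ hα rfl)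
    (hbound _ _ (by simpa using hα) (by simp)) ?_ ?_
    (k := fun y => Complex.exp (κ * Real.log ‖timeParam ε (y.1 - y.2)‖)) ?_
    (W.integrable_familyIntegrand hε g κ α β)
  · rw [← ofReal_norm] at key
    exact (ENNReal.ofReal_le_ofReal_iff (hlsConst_pos hγ1).le).1 key
  · have h1 : ‖g‖ₑ = 1 := by rw [← ofReal_norm, hg, ENNReal.ofReal_one]
    rw [Lp.enorm_def, eLpNorm_eq_lintegral_rpow_enorm_toReal (by norm_num) (by norm_num)] at h1
    simp only [ENNReal.toReal_ofNat, ENNReal.rpow_ofNat] at h1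
    have h2 := congrArg (fun x : ℝ≥0∞ => x ^ (2 : ℝ)) h1
    simp only [← ENNReal.rpow_mul] at h2
    norm_num at h2
    exact h2.le
  · refine le_trans (le_of_eq ?_) W.time_le
    rw [← lintegral_indicator measurableSet_Icc]
    refine lintegral_congr fun t => ?_
    by_cases ht : t ∈ Set.Icc (-W.R) W.R
    · simp only [w, Set.indicator_of_mem ht]
      rw [ENNReal.ofReal_rpow_of_pos (Real.exp_pos _), ← Real.exp_mul, hβ]
      congr 2
      field_simp
    · simp only [w, Set.indicator_of_notMem ht]
      exact ENNReal.zero_rpow_of_pos (by positivity)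
  · intro y
    have h0 := norm_timeParam_pos hε (y.1 - y.2)
    rw [← ofReal_norm, norm_exp_mul_log h0, hκ]
    exact enorm_rpow_neg_of_norm_le hγ0.le h0 (abs_le_norm_timeParam _ _)

/-- The squared kernel is at most `π^d |b|^{2κ - d} = π^d |b|^{-γ}`, with `κ` standing for its real
part. Squaring the weight gives `exp (q ℓ)`, whose spatial integral is at most `exp (q ω)`; `β` then
corrects the exponent so that the power `2/(2-γ)` is again `exp (p ω)`. -/
theorem norm_sum_integral_family_le {γ : ℝ} (hγ0 : 0 < γ) (hγ1 : γ < 1) {ε : ℝ} (hε : 0 < ε)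
    {ι : Type*} [Fintype ι] {g : ι → Lp ℂ 2 (volume : Measure (SpaceTime d))}
    (hg : Orthonormal ℂ g) {κ α β : ℂ} (hκ : 2 * κ.re = d - γ) (hα : 2 * α.re = q)
    (hβ : β.re = p * (2 - γ) / 4 - q / 2) {a : ι → ℂ} (ha : ∑ j, ‖a j‖ ^ 2 ≤ 1) :
    ‖∑ j, a j * ∫ z, W.familyIntegrand ε (g j) κ α β z‖ ≤
      Real.sqrt (Real.pi ^ (d : ℝ) * hlsConst γ) := by
  have h2γ : 0 < 2 - γ := by linarith
  let w : ℝ → ℝ≥0∞ := (Set.Icc (-W.R) W.R).indicator fun t =>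
    ENNReal.ofReal (Real.exp (p * (2 - γ) / 2 * W.ω t))
  have hwm : Measurable w := by
    have := W.measurable_ω
    refine Measurable.indicator ?_ measurableSet_Icc
    fun_prop
  have hC := hlsConst_pos hγ1
  let k : SpaceTime d × SpaceTime d → ℂ := fun z =>
    Complex.exp (κ * Real.log ‖timeParam ε (z.1.1 - z.2.1)‖) *
        gaussKernel (timeParam ε (z.1.1 - z.2.1)) (z.1.2 - z.2.2)
  have hkm : Measurable k := by
    have h1 := measurable_log_timeParam (d := d) ε
    have h2 := measurable_gaussKernel_timeParam (d := d) ε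
    simp only [k]
    fun_prop
  have hpm := W.measurable_power α β
  have hN := lintegral_kernel_sq_le_of_mixed (d := d) hγ0 hγ1 hpm hwm ?_ ?_
    (k := k) (c := ENNReal.ofReal (Real.pi ^ (d : ℝ))) ?_
  · have := norm_sum_mul_integral_kernel_le (μ := (volume : Measure (SpaceTime d))) hg
      (k := fun z => k z * (W.power α β z.1 * W.power α β z.2))
      (N := Real.sqrt (Real.pi ^ (d : ℝ) * hlsConst γ))
      (by fun_prop : Measurable _).aestronglyMeasurable (Real.sqrt_nonneg _) ?_ ha
    · refine le_trans (le_of_eq ?_) this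
      congr 1
      refine Finset.sum_congr rfl fun j _ => ?_
      congr 1
      refine integral_congr_ae (Filter.Eventually.of_forall fun z => ?_)
      exact W.familyIntegrand_eq ε (g j) κ α β z
    · rw [Real.sq_sqrt (by positivity), ENNReal.ofReal_mul (by positivity)]
      exact hN
  · intro t
    by_cases ht : t ∈ Set.Icc (-W.R) W.R
    · simp only [w, Set.indicator_of_mem ht]
      have h1 : ∀ x : Space d, ‖W.power α β (t, x)‖ₑ ^ 2 =
          ENNReal.ofReal (Real.exp (2 * β.re * W.ω t)) *
            W.Ω.indicator (fun P => ENNReal.ofReal (Real.exp (q * W.ℓ P))) (t, x) := by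
        intro x
        rw [← ofReal_norm, norm_power]
        by_cases hP : (t, x) ∈ W.Ω
        · rw [Set.indicator_of_mem hP, Set.indicator_of_mem hP, ← ENNReal.ofReal_pow
            (Real.exp_pos _).le, ← ENNReal.ofReal_mul (Real.exp_pos _).le, ← Real.exp_nat_mul,
            ← Real.exp_add]
          congr 2
          push_cast
          linear_combination W.ℓ (t, x) * hα
        · simp [Set.indicator_of_notMem hP]
      simp_rw [h1]
      rw [lintegral_const_mul' _ _ ENNReal.ofReal_ne_top]
      refine (mul_le_mul_right (W.slice_le t) _).trans (le_of_eq ?_)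
      rw [← ENNReal.ofReal_mul (Real.exp_pos _).le, ← Real.exp_add, hβ]
      congr 2
      ring
    · simp only [w, Set.indicator_of_notMem ht]
      have h1 : ∀ x : Space d, ‖W.power α β (t, x)‖ₑ ^ 2 = 0 := by
        intro x
        have hP : (t, x) ∉ W.Ω := fun hP => ht (abs_le.1 (W.abs_fst_le _ hP))
        simp [power, Set.indicator_of_notMem hP]
      simp [h1]
  · refine le_trans (le_of_eq ?_) W.time_le
    rw [← lintegral_indicator measurableSet_Icc]
    refine lintegral_congr fun t => ?_
    by_cases ht : t ∈ Set.Icc (-W.R) W.R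
    · simp only [w, Set.indicator_of_mem ht]
      rw [ENNReal.ofReal_rpow_of_pos (Real.exp_pos _), ← Real.exp_mul]
      congr 2
      field_simp
    · simp only [w, Set.indicator_of_notMem ht]
      exact ENNReal.zero_rpow_of_pos (by positivity)
  · intro z
    have h0 := norm_timeParam_pos hε (z.1.1 - z.2.1)
    set c := ‖timeParam ε (z.1.1 - z.2.1)‖ with hc
    have h1 : ‖k z‖ ≤ c ^ κ.re * (Real.pi / c) ^ ((d : ℝ) / 2) := by
      simp only [k]
      rw [norm_mul, norm_exp_mul_log h0]
      gcongr
      exact norm_gaussKernel_le (by rw [timeParam_re]; exact hε) _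
    have h2 : ‖k z‖ ^ 2 ≤ Real.pi ^ (d : ℝ) * c ^ (-γ) := by
      refine (pow_le_pow_left₀ (norm_nonneg _) h1 2).trans (le_of_eq ?_)
      rw [mul_pow, ← Real.rpow_natCast, ← Real.rpow_mul h0.le, ← Real.rpow_natCast,
        ← Real.rpow_mul (by positivity), Real.div_rpow Real.pi_pos.le h0.le]
      have e1 : (d : ℝ) / 2 * ((2 : ℕ) : ℝ) = d := by push_cast; ring
      have e2 : κ.re * ((2 : ℕ) : ℝ) = -γ + d := by push_cast; linarith
      rw [e1, e2, Real.rpow_add h0]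
      field_simp
    calc ‖k z‖ₑ ^ 2 = ENNReal.ofReal (‖k z‖ ^ 2) := by
          rw [← ofReal_norm, ENNReal.ofReal_pow (norm_nonneg _)]
      _ ≤ ENNReal.ofReal (Real.pi ^ (d : ℝ) * c ^ (-γ)) := ENNReal.ofReal_le_ofReal h2
      _ = ENNReal.ofReal (Real.pi ^ (d : ℝ)) * ENNReal.ofReal (c ^ (-γ)) :=
          ENNReal.ofReal_mul (by positivity)
      _ ≤ _ := by
          gcongr
          exact enorm_rpow_neg_of_norm_le hγ0.le h0 (abs_le_norm_timeParam _ _)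

end TameWeight

end Interpolation


/-! ### Interpolation between the endpoints and duality in the summation index -/

section Core

variable {d : ℕ}

/-- The family has `κ` running from `-γ₀` to `lam`, `α` from `0` to `q/2`, `β` from `β₀` to `β₁`,
and `ν` raised to the power `q'(1 - z/2)`. On the left edge the coefficients are summable, on the
right edge square summable. -/
theorem TameWeight.norm_sum_pairing_le {p q γ₀ γ₁ lam : ℝ} (hγ₀ : 0 < γ₀) (hγ₀1 : γ₀ < 1)
    (hγ₁ : 0 < γ₁) (hγ₁1 : γ₁ < 1) (hlam : 2 * lam = d - γ₁) (hq : 2 < q)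
    (hγq : γ₀ * (q - 2) = 2 * lam) (hpq : 2 * q + d * p = p * q)
    (W : TameWeight d p q) {ε : ℝ} (hε : 0 < ε) {ι : Type*} [Fintype ι]
    {g : ι → Lp ℂ 2 (volume : Measure (SpaceTime d))} (hg : Orthonormal ℂ g) {ν : ι → ℝ}
    (hν : ∀ j, 0 < ν j) (hν1 : ∑ j, ν j ^ (q / (q - 1)) ≤ 1) :
    ‖∑ j, (ν j : ℂ) * W.pairing ε (g j)‖ ≤
      hlsConst γ₀ ^ (1 - 2 / q) * Real.sqrt (Real.pi ^ (d : ℝ) * hlsConst γ₁) ^ (2 / q) := by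
  have hq0 : 0 < q := by linarith
  have hq1 : 0 < q - 1 := by linarith
  set q' : ℝ := q / (q - 1) with hq'
  set β₀ : ℝ := p * (1 - γ₀) / 2 with hβ₀
  set β₁ : ℝ := p * (2 - γ₁) / 4 - q / 2 with hβ₁
  let lb : SpaceTime d × SpaceTime d → ℝ := fun y => Real.log ‖timeParam ε (y.1.1 - y.2.1)‖
  -- The family at `z = 0`; `L` collects the logarithmic derivative in `z` of all the complex
  -- powers, including that of `ν j`.
  let G : ι → SpaceTime d × SpaceTime d → ℂ := fun j y =>
    Complex.exp ((q' * Real.log (ν j) : ℝ) : ℂ) *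
      W.familyIntegrand ε (g j) ((-γ₀ : ℝ) : ℂ) 0 (β₀ : ℂ) y
  let L : ι → SpaceTime d × SpaceTime d → ℝ := fun j y => (lam + γ₀) * lb y +
    q / 2 * (W.ℓ y.1 + W.ℓ y.2) + (β₁ - β₀) * (W.ω y.1.1 + W.ω y.2.1) - q' / 2 * Real.log (ν j)
  have hGint : ∀ j, Integrable (G j) volume := fun j =>
    (W.integrable_familyIntegrand hε (g j) _ _ _).const_mul _
  have hLm : ∀ j, Measurable (L j) := by
    intro j
    have h1 : Measurable lb := TameWeight.measurable_log_timeParam ε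
    have h2 := W.measurable_ℓ
    have h3 := W.measurable_ω
    simp only [L]
    fun_prop
  have hLB : ∀ j y, G j y ≠ 0 → |L j y| ≤ |lam + γ₀| * (|Real.log ε| +
      |Real.log (ε + 4 * Real.pi ^ 2 * (2 * W.R))|) + |q / 2| * (W.M + W.M) +
      |β₁ - β₀| * (W.M + W.M) + |q' / 2 * Real.log (ν j)| := by
    intro j y hy
    obtain ⟨hy1, hy2⟩ := W.familyIntegrand_ne_zero (right_ne_zero_of_mul hy)
    have h1 := W.abs_log_norm_timeParam_le hε hy1 hy2
    simp only [L]
    refine (abs_sub _ _).trans (add_le_add ((abs_add_le _ _).trans (add_le_add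
      ((abs_add_le _ _).trans (add_le_add ?_ ?_)) ?_)) le_rfl)
    · rw [abs_mul]; gcongr
    · rw [abs_mul]
      gcongr
      exact (abs_add_le _ _).trans (add_le_add (W.abs_ℓ_le _) (W.abs_ℓ_le _))
    · rw [abs_mul]
      gcongr
      exact (abs_add_le _ _).trans (add_le_add (W.abs_ω_le _) (W.abs_ω_le _))
  have hfam : ∀ (j : ι) (z : ℂ), ∫ y, G j y * Complex.exp (z * L j y) =
      Complex.exp ((q' - z * (q' / 2)) * Real.log (ν j)) *
        ∫ y, W.familyIntegrand ε (g j) ((-γ₀ : ℝ) + z * (lam + γ₀)) (z * (q / 2))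
          (β₀ + z * (β₁ - β₀)) y := by
    intro j z
    rw [← integral_const_mul]
    refine integral_congr_ae (Filter.Eventually.of_forall fun y => ?_)
    have h1 := W.familyIntegrand_mul_exp ε (g j) ((-γ₀ : ℝ) : ℂ) 0 (β₀ : ℂ) (z * (lam + γ₀))
      (z * (q / 2)) (z * (β₁ - β₀)) y
    rw [zero_add] at h1
    simp only [G]
    rw [← h1, mul_assoc, mul_left_comm, ← Complex.exp_add,
      mul_left_comm _ (W.familyIntegrand _ _ _ _ _ _),
      ← Complex.exp_add]
    congr 2
    simp only [L, lb]
    push_cast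
    ring
  have hexp : ∀ (j : ι) (z : ℂ), ‖Complex.exp ((q' - z * (q' / 2)) * Real.log (ν j))‖ =
      ν j ^ (q' * (1 - z.re / 2)) := by
    intro j z
    rw [TameWeight.norm_exp_mul_log (hν j)]
    congr 1
    have : (q' : ℂ) - z * (q' / 2) = q' - z * ((q' / 2 : ℝ) : ℂ) := by push_cast; ring
    rw [this, Complex.sub_re, Complex.ofReal_re, Complex.re_mul_ofReal]
    ring
  have hre : ∀ (a b : ℝ) (z : ℂ), ((a : ℂ) + z * (b : ℂ)).re = a + z.re * b := by
    intro a b z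
    rw [Complex.add_re, Complex.ofReal_re, Complex.re_mul_ofReal]
  have hκre : ∀ z : ℂ, (((-γ₀ : ℝ) : ℂ) + z * (lam + γ₀)).re = -γ₀ + z.re * (lam + γ₀) := by
    intro z; rw [← hre]; push_cast; rfl
  have hαre : ∀ z : ℂ, (z * ((q : ℂ) / 2)).re = z.re * (q / 2) := by
    intro z; rw [← Complex.re_mul_ofReal]; push_cast; rfl
  have hβre : ∀ z : ℂ, ((β₀ : ℂ) + z * (β₁ - β₀)).re = β₀ + z.re * (β₁ - β₀) := by
    intro z; rw [← hre]; push_cast; rfl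
  have h₀ : ∀ z : ℂ, z.re = 0 →
      ‖∑ j, ∫ y, G j y * Complex.exp (z * L j y)‖ ≤ hlsConst γ₀ := by
    intro z hz
    simp_rw [hfam]
    refine (norm_sum_le _ _).trans ?_
    calc _ ≤ ∑ j, ν j ^ q' * hlsConst γ₀ := by
          refine Finset.sum_le_sum fun j _ => ?_
          rw [norm_mul, hexp, hz]
          norm_num only
          rw [mul_one]
          refine mul_le_mul_of_nonneg_left ?_ (Real.rpow_nonneg (hν j).le _)
          refine W.norm_integral_family_le hγ₀ hγ₀1 hε (g j) (hg.1 j) ?_ ?_ ?_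
          · rw [hκre, hz]; ring
          · rw [hαre, hz]; ring
          · rw [hβre, hz]; ring
      _ = (∑ j, ν j ^ q') * hlsConst γ₀ := by rw [Finset.sum_mul]
      _ ≤ 1 * hlsConst γ₀ := by
          have := hlsConst_pos hγ₀1
          gcongr
      _ = _ := one_mul _
  have h₁ : ∀ z : ℂ, z.re = 1 → ‖∑ j, ∫ y, G j y * Complex.exp (z * L j y)‖ ≤
      Real.sqrt (Real.pi ^ (d : ℝ) * hlsConst γ₁) := by
    intro z hz
    simp_rw [hfam]
    refine W.norm_sum_integral_family_le hγ₁ hγ₁1 hε hg ?_ ?_ ?_ ?_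
    · rw [hκre, hz]; linarith
    · rw [hαre, hz]; ring
    · rw [hβre, hz]; ring
    · refine le_trans (le_of_eq ?_) hν1
      refine Finset.sum_congr rfl fun j _ => ?_
      rw [hexp, hz, ← Real.rpow_natCast, ← Real.rpow_mul (hν j).le]
      congr 1
      push_cast
      ring
  -- At `τ = 2/q` the exponents become `κ = 0`, `α = 1`, `β = 0`, and `ν` has power one. The value
  -- of `κ` uses `hγq`; that of `β` also uses the scaling relation `hpq`.
  have key := norm_sum_integral_le_interp hGint hLm hLB h₀ h₁ (τ := 2 / q) (by positivity)
    (by rw [div_le_one hq0]; exact hq.le)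
  refine le_trans (le_of_eq ?_) key
  congr 1
  refine Finset.sum_congr rfl fun j _ => ?_
  rw [hfam, ← W.familyIntegrand_zero_one_zero]
  congr 1
  · have h1 : (q' : ℂ) - ((2 / q : ℝ) : ℂ) * (q' / 2) = ((1 : ℝ) : ℂ) := by
      have : q' - 2 / q * (q' / 2) = 1 := by rw [hq']; field_simp
      rw [← this]; push_cast; ring
    rw [h1, ← Complex.ofReal_mul, one_mul, ← Complex.ofReal_exp, Real.exp_log (hν j)]
  · have h1 : ((-γ₀ : ℝ) : ℂ) + ((2 / q : ℝ) : ℂ) * (lam + γ₀) = 0 := by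
      have : -γ₀ + 2 / q * (lam + γ₀) = 0 := by
        field_simp
        linarith
      have h2 := congrArg (fun x : ℝ => (x : ℂ)) this
      push_cast at h2 ⊢
      exact h2
    have h2 : ((2 / q : ℝ) : ℂ) * ((q : ℂ) / 2) = 1 := by
      have hqc : (q : ℂ) ≠ 0 := by exact_mod_cast hq0.ne'
      push_cast
      field_simp
    have h3 : (β₀ : ℂ) + ((2 / q : ℝ) : ℂ) * (β₁ - β₀) = 0 := by
      have : β₀ + 2 / q * (β₁ - β₀) = 0 := by
        rw [hβ₀, hβ₁]
        field_simp
        have e1 : γ₁ = d - 2 * lam := by linarith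
        rw [e1]
        linear_combination (-4) * p * hγq - 4 * hpq
      have h2 := congrArg (fun x : ℝ => (x : ℂ)) this
      push_cast at h2 ⊢
      exact h2
    rw [h1, h2, h3]

/-- The converse of Hölder's inequality in `ℓ^q`, restricted to strictly positive multipliers
because the interpolation takes `log (ν j)`. -/
theorem sum_rpow_le_of_forall_sum_mul_le {ι : Type*} [Fintype ι] {q C : ℝ} (hq : 1 < q)
    (hC : 0 ≤ C) {c : ι → ℝ} (hc : ∀ j, 0 < c j)
    (h : ∀ ν : ι → ℝ, (∀ j, 0 < ν j) → ∑ j, ν j ^ (q / (q - 1)) ≤ 1 → ∑ j, ν j * c j ≤ C) :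
    ∑ j, c j ^ q ≤ C ^ q := by
  rcases isEmpty_or_nonempty ι with hι | hι
  · simpa using Real.rpow_nonneg hC q
  set S := ∑ j, c j ^ q with hS
  have hS0 : 0 < S := Finset.sum_pos (fun j _ => Real.rpow_pos_of_pos (hc j) q)
    Finset.univ_nonempty
  have hq1 : 0 < q - 1 := by linarith
  have hq0 : 0 < q := by linarith
  -- The extremal sequence of Hölder's inequality, normalized to have `q'`-power sum one.
  have h1 := h (fun j => c j ^ (q - 1) / S ^ ((q - 1) / q))
    (fun j => div_pos (Real.rpow_pos_of_pos (hc j) _) (Real.rpow_pos_of_pos hS0 _)) ?_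
  · have h2 : ∑ j, c j ^ (q - 1) / S ^ ((q - 1) / q) * c j = S ^ (1 / q) := by
      have h3 : ∀ j, c j ^ (q - 1) / S ^ ((q - 1) / q) * c j = c j ^ q / S ^ ((q - 1) / q) := by
        intro j
        rw [div_mul_eq_mul_div]
        congr 1
        nth_rewrite 2 [← Real.rpow_one (c j)]
        rw [← Real.rpow_add (hc j)]
        ring_nf
      simp_rw [h3]
      rw [← Finset.sum_div, ← hS, div_eq_iff (Real.rpow_pos_of_pos hS0 _).ne', ← Real.rpow_add hS0]
      have : 1 / q + (q - 1) / q = 1 := by field_simp; ring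
      rw [this, Real.rpow_one]
    rw [h2] at h1
    calc S = (S ^ (1 / q)) ^ q := by
          rw [← Real.rpow_mul hS0.le, one_div_mul_cancel hq0.ne', Real.rpow_one]
      _ ≤ C ^ q := Real.rpow_le_rpow (Real.rpow_nonneg hS0.le _) h1 hq0.le
  · have h3 : ∀ j, (c j ^ (q - 1) / S ^ ((q - 1) / q)) ^ (q / (q - 1)) = c j ^ q / S := by
      intro j
      rw [Real.div_rpow (Real.rpow_nonneg (hc j).le _) (Real.rpow_nonneg hS0.le _),
        ← Real.rpow_mul (hc j).le, ← Real.rpow_mul hS0.le]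
      congr 2
      · field_simp
      · have : (q - 1) / q * (q / (q - 1)) = 1 := by field_simp
        rw [this, Real.rpow_one]
    simp_rw [h3]
    rw [← Finset.sum_div, ← hS, div_self hS0.ne']

theorem exists_sum_pairing_rpow_le {p q : ℝ} (hd : 1 ≤ d) (hp : 1 ≤ p)
    (hpq : 2 / p + (d : ℝ) / q = 1) (hq : (d : ℝ) + 1 < q) :
    ∃ C : ℝ, 0 < C ∧ ∀ (W : TameWeight d p q) (ε : ℝ), 0 < ε → ∀ (n : ℕ)
      (g : Fin n → Lp ℂ 2 (volume : Measure (SpaceTime d))), Orthonormal ℂ g →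
      (∀ j, ∃ c : ℝ, 0 ≤ c ∧ W.pairing ε (g j) = c) →
      ∑ j, ‖W.pairing ε (g j)‖ ^ q ≤ C ^ q := by
  have hd' : (1 : ℝ) ≤ d := by exact_mod_cast hd
  -- With `γ₀ = 2 lam / (q - 2)` and `γ₁ = d - 2 lam`, both in `(0, 1)` exactly when `lam > 0`, `(d
  -- - 1)/2 < lam < d/2` and `lam < (q - 2)/2`. Such a `lam` exists because `q > d + 1` and `d ≥ 1`.
  obtain ⟨lam, hl1, hl2⟩ := exists_between
    (show ((d : ℝ) - 1) / 2 < min ((d : ℝ) / 2) ((q - 2) / 2) from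
      lt_min (by linarith) (by linarith))
  have hl3 := lt_of_lt_of_le hl2 (min_le_left _ _)
  have hl4 := lt_of_lt_of_le hl2 (min_le_right _ _)
  have hq2 : 0 < q - 2 := by linarith
  have hlam0 : 0 < lam := by linarith
  have hγ₀ : 0 < 2 * lam / (q - 2) := by positivity
  have hγ₀1 : 2 * lam / (q - 2) < 1 := by rw [div_lt_one hq2]; linarith
  have hγ₁ : 0 < d - 2 * lam := by linarith
  have hγ₁1 : d - 2 * lam < 1 := by linarith
  have hpq' : 2 * q + d * p = p * q := by
    have : q ≠ 0 := by linarith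
    have hp0 : p ≠ 0 := by linarith
    field_simp at hpq
    linarith
  have hC0 := hlsConst_pos hγ₀1
  have hC1 := hlsConst_pos hγ₁1
  refine ⟨hlsConst (2 * lam / (q - 2)) ^ (1 - 2 / q) *
    Real.sqrt (Real.pi ^ (d : ℝ) * hlsConst (d - 2 * lam)) ^ (2 / q), by positivity, ?_⟩
  intro W ε hε n g hg hc
  choose c hc0 hc using hc
  have hn : ∀ j, ‖W.pairing ε (g j)‖ = c j := fun j => by
    rw [hc, Complex.norm_real, Real.norm_of_nonneg (hc0 j)]
  simp_rw [hn]
  -- Vanishing terms are dropped, so that the extremal multipliers are strictly positive.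
  have h1 : ∑ j, c j ^ q = ∑ j : {j // 0 < c j}, c j ^ q := by
    rw [← Finset.sum_subtype (Finset.univ.filter fun k => 0 < c k) (by simp)
        (fun k => c k ^ q), Finset.sum_filter]
    refine Finset.sum_congr rfl fun k _ => ?_
    split_ifs with hk
    · rfl
    · rw [le_antisymm (not_lt.1 hk) (hc0 k), Real.zero_rpow (by linarith)]
  rw [h1]
  refine sum_rpow_le_of_forall_sum_mul_le (by linarith) (by positivity) (fun j => j.2)
    fun ν hν hν1 => ?_
  have key := W.norm_sum_pairing_le (lam := lam) hγ₀ hγ₀1 hγ₁ hγ₁1 (by ring) (by linarith)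
    (by field_simp) hpq' hε
    (g := fun j : {j // 0 < c j} => g j) (hg.comp _ Subtype.val_injective) hν hν1
  simp_rw [hc] at key
  refine le_trans (le_of_eq ?_) key
  have : ∑ j : {j // 0 < c j}, (ν j : ℂ) * (c j : ℂ) =
      ((∑ j : {j // 0 < c j}, ν j * c j : ℝ) : ℂ) := by push_cast; rfl
  rw [this, Complex.norm_real, Real.norm_of_nonneg]
  exact Finset.sum_nonneg fun j _ => mul_nonneg (hν j).le j.2.le

end Core


/-! ### Jointly measurable representatives of the free evolution -/

section Wave

variable {d : ℕ}

/-- The plane wave `exp (i (-2π x·ξ + 4π² t |ξ|²))`. -/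
noncomputable def planeWave (P : SpaceTime d) (ξ : Space d) : ℂ :=
  Complex.exp (((-2 * Real.pi * ⟪P.2, ξ⟫_ℝ + 4 * Real.pi ^ 2 * P.1 * ‖ξ‖ ^ 2 : ℝ) : ℂ) * Complex.I)

theorem norm_planeWave (P : SpaceTime d) (ξ : Space d) : ‖planeWave P ξ‖ = 1 :=
  Complex.norm_exp_ofReal_mul_I _

theorem continuous_planeWave :
    Continuous fun z : SpaceTime d × Space d => planeWave z.1 z.2 := by
  unfold planeWave
  fun_prop

/-- The superposition of plane waves with amplitude `h`. -/
noncomputable def waveIntegral (h : Space d → ℂ) (P : SpaceTime d) : ℂ :=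
  ∫ ξ, starRingEnd ℂ (planeWave P ξ) * h ξ

theorem continuous_waveIntegral {h : Space d → ℂ} (hh : Integrable h volume) :
    Continuous (waveIntegral h) := by
  refine continuous_of_dominated (bound := fun ξ => ‖h ξ‖) (fun P => ?_) (fun P => ?_) hh.norm
    (Filter.Eventually.of_forall fun ξ => ?_)
  · refine AEStronglyMeasurable.mul ?_ hh.1
    exact (Complex.continuous_conj.comp
      (continuous_planeWave.comp (Continuous.prodMk_right P))).aestronglyMeasurable
  · refine Filter.Eventually.of_forall fun ξ => ?_
    rw [norm_mul, RCLike.norm_conj, norm_planeWave, one_mul]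
  · have h1 : Continuous fun P : SpaceTime d => planeWave P ξ := by
      unfold planeWave
      fun_prop
    exact (Complex.continuous_conj.comp h1).mul continuous_const

theorem norm_schrodingerSymbol (t : ℝ) (ξ : Space d) : ‖schrodingerSymbol t ξ‖ = 1 := by
  have h : -Complex.I * ((t * (2 * Real.pi * ‖ξ‖) ^ 2 : ℝ) : ℂ)
      = ((-(t * (2 * Real.pi * ‖ξ‖) ^ 2) : ℝ) : ℂ) * Complex.I := by
    push_cast; ring
  rw [schrodingerSymbol, h, Complex.norm_exp_ofReal_mul_I]

theorem norm_symbol_smul (t : ℝ) (F : Lp ℂ 2 (volume : Measure (Space d))) :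
    ‖((memLp_schrodingerSymbol t).toLp (schrodingerSymbol (d := d) t) • F :
      Lp ℂ 2 (volume : Measure (Space d)))‖ = ‖F‖ := by
  rw [Lp.norm_def, Lp.norm_def]
  congr 1
  refine eLpNorm_congr_norm_ae ?_
  filter_upwards [Lp.coeFn_lpSMul (r := 2)
    ((memLp_schrodingerSymbol t).toLp (schrodingerSymbol (d := d) t)) F,
    (memLp_schrodingerSymbol (d := d) t).coeFn_toLp] with ξ h1 h2
  rw [h1, Pi.smul_apply', h2, norm_smul, norm_schrodingerSymbol, one_mul]

theorem norm_schrodinger (t : ℝ) (f : Lp ℂ 2 (volume : Measure (Space d))) :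
    ‖schrodinger t f‖ = ‖f‖ := by
  rw [schrodinger]
  refine ((Lp.fourierTransformₗᵢ (Space d) ℂ).symm.norm_map _).trans ?_
  rw [norm_symbol_smul, Lp.norm_fourier_eq]

theorem schrodinger_add (t : ℝ) (f g : Lp ℂ 2 (volume : Measure (Space d))) :
    schrodinger t (f + g) = schrodinger t f + schrodinger t g := by
  simp only [schrodinger]
  rw [FourierTransform.fourier_add, Lp.add_smul, FourierTransform.fourierInv_add]

theorem schrodinger_smul (t : ℝ) (c : ℂ) (f : Lp ℂ 2 (volume : Measure (Space d))) :
    schrodinger t (c • f) = c • schrodinger t f := by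
  simp only [schrodinger]
  rw [FourierTransform.fourier_smul, ← Lp.smul_comm, FourierTransform.fourierInv_smul]

theorem schrodinger_sub (t : ℝ) (f g : Lp ℂ 2 (volume : Measure (Space d))) :
    schrodinger t (f - g) = schrodinger t f - schrodinger t g := by
  have h := schrodinger_add t (f - g) g
  rw [sub_add_cancel] at h
  rw [h, add_sub_cancel_right]

theorem schrodinger_ae_eq_waveIntegral {f : Lp ℂ 2 (volume : Measure (Space d))}
    {h : Space d → ℂ} (hf : (𝓕 f : Lp ℂ 2 (volume : Measure (Space d))) =ᵐ[volume] h)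
    (hh : Integrable h volume) (t : ℝ) :
    schrodinger t f =ᵐ[volume] fun x => waveIntegral h (t, x) := by
  set G : Lp ℂ 2 (volume : Measure (Space d)) :=
    (memLp_schrodingerSymbol t).toLp (schrodingerSymbol (d := d) t) • 𝓕 f with hG
  have hGae : G =ᵐ[volume] fun ξ => schrodingerSymbol t ξ * h ξ := by
    filter_upwards [Lp.coeFn_lpSMul (r := 2)
      ((memLp_schrodingerSymbol t).toLp (schrodingerSymbol (d := d) t))
      (𝓕 f : Lp ℂ 2 (volume : Measure (Space d))),
      (memLp_schrodingerSymbol (d := d) t).coeFn_toLp, hf] with ξ h1 h2 h3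
    rw [hG, h1, Pi.smul_apply', h2, smul_eq_mul, h3]
  have hGint : Integrable G volume := by
    refine Integrable.congr (hh.bdd_mul (c := 1) ?_
      (Filter.Eventually.of_forall fun ξ => (norm_schrodingerSymbol t ξ).le)) hGae.symm
    exact (memLp_schrodingerSymbol t).1
  filter_upwards [fourierInv_ae_eq G hGint] with x hx
  rw [schrodinger, ← hG, hx, Real.fourierInv_eq', waveIntegral]
  refine integral_congr_ae ?_
  filter_upwards [hGae] with ξ hξ
  rw [hξ, smul_eq_mul, ← mul_assoc]
  congr 1
  rw [schrodingerSymbol, planeWave, ← Complex.exp_conj, ← Complex.exp_add, map_mul,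
    Complex.conj_ofReal, Complex.conj_I, real_inner_comm]
  congr 1
  push_cast
  ring

theorem exists_schwartz_near (F : Lp ℂ 2 (volume : Measure (Space d))) {δ : ℝ} (hδ : 0 < δ) :
    ∃ h : SchwartzMap (Space d) ℂ, ‖h.toLp 2 volume - F‖ < δ := by
  have h1 := SchwartzMap.denseRange_toLpCLM (E := Space d) (F := ℂ) (p := 2)
    (μ := volume) ENNReal.ofNat_ne_top
  obtain ⟨h, hh⟩ := Metric.denseRange_iff.1 h1 F δ hδ
  refine ⟨h, ?_⟩
  rw [← dist_eq_norm, dist_comm]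
  exact hh

/-- `schrodinger t f` is only a class of functions for each `t`, whereas Fubini needs one measurable
function of `(t, x)`. Schwartz data on the Fourier side give continuous solutions; approximating `f`
at a geometric rate, their pointwise limit is a representative for every `t`, because the propagator
is isometric and the rate does not depend on `t`. -/
theorem exists_wave (f : Lp ℂ 2 (volume : Measure (Space d))) :
    ∃ u : SpaceTime d → ℂ, StronglyMeasurable u ∧
      ∀ t, (fun x => u (t, x)) =ᵐ[volume] schrodinger t f := by
  choose h hh using fun n : ℕ => exists_schwartz_near
    (𝓕 f : Lp ℂ 2 (volume : Measure (Space d))) (δ := (1 / 2 : ℝ) ^ n) (by positivity)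
  let fn : ℕ → Lp ℂ 2 (volume : Measure (Space d)) := fun n => 𝓕⁻ ((h n).toLp 2 volume)
  have hfn : ∀ n, (𝓕 (fn n) : Lp ℂ 2 (volume : Measure (Space d))) = (h n).toLp 2 volume :=
    fun n => FourierTransform.fourier_fourierInv_eq _
  have hfnf : ∀ n, ‖fn n - f‖ < (1 / 2 : ℝ) ^ n := by
    intro n
    have h1 : ‖(𝓕 (fn n - f) : Lp ℂ 2 (volume : Measure (Space d)))‖ =
        ‖(𝓕 (fn n) : Lp ℂ 2 (volume : Measure (Space d))) - 𝓕 f‖ :=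
      congrArg norm ((Lp.fourierTransformₗᵢ (Space d) ℂ).map_sub (fn n) f)
    rw [← Lp.norm_fourier_eq, h1, hfn]
    exact hh n
  have hInt : ∀ n, Integrable (h n) (volume : Measure (Space d)) := fun n => (h n).integrable
  have hrep : ∀ n t, schrodinger t (fn n) =ᵐ[volume] fun x => waveIntegral (h n) (t, x) := by
    intro n t
    refine schrodinger_ae_eq_waveIntegral ?_ (hInt n) t
    rw [hfn]
    exact (h n).coeFn_toLp 2 volume
  refine ⟨fun P => Filter.limUnder Filter.atTop fun n => waveIntegral (h n) P, ?_, fun t => ?_⟩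
  · exact StronglyMeasurable.limUnder fun n =>
      (continuous_waveIntegral (hInt n)).stronglyMeasurable
  -- Summable squared errors force almost everywhere convergence of the full sequence, without
  -- passing to a subsequence depending on `t`.
  · have hsum : ∑' n, ∫⁻ x, ‖(schrodinger t (fn n) - schrodinger t f : Lp ℂ 2 volume) x‖ₑ ^ 2 <
        ∞ := by
      refine lt_of_le_of_lt (ENNReal.tsum_le_tsum (g := fun n => ENNReal.ofReal ((1 / 4 : ℝ) ^ n))
        fun n => ?_) ?_
      · have h1 : ‖schrodinger t (fn n) - schrodinger t f‖ₑ ≤ ENNReal.ofReal ((1 / 2 : ℝ) ^ n) := by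
          rw [← ofReal_norm, ← schrodinger_sub, norm_schrodinger]
          exact ENNReal.ofReal_le_ofReal (hfnf n).le
        rw [Lp.enorm_def, eLpNorm_eq_lintegral_rpow_enorm_toReal (by norm_num) (by norm_num)] at h1
        simp only [ENNReal.toReal_ofNat, ENNReal.rpow_ofNat] at h1
        have h2 := ENNReal.rpow_le_rpow h1 (z := 2) (by norm_num)
        rw [← ENNReal.rpow_mul, ENNReal.ofReal_rpow_of_nonneg (by positivity) (by norm_num),
          one_div_mul_cancel two_ne_zero, ENNReal.rpow_one] at h2
        refine h2.trans (le_of_eq ?_)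
        congr 1
        rw [Real.rpow_two, ← pow_mul, mul_comm, pow_mul]
        norm_num
      · rw [← ENNReal.ofReal_tsum_of_nonneg (fun n => by positivity)
          (summable_geometric_of_lt_one (by norm_num) (by norm_num))]
        exact ENNReal.ofReal_lt_top
    rw [← lintegral_tsum (fun n => by
      have := (Lp.stronglyMeasurable
        (schrodinger t (fn n) - schrodinger t f : Lp ℂ 2 volume)).measurable
      fun_prop)] at hsum
    have hae := ae_lt_top' (by
      refine AEMeasurable.tsum fun n => ?_
      have := (Lp.stronglyMeasurable
        (schrodinger t (fn n) - schrodinger t f : Lp ℂ 2 volume)).measurable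
      fun_prop) hsum.ne
    filter_upwards [hae, ae_all_iff.2 fun n => hrep n t,
      ae_all_iff.2 fun n => Lp.coeFn_sub (schrodinger t (fn n)) (schrodinger t f)] with x h1 h2 h3
    have h4 := ENNReal.tendsto_atTop_zero_of_tsum_ne_top h1.ne
    refine Filter.Tendsto.limUnder_eq ?_
    rw [tendsto_iff_norm_sub_tendsto_zero]
    have h5 : Filter.Tendsto (fun n => ‖waveIntegral (h n) (t, x) - schrodinger t f x‖ ^ 2)
        Filter.atTop (nhds 0) := by
      have := (ENNReal.tendsto_toReal (by simp)).comp h4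
      refine this.congr fun n => ?_
      simp only [Function.comp]
      rw [h3, Pi.sub_apply, h2, ENNReal.toReal_pow, toReal_enorm]
    have h6 := h5.sqrt
    simpa [Real.sqrt_sq] using h6

/-- A jointly measurable representative of `(t, x) ↦ (e^{itΔ} f)(x)`. -/
noncomputable def wave (f : Lp ℂ 2 (volume : Measure (Space d))) : SpaceTime d → ℂ :=
  (exists_wave f).choose

theorem stronglyMeasurable_wave (f : Lp ℂ 2 (volume : Measure (Space d))) :
    StronglyMeasurable (wave f) := (exists_wave f).choose_spec.1

theorem measurable_wave (f : Lp ℂ 2 (volume : Measure (Space d))) : Measurable (wave f) :=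
  (stronglyMeasurable_wave f).measurable

theorem wave_ae_eq (f : Lp ℂ 2 (volume : Measure (Space d))) (t : ℝ) :
    (fun x => wave f (t, x)) =ᵐ[volume] schrodinger t f := (exists_wave f).choose_spec.2 t

theorem ae_eq_of_forall_slice {u v : SpaceTime d → ℂ} (hu : Measurable u) (hv : Measurable v)
    (h : ∀ t, (fun x => u (t, x)) =ᵐ[volume] fun x => v (t, x)) : u =ᵐ[volume] v := by
  have hm : MeasurableSet {P : SpaceTime d | u P = v P} := measurableSet_eq_fun hu hv
  have := (Measure.ae_prod_mem_iff_ae_ae_mem (μ := (volume : Measure ℝ))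
    (ν := (volume : Measure (Space d))) hm).2 (Filter.Eventually.of_forall h)
  exact this

theorem wave_add (f g : Lp ℂ 2 (volume : Measure (Space d))) :
    wave (f + g) =ᵐ[volume] fun P => wave f P + wave g P := by
  refine ae_eq_of_forall_slice (measurable_wave _) ((measurable_wave f).add (measurable_wave g))
    fun t => ?_
  filter_upwards [wave_ae_eq (f + g) t, wave_ae_eq f t, wave_ae_eq g t,
    Lp.coeFn_add (schrodinger t f) (schrodinger t g)] with x h1 h2 h3 h4
  rw [h1, h2, h3, schrodinger_add, h4, Pi.add_apply]

theorem wave_smul (c : ℂ) (f : Lp ℂ 2 (volume : Measure (Space d))) :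
    wave (c • f) =ᵐ[volume] fun P => c * wave f P := by
  refine ae_eq_of_forall_slice (measurable_wave _) ((measurable_wave f).const_mul c)
    fun t => ?_
  filter_upwards [wave_ae_eq (c • f) t, wave_ae_eq f t,
    Lp.coeFn_smul c (schrodinger t f)] with x h1 h2 h3
  rw [h1, h2, schrodinger_smul, h3, Pi.smul_apply, smul_eq_mul]

theorem wave_ae_eq_waveIntegral {f : Lp ℂ 2 (volume : Measure (Space d))}
    {h : Space d → ℂ} (hf : (𝓕 f : Lp ℂ 2 (volume : Measure (Space d))) =ᵐ[volume] h)
    (hh : Integrable h volume) : wave f =ᵐ[volume] waveIntegral h :=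
  ae_eq_of_forall_slice (measurable_wave _) (continuous_waveIntegral hh).measurable fun t =>
    (wave_ae_eq f t).trans (schrodinger_ae_eq_waveIntegral hf hh t)

theorem lintegral_wave_slice_sq (f : Lp ℂ 2 (volume : Measure (Space d))) (t : ℝ) :
    ∫⁻ x, ‖wave f (t, x)‖ₑ ^ 2 = ‖f‖ₑ ^ 2 := by
  have h1 : ‖schrodinger t f‖ₑ = ‖f‖ₑ := by
    rw [← ofReal_norm, norm_schrodinger, ofReal_norm]
  rw [← h1, Lp.enorm_def, ← eLpNorm_congr_ae (wave_ae_eq f t),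
    eLpNorm_eq_lintegral_rpow_enorm_toReal (by norm_num) (by norm_num), ← ENNReal.rpow_natCast,
    ← ENNReal.rpow_mul]
  norm_num

/-- The operator `f ↦ W · e^{itΔ} f`, when it is bounded. -/
theorem exists_weightedWave {W : SpaceTime d → ℂ} (hW : AEStronglyMeasurable W volume) {c : ℝ}
    (hc : 0 ≤ c) (hb : ∀ f : Lp ℂ 2 (volume : Measure (Space d)),
      eLpNorm (fun P => W P * wave f P) 2 volume ≤ ENNReal.ofReal c * ‖f‖ₑ) :
    ∃ A : Lp ℂ 2 (volume : Measure (Space d)) →L[ℂ] Lp ℂ 2 (volume : Measure (SpaceTime d)),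
      ∀ f, A f =ᵐ[volume] fun P => W P * wave f P := by
  have hmem : ∀ f : Lp ℂ 2 (volume : Measure (Space d)),
      MemLp (fun P => W P * wave f P) 2 volume := fun f =>
    ⟨hW.mul (stronglyMeasurable_wave f).aestronglyMeasurable,
      (hb f).trans_lt (ENNReal.mul_lt_top ENNReal.ofReal_lt_top enorm_lt_top)⟩
  let A₀ : Lp ℂ 2 (volume : Measure (Space d)) →ₗ[ℂ] Lp ℂ 2 (volume : Measure (SpaceTime d)) :=
    { toFun := fun f => (hmem f).toLp _
      map_add' := fun f g => by
        rw [← MemLp.toLp_add]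
        refine MemLp.toLp_congr _ _ ?_
        filter_upwards [wave_add f g] with P hP
        rw [hP, Pi.add_apply, mul_add]
      map_smul' := fun a f => by
        rw [RingHom.id_apply, ← MemLp.toLp_const_smul]
        refine MemLp.toLp_congr _ _ ?_
        filter_upwards [wave_smul a f] with P hP
        rw [hP, Pi.smul_apply, smul_eq_mul]
        ring }
  refine ⟨A₀.mkContinuous c fun f => ?_, fun f => (hmem f).coeFn_toLp⟩
  change ‖(hmem f).toLp _‖ ≤ _
  rw [Lp.norm_toLp]
  refine ENNReal.toReal_le_of_le_ofReal (by positivity) ((hb f).trans (le_of_eq ?_))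
  rw [ENNReal.ofReal_mul hc, ofReal_norm]

end Wave


/-! ### The estimate for tame weights -/

section TameBound

variable {d : ℕ}

/-- Test with `f = e⁻¹ A^* g`. The isometry `e` will be the inverse Fourier transform, so that the
hypothesis is checked in frequency variables. -/
theorem norm_adjoint_apply_le {H K : Type*} [NormedAddCommGroup H] [InnerProductSpace ℂ H]
    [CompleteSpace H] [NormedAddCommGroup K] [InnerProductSpace ℂ K] [CompleteSpace K]
    {A : H →L[ℂ] K} (e : H ≃ₗᵢ[ℂ] H) {g : K} {c : ℝ} (hc : 0 ≤ c)
    (h : ∀ f, ‖⟪g, A (e f)⟫_ℂ‖ ≤ c * ‖f‖) : ‖ContinuousLinearMap.adjoint A g‖ ≤ c := by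
  have h3 := h (e.symm (ContinuousLinearMap.adjoint A g))
  rw [LinearIsometryEquiv.apply_symm_apply, LinearIsometryEquiv.norm_map,
    ← ContinuousLinearMap.adjoint_inner_left, inner_self_eq_norm_sq_to_K, norm_pow,
    RCLike.norm_ofReal, abs_norm, sq] at h3
  rcases (norm_nonneg (ContinuousLinearMap.adjoint A g)).eq_or_lt with h0 | h0
  · rwa [← h0]
  · exact le_of_mul_le_mul_right h3 h0

/-! ### The adjoint in frequency variables and the removal of the regularization -/

namespace TameWeight

variable {p q : ℝ} (W : TameWeight d p q)

theorem weight_nonneg (P : SpaceTime d) : 0 ≤ W.weight P :=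
  Set.indicator_nonneg (fun _ _ => (Real.exp_pos _).le) P

theorem weight_le (P : SpaceTime d) : W.weight P ≤ Real.exp W.M := by
  by_cases hP : P ∈ W.Ω
  · rw [weight, Set.indicator_of_mem hP]
    exact Real.exp_le_exp.2 ((le_abs_self _).trans (W.abs_ℓ_le P))
  · rw [weight, Set.indicator_of_notMem hP]
    exact (Real.exp_pos _).le

/-- A crude bound from conservation of the `L²` norm over the bounded time interval carrying the
weight. It only ensures that the operator and its adjoint exist; the constant disappears from the
final estimate. -/
theorem eLpNorm_weight_mul_wave_le (f : Lp ℂ 2 (volume : Measure (Space d))) :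
    eLpNorm (fun P => (W.weight P : ℂ) * wave f P) 2 volume ≤
      ENNReal.ofReal (Real.exp W.M * Real.sqrt (2 * |W.R|)) * ‖f‖ₑ := by
  have hm := measurable_wave f
  rw [eLpNorm_eq_lintegral_rpow_enorm_toReal (by norm_num) (by norm_num)]
  simp only [ENNReal.toReal_ofNat, ENNReal.rpow_ofNat]
  calc _ ≤ (∫⁻ P : SpaceTime d, (Set.Icc (-|W.R|) |W.R|).indicator
          (fun _ => ENNReal.ofReal (Real.exp W.M) ^ 2) P.1 * ‖wave f P‖ₑ ^ 2) ^ (1 / 2 : ℝ) := by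
        gcongr with P
        rw [enorm_mul, mul_pow]
        refine mul_le_mul' ?_ le_rfl
        by_cases hP : P ∈ W.Ω
        · have ht : P.1 ∈ Set.Icc (-|W.R|) |W.R| :=
            abs_le.1 ((W.abs_fst_le P hP).trans (le_abs_self _))
          rw [Set.indicator_of_mem ht, ← ofReal_norm, Complex.norm_real,
            Real.norm_of_nonneg (W.weight_nonneg P)]
          gcongr
          exact W.weight_le P
        · simp [weight, Set.indicator_of_notMem hP]
    _ = (ENNReal.ofReal (Real.exp W.M) ^ 2 * ENNReal.ofReal (2 * |W.R|) * ‖f‖ₑ ^ 2) ^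
        (1 / 2 : ℝ) := by
        congr 1
        have hind : Measurable ((Set.Icc (-|W.R|) |W.R|).indicator
            (fun _ => ENNReal.ofReal (Real.exp W.M) ^ 2)) :=
          measurable_const.indicator measurableSet_Icc
        rw [Measure.volume_eq_prod, lintegral_prod _ (by fun_prop)]
        have h1 : ∀ t : ℝ, ∫⁻ x : Space d, (Set.Icc (-|W.R|) |W.R|).indicator
            (fun _ => ENNReal.ofReal (Real.exp W.M) ^ 2) t * ‖wave f (t, x)‖ₑ ^ 2 =
            (Set.Icc (-|W.R|) |W.R|).indicator
            (fun _ => ENNReal.ofReal (Real.exp W.M) ^ 2) t * ‖f‖ₑ ^ 2 := by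
          intro t
          rw [lintegral_const_mul _ (by fun_prop), lintegral_wave_slice_sq]
        simp_rw [h1]
        rw [lintegral_mul_const _ hind, lintegral_indicator_const measurableSet_Icc,
          Real.volume_Icc]
        congr 3
        ring
    _ = _ := by
        have h2 : ENNReal.ofReal (2 * |W.R|) = ENNReal.ofReal (Real.sqrt (2 * |W.R|)) ^ 2 := by
          rw [← ENNReal.ofReal_pow (Real.sqrt_nonneg _), Real.sq_sqrt (by positivity)]
        rw [h2, ← mul_pow, ← mul_pow, ← ENNReal.rpow_natCast, ← ENNReal.rpow_mul,
          ENNReal.ofReal_mul (Real.exp_pos _).le]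
        norm_num

/-- The Fourier coefficients of the adjoint of `f ↦ W · e^{itΔ} f`. -/
noncomputable def dualAmplitude (g : Lp ℂ 2 (volume : Measure (SpaceTime d))) (ξ : Space d) : ℂ :=
  ∫ P, (W.weight P * g P) * planeWave P ξ

theorem integrable_weight_mul (g : Lp ℂ 2 (volume : Measure (SpaceTime d))) :
    Integrable (fun P => (W.weight P : ℂ) * g P) volume := by
  have := W.integrable_power_mul 1 0 g
  simpa only [power_one_zero] using this

theorem continuous_dualAmplitude (g : Lp ℂ 2 (volume : Measure (SpaceTime d))) :
    Continuous (W.dualAmplitude g) := by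
  refine continuous_of_dominated (bound := fun P => ‖(W.weight P : ℂ) * g P‖) (fun ξ => ?_)
    (fun ξ => ?_) (W.integrable_weight_mul g).norm (Filter.Eventually.of_forall fun P => ?_)
  · refine (W.integrable_weight_mul g).1.mul (Continuous.aestronglyMeasurable ?_)
    unfold planeWave
    fun_prop
  · refine Filter.Eventually.of_forall fun P => ?_
    rw [norm_mul _ (planeWave P ξ), norm_planeWave, mul_one]
  · refine continuous_const.mul ?_
    unfold planeWave
    fun_prop

theorem norm_dualAmplitude_le (g : Lp ℂ 2 (volume : Measure (SpaceTime d))) (ξ : Space d) :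
    ‖W.dualAmplitude g ξ‖ ≤ ∫ P, ‖(W.weight P : ℂ) * g P‖ := by
  refine (norm_integral_le_integral_norm _).trans (le_of_eq ?_)
  refine integral_congr_ae (Filter.Eventually.of_forall fun P => ?_)
  simp only
  rw [norm_mul _ (planeWave P ξ), norm_planeWave, mul_one]

/-- Fubini: integrating `e^{-ε|ξ|²}` against a plane wave and a conjugate plane wave produces the
Gaussian kernel. The pairing is thus real, nonnegative and monotone in `ε`. -/
theorem pairing_eq {ε : ℝ} (hε : 0 < ε) (g : Lp ℂ 2 (volume : Measure (SpaceTime d))) :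
    W.pairing ε g =
      ((∫ ξ, Real.exp (-ε * ‖ξ‖ ^ 2) * ‖W.dualAmplitude g ξ‖ ^ 2 : ℝ) : ℂ) := by
  have hre : 0 < ((ε : ℝ) : ℂ).re := by simpa using hε
  have hχ : Measurable (Function.uncurry (planeWave (d := d))) := continuous_planeWave.measurable
  have key := integral_mul_conj_integral_eq (integrable_gauss (d := d) hre) hχ
    (fun P ξ => (norm_planeWave P ξ).le) (W.integrable_weight_mul g) (W.integrable_weight_mul g)
  have hK : ∀ z : SpaceTime d × SpaceTime d, ∫ ξ : Space d, Complex.exp (-(ε : ℂ) * ‖ξ‖ ^ 2) *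
      (planeWave z.1 ξ * starRingEnd ℂ (planeWave z.2 ξ)) =
      gaussKernel (timeParam ε (z.1.1 - z.2.1)) (z.1.2 - z.2.2) := by
    intro z
    rw [← integral_gauss_mul_exp (by rw [timeParam_re]; exact hε)]
    refine integral_congr_ae (Filter.Eventually.of_forall fun ξ => ?_)
    have hb : timeParam ε (z.1.1 - z.2.1) =
        (ε : ℂ) - ((4 * Real.pi ^ 2 * (z.1.1 - z.2.1) : ℝ) : ℂ) * Complex.I := by
      rw [timeParam]
      generalize 4 * Real.pi ^ 2 * (z.1.1 - z.2.1) = c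
      apply Complex.ext <;> simp
    simp only [planeWave]
    rw [← Complex.exp_conj, ← Complex.exp_add, ← Complex.exp_add, ← Complex.exp_add, map_mul,
      Complex.conj_ofReal, Complex.conj_I, inner_sub_left, hb]
    congr 1
    push_cast
    ring
  simp_rw [hK] at key
  rw [pairing, Measure.volume_eq_prod, ← key, ← integral_complex_ofReal]
  refine integral_congr_ae (Filter.Eventually.of_forall fun ξ => ?_)
  simp only
  rw [Complex.mul_conj']
  push_cast
  rfl

theorem enorm_pairing_eq {ε : ℝ} (hε : 0 < ε) (g : Lp ℂ 2 (volume : Measure (SpaceTime d))) :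
    ∫⁻ ξ, ENNReal.ofReal (Real.exp (-ε * ‖ξ‖ ^ 2)) * ‖W.dualAmplitude g ξ‖ₑ ^ 2 =
      ENNReal.ofReal ‖W.pairing ε g‖ := by
  have hre : 0 < ((ε : ℝ) : ℂ).re := by simpa using hε
  have hc := W.continuous_dualAmplitude g
  have hInt : Integrable (fun ξ => Real.exp (-ε * ‖ξ‖ ^ 2) * ‖W.dualAmplitude g ξ‖ ^ 2)
      volume := by
    refine ((integrable_gauss (d := d) hre).norm.mul_const
      ((∫ P, ‖(W.weight P : ℂ) * g P‖) ^ 2)).mono' ?_ (Filter.Eventually.of_forall fun ξ => ?_)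
    · exact Continuous.aestronglyMeasurable (by fun_prop)
    · rw [Real.norm_of_nonneg (by positivity), Complex.norm_exp]
      have h1 : (-(ε : ℂ) * (‖ξ‖ : ℂ) ^ 2).re = -ε * ‖ξ‖ ^ 2 := by
        rw [← Complex.ofReal_neg, ← Complex.ofReal_pow, ← Complex.ofReal_mul, Complex.ofReal_re]
      rw [h1]
      gcongr
      exact W.norm_dualAmplitude_le g ξ
  have hnn : 0 ≤ ∫ ξ, Real.exp (-ε * ‖ξ‖ ^ 2) * ‖W.dualAmplitude g ξ‖ ^ 2 :=
    integral_nonneg fun ξ => by positivity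
  rw [W.pairing_eq hε, Complex.norm_real, Real.norm_of_nonneg hnn,
    ofReal_integral_eq_lintegral_ofReal hInt (Filter.Eventually.of_forall fun ξ => by positivity)]
  refine lintegral_congr fun ξ => ?_
  rw [ENNReal.ofReal_mul (Real.exp_pos _).le, ENNReal.ofReal_pow (norm_nonneg _), ofReal_norm]

/-- Monotone convergence along `ε = 1/(m + 1)`, the bound being uniform in `ε`. -/
theorem sum_lintegral_dualAmplitude_rpow_le (hq : 0 < q) {C : ℝ} {n : ℕ}
    {g : Fin n → Lp ℂ 2 (volume : Measure (SpaceTime d))}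
    (h : ∀ ε : ℝ, 0 < ε → ∑ j, ‖W.pairing ε (g j)‖ ^ q ≤ C) :
    ∑ j, (∫⁻ ξ, ‖W.dualAmplitude (g j) ξ‖ₑ ^ 2) ^ q ≤ ENNReal.ofReal C := by
  have hlim : ∀ j, Filter.Tendsto (fun m : ℕ => ∫⁻ ξ : Space d,
      ENNReal.ofReal (Real.exp (-(1 / ((m : ℝ) + 1)) * ‖ξ‖ ^ 2)) * ‖W.dualAmplitude (g j) ξ‖ₑ ^ 2)
      Filter.atTop (nhds (∫⁻ ξ, ‖W.dualAmplitude (g j) ξ‖ₑ ^ 2)) := by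
    intro j
    have hc := (W.continuous_dualAmplitude (g j)).measurable
    refine lintegral_tendsto_of_tendsto_of_monotone (fun m => by fun_prop)
      (Filter.Eventually.of_forall fun ξ m m' hmm => ?_)
      (Filter.Eventually.of_forall fun ξ => ?_)
    · dsimp only
      gcongr
    · have h1 : Filter.Tendsto (fun m : ℕ => Real.exp (-(1 / ((m : ℝ) + 1)) * ‖ξ‖ ^ 2))
          Filter.atTop (nhds 1) := by
        have := (tendsto_one_div_add_atTop_nhds_zero_nat (𝕜 := ℝ)).neg.mul_const (‖ξ‖ ^ 2)
        have h2 := (Real.continuous_exp.tendsto _).comp this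
        simpa [Function.comp_def] using h2
      have h2 := ENNReal.tendsto_ofReal h1
      rw [ENNReal.ofReal_one] at h2
      have h3 := ENNReal.Tendsto.mul_const (b := ‖W.dualAmplitude (g j) ξ‖ₑ ^ 2) h2
        (Or.inl one_ne_zero)
      rwa [one_mul] at h3
  have hsum : Filter.Tendsto (fun m : ℕ => ∑ j, (∫⁻ ξ : Space d,
      ENNReal.ofReal (Real.exp (-(1 / ((m : ℝ) + 1)) * ‖ξ‖ ^ 2)) *
        ‖W.dualAmplitude (g j) ξ‖ₑ ^ 2) ^ q) Filter.atTop
      (nhds (∑ j, (∫⁻ ξ, ‖W.dualAmplitude (g j) ξ‖ₑ ^ 2) ^ q)) :=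
    tendsto_finsetSum _ fun j _ => (ENNReal.continuous_rpow_const.tendsto _).comp (hlim j)
  refine le_of_tendsto' hsum fun m => ?_
  have hm : 0 < 1 / ((m : ℝ) + 1) := by positivity
  simp_rw [W.enorm_pairing_eq hm, ENNReal.ofReal_rpow_of_nonneg (norm_nonneg _) hq.le]
  rw [← ENNReal.ofReal_sum_of_nonneg fun j _ => Real.rpow_nonneg (norm_nonneg _) _]
  exact ENNReal.ofReal_le_ofReal (h _ hm)

theorem inner_weightedWave_eq
    {A : Lp ℂ 2 (volume : Measure (Space d)) →L[ℂ] Lp ℂ 2 (volume : Measure (SpaceTime d))}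
    (hA : ∀ f, A f =ᵐ[volume] fun P => (W.weight P : ℂ) * wave f P)
    (g : Lp ℂ 2 (volume : Measure (SpaceTime d))) {f : Lp ℂ 2 (volume : Measure (Space d))}
    {h : Space d → ℂ} (hf : (𝓕 f : Lp ℂ 2 (volume : Measure (Space d))) =ᵐ[volume] h)
    (hh : Integrable h volume) :
    ⟪g, A f⟫_ℂ = ∫ ξ, starRingEnd ℂ (W.dualAmplitude g ξ) * h ξ := by
  have hgi := W.integrable_weight_mul g
  rw [L2.inner_def]
  calc ∫ P, ⟪g P, A f P⟫_ℂ
      = ∫ P, ∫ ξ, starRingEnd ℂ (W.weight P * g P) * (starRingEnd ℂ (planeWave P ξ) * h ξ) := by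
        refine integral_congr_ae ?_
        filter_upwards [hA f, wave_ae_eq_waveIntegral hf hh] with P h1 h2
        rw [h1, h2, integral_const_mul, ← waveIntegral]
        simp only [RCLike.inner_apply, map_mul, Complex.conj_ofReal]
        ring
    _ = ∫ ξ, ∫ P, starRingEnd ℂ (W.weight P * g P) * (starRingEnd ℂ (planeWave P ξ) * h ξ) := by
        rw [integral_integral_swap]
        have hgc : Integrable (fun P => starRingEnd ℂ (W.weight P * g P)) volume :=
          (LinearIsometryEquiv.integrable_comp_iff Complex.conjLIE).2 hgi
        have h1 := hgc.mul_prod hh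
        have hconj : Measurable (starRingEnd ℂ) := Complex.continuous_conj.measurable
        have h2 := h1.bdd_mul (c := 1) (f := fun z : SpaceTime d × Space d =>
          starRingEnd ℂ (planeWave z.1 z.2))
          (hconj.comp continuous_planeWave.measurable).aestronglyMeasurable
          (Filter.Eventually.of_forall fun z => by rw [RCLike.norm_conj, norm_planeWave])
        refine h2.congr (Filter.Eventually.of_forall fun z => ?_)
        simp only [Function.uncurry]
        ring
    _ = _ := by
        refine integral_congr_ae (Filter.Eventually.of_forall fun ξ => ?_)
        simp only
        rw [dualAmplitude, ← integral_conj, ← integral_mul_const]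
        refine integral_congr_ae (Filter.Eventually.of_forall fun P => ?_)
        simp only [map_mul]
        ring

theorem enorm_integral_conj_mul_le {u h : Space d → ℂ} (hu : Measurable u) (hh : Measurable h) :
    ‖∫ ξ, starRingEnd ℂ (u ξ) * h ξ‖ₑ ≤
      (∫⁻ ξ, ‖u ξ‖ₑ ^ 2) ^ (1 / 2 : ℝ) * eLpNorm h 2 volume := by
  have h1 := ENNReal.lintegral_mul_le_Lp_mul_Lq (volume : Measure (Space d))
    (Real.HolderConjugate.two_two) (f := fun ξ => ‖u ξ‖ₑ)
    (g := fun ξ => ‖h ξ‖ₑ) (by fun_prop) (by fun_prop)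
  rw [eLpNorm_eq_lintegral_rpow_enorm_toReal (by norm_num) (by norm_num)]
  refine (enorm_integral_le_lintegral_enorm _).trans (le_trans (le_of_eq ?_)
    (h1.trans (le_of_eq ?_)))
  · refine lintegral_congr fun ξ => ?_
    rw [enorm_mul, Pi.mul_apply, ← ofReal_norm (starRingEnd ℂ _), RCLike.norm_conj,
      ofReal_norm]
  · simp

/-- For Schwartz `f` the inner product is an absolutely convergent integral against the amplitude,
and Cauchy-Schwarz applies. Both sides are continuous in `f`, so density of Schwartz functions
finishes. -/
theorem norm_inner_weightedWave_fourierInv_le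
    {A : Lp ℂ 2 (volume : Measure (Space d)) →L[ℂ] Lp ℂ 2 (volume : Measure (SpaceTime d))}
    (hA : ∀ f, A f =ᵐ[volume] fun P => (W.weight P : ℂ) * wave f P)
    (g : Lp ℂ 2 (volume : Measure (SpaceTime d)))
    (hfin : ∫⁻ ξ, ‖W.dualAmplitude g ξ‖ₑ ^ 2 ≠ ∞) (f : Lp ℂ 2 (volume : Measure (Space d))) :
    ‖⟪g, A ((Lp.fourierTransformₗᵢ (Space d) ℂ).symm f)⟫_ℂ‖ ≤
      ((∫⁻ ξ, ‖W.dualAmplitude g ξ‖ₑ ^ 2) ^ (1 / 2 : ℝ)).toReal * ‖f‖ := by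
  have hcfin : (∫⁻ ξ, ‖W.dualAmplitude g ξ‖ₑ ^ 2) ^ (1 / 2 : ℝ) ≠ ∞ :=
    ENNReal.rpow_ne_top_of_nonneg (by norm_num) hfin
  have hcm := (W.continuous_dualAmplitude g).measurable
  refine DenseRange.induction_on (SchwartzMap.denseRange_toLpCLM (E := Space d) (F := ℂ) (p := 2)
    (μ := volume) ENNReal.ofNat_ne_top) f ?_ fun h => ?_
  · refine isClosed_le ?_ (continuous_const.mul continuous_norm)
    exact (continuous_const.inner (A.continuous.comp
      (Lp.fourierTransformₗᵢ (Space d) ℂ).symm.continuous)).norm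
  · have hHF : (𝓕 ((Lp.fourierTransformₗᵢ (Space d) ℂ).symm (h.toLp 2 volume)) :
        Lp ℂ 2 (volume : Measure (Space d))) = h.toLp 2 volume :=
      (Lp.fourierTransformₗᵢ (Space d) ℂ).apply_symm_apply _
    have hHh : h.toLp 2 (volume : Measure (Space d)) =ᵐ[volume] h := h.coeFn_toLp 2 volume
    change ‖⟪g, A ((Lp.fourierTransformₗᵢ (Space d) ℂ).symm (h.toLp 2 volume))⟫_ℂ‖ ≤
      _ * ‖h.toLp 2 (volume : Measure (Space d))‖
    rw [W.inner_weightedWave_eq hA g (h := h) (by rw [hHF]; exact hHh) h.integrable]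
    have key := enorm_integral_conj_mul_le hcm h.continuous.measurable
    rw [← eLpNorm_congr_ae hHh, ← Lp.enorm_def, ← ofReal_norm, ← ofReal_norm,
      ← ENNReal.ofReal_toReal hcfin, ← ENNReal.ofReal_mul ENNReal.toReal_nonneg] at key
    exact (ENNReal.ofReal_le_ofReal_iff (by positivity)).1 key

theorem enorm_adjoint_sq_le
    {A : Lp ℂ 2 (volume : Measure (Space d)) →L[ℂ] Lp ℂ 2 (volume : Measure (SpaceTime d))}
    (hA : ∀ f, A f =ᵐ[volume] fun P => (W.weight P : ℂ) * wave f P)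
    (g : Lp ℂ 2 (volume : Measure (SpaceTime d)))
    (hfin : ∫⁻ ξ, ‖W.dualAmplitude g ξ‖ₑ ^ 2 ≠ ∞) :
    ‖ContinuousLinearMap.adjoint A g‖ₑ ^ 2 ≤ ∫⁻ ξ, ‖W.dualAmplitude g ξ‖ₑ ^ 2 := by
  have hcfin : (∫⁻ ξ, ‖W.dualAmplitude g ξ‖ₑ ^ 2) ^ (1 / 2 : ℝ) ≠ ∞ :=
    ENNReal.rpow_ne_top_of_nonneg (by norm_num) hfin
  have hsq : ((∫⁻ ξ, ‖W.dualAmplitude g ξ‖ₑ ^ 2) ^ (1 / 2 : ℝ)) ^ 2 =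
      ∫⁻ ξ, ‖W.dualAmplitude g ξ‖ₑ ^ 2 := by
    rw [← ENNReal.rpow_natCast, ← ENNReal.rpow_mul]
    norm_num
  have h2 := norm_adjoint_apply_le (Lp.fourierTransformₗᵢ (Space d) ℂ).symm
    ENNReal.toReal_nonneg (W.norm_inner_weightedWave_fourierInv_le hA g hfin)
  have h4 := (ENNReal.ofReal_le_iff_le_toReal hcfin).2 h2
  rw [ofReal_norm] at h4
  exact (pow_le_pow_left' h4 2).trans hsq.le

end TameWeight

/-- The interpolation estimate says that `A^*` has bounded `2q`-power sums over orthonormal families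
in space-time; `OrthoBound.of_adjoint` transfers this to `A` with the same constant. -/
theorem exists_tame_bound {p q : ℝ} (hd : 1 ≤ d) (hp : 1 ≤ p)
    (hpq : 2 / p + (d : ℝ) / q = 1) (hq : (d : ℝ) + 1 < q) :
    ∃ C : ℝ, 0 < C ∧ ∀ (W : TameWeight d p q) (n : ℕ)
      (f : Fin n → Lp ℂ 2 (volume : Measure (Space d))), Orthonormal ℂ f →
      ∑ j, (∫⁻ P, ‖(W.weight P : ℂ) * wave (f j) P‖ₑ ^ 2) ^ q ≤ ENNReal.ofReal (C ^ q) := by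
  obtain ⟨C, hC, key⟩ := exists_sum_pairing_rpow_le hd hp hpq hq
  have hd' : (1 : ℝ) ≤ d := by exact_mod_cast hd
  have hq0 : 0 < q := by linarith
  refine ⟨C, hC, fun W n f hf => ?_⟩
  obtain ⟨A, hA⟩ := exists_weightedWave (W := fun P => (W.weight P : ℂ))
    (Complex.measurable_ofReal.comp W.measurable_weight).aestronglyMeasurable
    (by positivity) W.eLpNorm_weight_mul_wave_le
  have hadj : OrthoBound (ContinuousLinearMap.adjoint A) (2 * q) (C ^ q) := by
    intro m g hg
    have h1 := W.sum_lintegral_dualAmplitude_rpow_le hq0 (g := g) (C := C ^ q) fun ε hε =>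
      key W ε hε m g hg fun j => ⟨_, integral_nonneg fun ξ => by positivity, W.pairing_eq hε (g j)⟩
    rw [← ENNReal.ofReal_le_ofReal_iff (by positivity),
      ENNReal.ofReal_sum_of_nonneg fun j _ => Real.rpow_nonneg (norm_nonneg _) _]
    refine le_trans (Finset.sum_le_sum fun j _ => ?_) h1
    -- Square integrability of the amplitude is read off from the summed bound itself.
    have hfin : ∫⁻ ξ, ‖W.dualAmplitude (g j) ξ‖ₑ ^ 2 ≠ ∞ := by
      intro htop
      have h2 := (Finset.single_le_sum (f := fun j =>
        (∫⁻ ξ, ‖W.dualAmplitude (g j) ξ‖ₑ ^ 2) ^ q) (fun _ _ => zero_le)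
        (Finset.mem_univ j)).trans h1
      simp only [htop, ENNReal.top_rpow_of_pos hq0] at h2
      exact absurd h2 (by simp)
    rw [← ENNReal.ofReal_rpow_of_nonneg (norm_nonneg _) (by positivity), ofReal_norm,
      ENNReal.rpow_mul]
    refine ENNReal.rpow_le_rpow ?_ hq0.le
    have := W.enorm_adjoint_sq_le hA (g j) hfin
    rwa [← ENNReal.rpow_natCast] at this
  have h1 := hadj.of_adjoint (by linarith) n f hf
  refine le_trans (le_of_eq ?_) (ENNReal.ofReal_le_ofReal h1)
  rw [ENNReal.ofReal_sum_of_nonneg fun j _ => Real.rpow_nonneg (norm_nonneg _) _]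
  refine Finset.sum_congr rfl fun j _ => ?_
  rw [← ENNReal.ofReal_rpow_of_nonneg (norm_nonneg _) (by positivity), ofReal_norm,
    ENNReal.rpow_mul]
  congr 1
  rw [Lp.enorm_def, eLpNorm_congr_ae (hA (f j)),
    eLpNorm_eq_lintegral_rpow_enorm_toReal (by norm_num) (by norm_num), ← ENNReal.rpow_mul]
  norm_num

end TameBound


/-! ### The estimate for general weights -/

section GeneralWeight

variable {d : ℕ} {p q : ℝ}

theorem indicator_slice_le {Ω : Set (SpaceTime d)} {v : SpaceTime d → ℝ} {R b : ℝ} (hq : 0 < q)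
    (hx : ∀ P ∈ Ω, ‖P.2‖ ≤ R) (hv0 : ∀ P ∈ Ω, 0 < v P) (hb : ∀ P ∈ Ω, v P ≤ b) (t : ℝ) :
    ∫⁻ x : Space d, Ω.indicator (fun P => ENNReal.ofReal (v P ^ q)) (t, x) ≤
      ENNReal.ofReal (b ^ q) * volume (Metric.closedBall (0 : Space d) R) := by
  calc _ ≤ ∫⁻ x : Space d, (Metric.closedBall (0 : Space d) R).indicator
        (fun _ => ENNReal.ofReal (b ^ q)) x := by
        refine lintegral_mono fun x => ?_
        by_cases hP : ((t, x) : SpaceTime d) ∈ Ω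
        · have hx' : x ∈ Metric.closedBall (0 : Space d) R := by
            simpa using hx _ hP
          simp only
          rw [Set.indicator_of_mem hP, Set.indicator_of_mem hx']
          exact ENNReal.ofReal_le_ofReal (Real.rpow_le_rpow (hv0 _ hP).le (hb _ hP) hq.le)
        · simp only
          rw [Set.indicator_of_notMem hP]
          exact zero_le
    _ = _ := by
        rw [lintegral_indicator_const Metric.isClosed_closedBall.measurableSet]

/-- A weight bounded from above and below on a bounded set is tame once its mixed norm is less
than one. -/
theorem exists_tameWeight {Ω : Set (SpaceTime d)} {v : SpaceTime d → ℝ} {R a b : ℝ}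
    (hp : 0 < p) (hq : 0 < q) (hΩ : MeasurableSet Ω) (hv : Measurable v) (ha : 0 < a) (hR : 0 < R)
    (ht : ∀ P ∈ Ω, |P.1| ≤ R) (hx : ∀ P ∈ Ω, ‖P.2‖ ≤ R) (hav : ∀ P ∈ Ω, a ≤ v P)
    (hb : ∀ P ∈ Ω, v P ≤ b)
    (hI : ∫⁻ t : ℝ, (∫⁻ x : Space d, Ω.indicator (fun P => ENNReal.ofReal (v P ^ q)) (t, x)) ^
      (p / q) < 1) :
    ∃ W : TameWeight d p q, W.weight = Ω.indicator v := by
  set S : ℝ → ℝ≥0∞ := fun t => ∫⁻ x : Space d,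
    Ω.indicator (fun P => ENNReal.ofReal (v P ^ q)) (t, x) with hS
  have hSm : Measurable S := by
    refine Measurable.lintegral_prod_right' (f := Ω.indicator fun P => ENNReal.ofReal (v P ^ q)) ?_
    exact Measurable.indicator (by fun_prop) hΩ
  set B : ℝ≥0∞ := ENNReal.ofReal (b ^ q) * volume (Metric.closedBall (0 : Space d) R) with hB
  have hBfin : B ≠ ∞ := ENNReal.mul_ne_top ENNReal.ofReal_ne_top
    (isCompact_closedBall _ _).measure_lt_top.ne
  have hSB : ∀ t, S t ≤ B :=
    indicator_slice_le hq hx (fun P hP => ha.trans_le (hav P hP)) hb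
  have hSfin : ∀ t, S t ≠ ∞ := fun t => ne_top_of_le_ne_top hBfin (hSB t)
  set I : ℝ≥0∞ := ∫⁻ t, S t ^ (p / q) with hIdef
  have hIfin : I ≠ ∞ := ne_top_of_lt hI
  have hI1 : I.toReal < 1 := by
    have := (ENNReal.toReal_lt_toReal hIfin ENNReal.one_ne_top).2 hI
    simpa using this
  -- The spare mass `1 - I`, spread evenly over `[-R, R]`. It keeps the spatial norms away from
  -- zero, so that their logarithms are bounded, while the time integral comes to at most one.
  set δ : ℝ := (1 - I.toReal) / (2 * R) with hδdef
  have hδ : 0 < δ := div_pos (by linarith) (by linarith)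
  set r : ℝ → ℝ := fun t => (S t).toReal ^ (p / q) + δ with hr
  have hrpos : ∀ t, 0 < r t := fun t => by positivity
  have hrB : ∀ t, r t ≤ B.toReal ^ (p / q) + δ := fun t => by
    have := ENNReal.toReal_mono hBfin (hSB t)
    simp only [hr]
    gcongr
  have hδr : ∀ t, δ ≤ r t := fun t => le_add_of_nonneg_left (by positivity)
  let M : ℝ := max (max |Real.log a| |Real.log b|)
    (max |1 / p * Real.log δ| |1 / p * Real.log (B.toReal ^ (p / q) + δ)|)
  refine ⟨{ Ω := Ω, ℓ := Ω.indicator fun P => Real.log (v P), ω := fun t => 1 / p * Real.log (r t)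
            R := R, M := M, measurableSet_Ω := hΩ, abs_fst_le := ht, norm_snd_le := hx
            measurable_ℓ := Measurable.indicator (by fun_prop) hΩ
            abs_ℓ_le := fun P => ?_
            measurable_ω := by fun_prop
            abs_ω_le := fun t => ?_
            slice_le := fun t => ?_
            time_le := ?_ }, ?_⟩
  · by_cases hP : P ∈ Ω
    · rw [Set.indicator_of_mem hP]
      refine (abs_le_max_abs_abs (Real.log_le_log ha (hav P hP))
        (Real.log_le_log (ha.trans_le (hav P hP)) (hb P hP))).trans (le_max_left _ _)
    · rw [Set.indicator_of_notMem hP, abs_zero]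
      exact (abs_nonneg (Real.log a)).trans ((le_max_left _ _).trans (le_max_left _ _))
  · refine (abs_le_max_abs_abs ?_ ?_).trans (le_max_right _ _)
    · exact mul_le_mul_of_nonneg_left (Real.log_le_log hδ (hδr t)) (by positivity)
    · exact mul_le_mul_of_nonneg_left (Real.log_le_log (hrpos t) (hrB t)) (by positivity)
  · have h1 : ∫⁻ x : Space d, Ω.indicator (fun P => ENNReal.ofReal
        (Real.exp (q * Ω.indicator (fun P => Real.log (v P)) P))) (t, x) = S t := by
      refine lintegral_congr fun x => ?_
      by_cases hP : ((t, x) : SpaceTime d) ∈ Ω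
      · rw [Set.indicator_of_mem hP, Set.indicator_of_mem hP, Set.indicator_of_mem hP,
          Real.rpow_def_of_pos (ha.trans_le (hav _ hP)), mul_comm q]
      · rw [Set.indicator_of_notMem hP, Set.indicator_of_notMem hP]
    rw [h1]
    have h2 : Real.exp (q * (1 / p * Real.log (r t))) = r t ^ (q / p) := by
      rw [Real.rpow_def_of_pos (hrpos t)]
      congr 1
      ring
    rw [h2, ENNReal.le_ofReal_iff_toReal_le (hSfin t) (by positivity)]
    calc (S t).toReal = ((S t).toReal ^ (p / q)) ^ (q / p) := by
          rw [← Real.rpow_mul ENNReal.toReal_nonneg, div_mul_div_cancel₀ hq.ne', div_self hp.ne',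
            Real.rpow_one]
      _ ≤ _ := by
          gcongr
          exact le_add_of_nonneg_right hδ.le
  · have h2 : ∀ t, ENNReal.ofReal (Real.exp (p * (1 / p * Real.log (r t)))) =
        S t ^ (p / q) + ENNReal.ofReal δ := by
      intro t
      rw [← mul_assoc, mul_one_div_cancel hp.ne', one_mul, Real.exp_log (hrpos t),
        ENNReal.ofReal_add (by positivity) hδ.le,
        ← ENNReal.ofReal_rpow_of_nonneg ENNReal.toReal_nonneg (by positivity),
        ENNReal.ofReal_toReal (hSfin t)]
    simp_rw [h2]
    rw [lintegral_add_right _ measurable_const, setLIntegral_const, Real.volume_Icc]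
    calc _ ≤ I + ENNReal.ofReal δ * ENNReal.ofReal (R - -R) := by
          gcongr
          exact setLIntegral_le_lintegral _ _
      _ = ENNReal.ofReal (I.toReal + δ * (R - -R)) := by
          rw [ENNReal.ofReal_add ENNReal.toReal_nonneg (by nlinarith),
            ENNReal.ofReal_mul hδ.le, ENNReal.ofReal_toReal hIfin]
      _ = 1 := by
          have : I.toReal + δ * (R - -R) = 1 := by
            rw [hδdef]
            field_simp
            ring
          rw [this, ENNReal.ofReal_one]
  · funext P
    simp only [TameWeight.weight]
    by_cases hP : P ∈ Ω
    · rw [Set.indicator_of_mem hP, Set.indicator_of_mem hP, Set.indicator_of_mem hP,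
        Real.exp_log (ha.trans_le (hav P hP))]
    · rw [Set.indicator_of_notMem hP, Set.indicator_of_notMem hP]

theorem ofReal_sq_mul_enorm_sq {v : ℝ} (hv : 0 ≤ v) (z : ℂ) :
    ‖(v : ℂ) * z‖ₑ ^ 2 = ENNReal.ofReal v ^ 2 * ‖z‖ₑ ^ 2 := by
  rw [enorm_mul, mul_pow, ← ofReal_norm (v : ℂ), Complex.norm_real, Real.norm_of_nonneg hv]

/-- The bound for bounded weights with bounded support. -/
theorem sum_lintegral_indicator_rpow_le {C : ℝ} (hp : 0 < p) (hq : 0 < q)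
    (hC : ∀ (W : TameWeight d p q) (n : ℕ)
      (f : Fin n → Lp ℂ 2 (volume : Measure (Space d))), Orthonormal ℂ f →
      ∑ j, (∫⁻ P, ‖(W.weight P : ℂ) * wave (f j) P‖ₑ ^ 2) ^ q ≤ ENNReal.ofReal (C ^ q))
    {Ω : Set (SpaceTime d)} {v : SpaceTime d → ℝ} {R a b : ℝ}
    (hΩ : MeasurableSet Ω) (hv : Measurable v) (ha : 0 < a) (hR : 0 < R)
    (ht : ∀ P ∈ Ω, |P.1| ≤ R) (hx : ∀ P ∈ Ω, ‖P.2‖ ≤ R) (hav : ∀ P ∈ Ω, a ≤ v P)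
    (hb : ∀ P ∈ Ω, v P ≤ b) {N : ℝ} (hN : 0 < N)
    (hI : ∫⁻ t : ℝ, (∫⁻ x : Space d, Ω.indicator (fun P => ENNReal.ofReal (v P ^ q)) (t, x)) ^
      (p / q) < ENNReal.ofReal N) {n : ℕ}
    {f : Fin n → Lp ℂ 2 (volume : Measure (Space d))} (hf : Orthonormal ℂ f) :
    ∑ j, (∫⁻ P, Ω.indicator (fun P => ENNReal.ofReal (v P) ^ 2 * ‖wave (f j) P‖ₑ ^ 2) P) ^ q ≤
      ENNReal.ofReal (C ^ q) * ENNReal.ofReal N ^ (2 * q / p) := by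
  -- The scaling that brings the mixed norm strictly below one. Homogeneity restores the factor
  -- `c^{-2q} = N^{2q/p}`.
  set c : ℝ := N ^ (-(1 / p)) with hc
  have hc0 : 0 < c := Real.rpow_pos_of_pos hN _
  have hcp : c ^ p = N⁻¹ := by
    rw [hc, ← Real.rpow_mul hN.le, neg_mul, one_div_mul_cancel hp.ne', Real.rpow_neg_one]
  obtain ⟨W, hW⟩ := exists_tameWeight (v := fun P => c * v P) (a := c * a) (b := c * b) hp hq hΩ
    (hv.const_mul c) (by positivity) hR ht hx
    (fun P hP => mul_le_mul_of_nonneg_left (hav P hP) hc0.le)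
    (fun P hP => mul_le_mul_of_nonneg_left (hb P hP) hc0.le) (by
      have h1 : ∀ t, ∫⁻ x : Space d, Ω.indicator (fun P => ENNReal.ofReal ((c * v P) ^ q)) (t, x) =
          ENNReal.ofReal (c ^ q) *
            ∫⁻ x : Space d, Ω.indicator (fun P => ENNReal.ofReal (v P ^ q)) (t, x) := by
        intro t
        rw [← lintegral_const_mul' _ _ ENNReal.ofReal_ne_top]
        refine lintegral_congr fun x => ?_
        by_cases hP : ((t, x) : SpaceTime d) ∈ Ω
        · rw [Set.indicator_of_mem hP, Set.indicator_of_mem hP,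
            Real.mul_rpow hc0.le (ha.le.trans (hav _ hP)), ENNReal.ofReal_mul (by positivity)]
        · rw [Set.indicator_of_notMem hP, Set.indicator_of_notMem hP, mul_zero]
      have h2 : ENNReal.ofReal (c ^ q) ^ (p / q) = ENNReal.ofReal N⁻¹ := by
        rw [ENNReal.ofReal_rpow_of_nonneg (by positivity) (by positivity),
          ← Real.rpow_mul hc0.le, mul_div_cancel₀ _ hq.ne', hcp]
      simp_rw [h1, ENNReal.mul_rpow_of_nonneg _ _ (div_pos hp hq).le, h2]
      rw [lintegral_const_mul' _ _ ENNReal.ofReal_ne_top]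
      calc _ < ENNReal.ofReal N⁻¹ * ENNReal.ofReal N :=
            ENNReal.mul_lt_mul_right (by simpa using hN) ENNReal.ofReal_ne_top hI
        _ = 1 := by
            rw [← ENNReal.ofReal_mul (by positivity), inv_mul_cancel₀ hN.ne', ENNReal.ofReal_one])
  have key := hC W n f hf
  have h3 : ∀ j, ∫⁻ P, ‖(W.weight P : ℂ) * wave (f j) P‖ₑ ^ 2 = ENNReal.ofReal (c ^ 2) *
      ∫⁻ P, Ω.indicator (fun P => ENNReal.ofReal (v P) ^ 2 * ‖wave (f j) P‖ₑ ^ 2) P := by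
    intro j
    rw [← lintegral_const_mul' _ _ ENNReal.ofReal_ne_top]
    refine lintegral_congr fun P => ?_
    rw [ofReal_sq_mul_enorm_sq (W.weight_nonneg P), hW]
    by_cases hP : P ∈ Ω
    · rw [Set.indicator_of_mem hP, Set.indicator_of_mem hP, ENNReal.ofReal_mul hc0.le, mul_pow,
        ENNReal.ofReal_pow hc0.le, mul_assoc]
    · rw [Set.indicator_of_notMem hP, Set.indicator_of_notMem hP]
      simp
  simp_rw [h3, ENNReal.mul_rpow_of_nonneg _ _ hq.le] at key
  rw [← Finset.mul_sum] at key
  have h4 : ENNReal.ofReal (c ^ 2) ^ q * ENNReal.ofReal N ^ (2 * q / p) = 1 := by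
    rw [ENNReal.ofReal_rpow_of_nonneg (by positivity) hq.le,
      ENNReal.ofReal_rpow_of_nonneg hN.le (by positivity), ← ENNReal.ofReal_mul (by positivity),
      ← Real.rpow_natCast, ← Real.rpow_mul hc0.le, hc, ← Real.rpow_mul hN.le,
      ← Real.rpow_add hN]
    have : -(1 / p) * ((2 : ℕ) * q) + 2 * q / p = 0 := by
      push_cast
      ring
    rw [this, Real.rpow_zero, ENNReal.ofReal_one]
  calc _ = (ENNReal.ofReal (c ^ 2) ^ q * ENNReal.ofReal N ^ (2 * q / p)) * _ := by
        rw [h4, one_mul]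
    _ = (ENNReal.ofReal (c ^ 2) ^ q * ∑ j, (∫⁻ P, Ω.indicator
        (fun P => ENNReal.ofReal (v P) ^ 2 * ‖wave (f j) P‖ₑ ^ 2) P) ^ q) *
          ENNReal.ofReal N ^ (2 * q / p) := by ring
    _ ≤ _ := by gcongr

/-- The region on which `v` and the variables are bounded by `n + 1`. -/
def truncation (v : SpaceTime d → ℝ) (n : ℕ) : Set (SpaceTime d) :=
  {P | 1 / ((n : ℝ) + 1) ≤ v P ∧ v P ≤ n + 1 ∧ |P.1| ≤ n + 1 ∧ ‖P.2‖ ≤ n + 1}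

theorem measurableSet_truncation {v : SpaceTime d → ℝ} (hv : Measurable v) (n : ℕ) :
    MeasurableSet (truncation v n) := by
  have h1 : MeasurableSet {P : SpaceTime d | |P.1| ≤ n + 1} :=
    measurableSet_le measurable_fst.norm measurable_const
  have h2 : MeasurableSet {P : SpaceTime d | ‖P.2‖ ≤ n + 1} :=
    measurableSet_le measurable_snd.norm measurable_const
  exact (measurableSet_le measurable_const hv).inter
    ((measurableSet_le hv measurable_const).inter (h1.inter h2))

theorem truncation_mono (v : SpaceTime d → ℝ) : Monotone (truncation v) := by
  intro m n hmn P hP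
  obtain ⟨h1, h2, h3, h4⟩ := hP
  have hmn' : (m : ℝ) ≤ n := by exact_mod_cast hmn
  refine ⟨le_trans ?_ h1, by linarith, by linarith, by linarith⟩
  gcongr

theorem eventually_mem_truncation {v : SpaceTime d → ℝ} {P : SpaceTime d} (hP : 0 < v P) :
    ∀ᶠ n in Filter.atTop, P ∈ truncation v n := by
  obtain ⟨n, hn⟩ := exists_nat_ge (max (max (1 / v P) (v P)) (max |P.1| ‖P.2‖))
  refine Filter.eventually_atTop.2 ⟨n, fun m hm => truncation_mono v hm ?_⟩
  simp only [max_le_iff] at hn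
  obtain ⟨⟨h1, h2⟩, h3, h4⟩ := hn
  refine ⟨?_, by linarith, by linarith, by linarith⟩
  rw [div_le_iff₀ hP] at h1
  rw [div_le_iff₀ (by positivity)]
  nlinarith

theorem tendsto_lintegral_truncation {v : SpaceTime d → ℝ} (hv : Measurable v)
    (hv0 : ∀ P, 0 ≤ v P) {F : SpaceTime d → ℝ≥0∞} (hF : Measurable F)
    (hF0 : ∀ P, v P = 0 → F P = 0) :
    Filter.Tendsto (fun n => ∫⁻ P, (truncation v n).indicator F P) Filter.atTop
      (nhds (∫⁻ P, F P)) := by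
  refine lintegral_tendsto_of_tendsto_of_monotone
    (fun n => (hF.indicator (measurableSet_truncation hv n)).aemeasurable)
    (Filter.Eventually.of_forall fun P m n hmn => ?_) (Filter.Eventually.of_forall fun P => ?_)
  · exact Set.indicator_le_indicator_of_subset (truncation_mono v hmn) (fun _ => zero_le) P
  · rcases (hv0 P).eq_or_lt with h | h
    · have : ∀ n, (truncation v n).indicator F P = 0 := fun n => by
        by_cases hP : P ∈ truncation v n
        · rw [Set.indicator_of_mem hP, hF0 P h.symm]
        · exact Set.indicator_of_notMem hP _
      simp_rw [this, hF0 P h.symm]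
      exact tendsto_const_nhds
    · refine tendsto_const_nhds.congr' ?_
      filter_upwards [eventually_mem_truncation h] with n hn
      rw [Set.indicator_of_mem hn]

/-- The main estimate, in dual form: a Strichartz inequality for orthonormal functions with a
space-time weight. -/
theorem exists_weighted_bound (hd : 1 ≤ d) (hp : 1 ≤ p)
    (hpq : 2 / p + (d : ℝ) / q = 1) (hq : (d : ℝ) + 1 < q) :
    ∃ C : ℝ, 0 < C ∧ ∀ v : SpaceTime d → ℝ, Measurable v → (∀ P, 0 ≤ v P) → ∀ (n : ℕ)
      (f : Fin n → Lp ℂ 2 (volume : Measure (Space d))), Orthonormal ℂ f →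
      ∑ j, (∫⁻ P, ENNReal.ofReal (v P) ^ 2 * ‖wave (f j) P‖ₑ ^ 2) ^ q ≤
        ENNReal.ofReal (C ^ q) *
          (∫⁻ t : ℝ, (∫⁻ x : Space d, ENNReal.ofReal (v (t, x)) ^ q) ^ (p / q)) ^ (2 * q / p) := by
  obtain ⟨C, hC0, hC⟩ := exists_tame_bound hd hp hpq hq
  have hp0 : 0 < p := by linarith
  have hq0 : 0 < q := by
    have : (0 : ℝ) ≤ d := Nat.cast_nonneg d
    linarith
  refine ⟨C, hC0, fun v hv hv0 n f hf => ?_⟩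
  set I : ℝ≥0∞ := ∫⁻ t : ℝ, (∫⁻ x : Space d, ENNReal.ofReal (v (t, x)) ^ q) ^ (p / q) with hI
  rcases eq_or_ne I ∞ with hItop | hItop
  · have h1 : ENNReal.ofReal (C ^ q) ≠ 0 := by
      rw [Ne, ENNReal.ofReal_eq_zero, not_le]
      positivity
    rw [hItop, ENNReal.top_rpow_of_pos (by positivity), ENNReal.mul_top h1]
    exact le_top
  have hlim : Filter.Tendsto (fun m => ∑ j, (∫⁻ P, (truncation v m).indicator
      (fun P => ENNReal.ofReal (v P) ^ 2 * ‖wave (f j) P‖ₑ ^ 2) P) ^ q) Filter.atTop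
      (nhds (∑ j, (∫⁻ P, ENNReal.ofReal (v P) ^ 2 * ‖wave (f j) P‖ₑ ^ 2) ^ q)) := by
    refine tendsto_finsetSum _ fun j _ => (ENNReal.continuous_rpow_const.tendsto _).comp
      (tendsto_lintegral_truncation hv hv0 ?_ fun P hP => ?_)
    · have := measurable_wave (f j)
      fun_prop
    · rw [hP]
      simp
  -- The scaled weight needs a strict inequality and `N > 0`, even if `I = 0`; afterwards `N`
  -- decreases to `I`.
  have hN : ∀ N : ℝ≥0∞, I < N → ∑ j, (∫⁻ P, ENNReal.ofReal (v P) ^ 2 * ‖wave (f j) P‖ₑ ^ 2) ^ q ≤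
      ENNReal.ofReal (C ^ q) * N ^ (2 * q / p) := by
    intro N hIN
    rcases eq_or_ne N ∞ with hNtop | hNtop
    · have h1 : ENNReal.ofReal (C ^ q) ≠ 0 := by
        rw [Ne, ENNReal.ofReal_eq_zero, not_le]
        positivity
      rw [hNtop, ENNReal.top_rpow_of_pos (by positivity), ENNReal.mul_top h1]
      exact le_top
    have hN0 : 0 < N.toReal := ENNReal.toReal_pos (pos_of_gt hIN).ne' hNtop
    refine le_of_tendsto' hlim fun m => ?_
    rw [← ENNReal.ofReal_toReal hNtop] at hIN ⊢
    refine sum_lintegral_indicator_rpow_le (a := 1 / ((m : ℝ) + 1)) (b := m + 1) (R := m + 1)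
      hp0 hq0 hC (measurableSet_truncation hv m) hv (by positivity) (by positivity)
      (fun P hP => hP.2.2.1) (fun P hP => hP.2.2.2) (fun P hP => hP.1) (fun P hP => hP.2.1) hN0
      (lt_of_le_of_lt ?_ hIN) hf
    refine lintegral_mono fun t => ENNReal.rpow_le_rpow (lintegral_mono fun x => ?_) (by positivity)
    refine (Set.indicator_le_self _ _ _).trans (le_of_eq ?_)
    rw [ENNReal.ofReal_rpow_of_nonneg (hv0 _) hq0.le]
  have hcont : Filter.Tendsto (fun N : ℝ≥0∞ => ENNReal.ofReal (C ^ q) * N ^ (2 * q / p))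
      (nhdsWithin I (Set.Ioi I)) (nhds (ENNReal.ofReal (C ^ q) * I ^ (2 * q / p))) := by
    refine ENNReal.Tendsto.const_mul ?_ (Or.inr ENNReal.ofReal_ne_top)
    exact (ENNReal.continuous_rpow_const.tendsto _).mono_left nhdsWithin_le_nhds
  have : (nhdsWithin I (Set.Ioi I)).NeBot := nhdsGT_neBot_of_exists_gt ⟨∞, hItop.lt_top⟩
  refine ge_of_tendsto hcont ?_
  filter_upwards [self_mem_nhdsWithin] with N hIN
  exact hN N hIN

end GeneralWeight


/-! ### The Schatten bound for the paraboloid -/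

section Paraboloid

variable {d : ℕ} {p q : ℝ}

theorem mixedNorm_congr_ae {F G : SpaceTime d → ℂ} (h : F =ᵐ[volume] G) (p q : ℝ≥0∞) :
    mixedNorm p q F = mixedNorm p q G := by
  have h1 : ∀ᵐ t : ℝ, ∀ᵐ x : Space d, F (t, x) = G (t, x) := Measure.ae_ae_of_ae_prod h
  refine eLpNorm_congr_ae ?_
  filter_upwards [h1] with t ht
  exact eLpNorm_congr_ae ht

theorem mixedNorm_ofReal (hp : 0 < p) (hq : 0 < q) (F : SpaceTime d → ℂ) :
    mixedNorm (ENNReal.ofReal p) (ENNReal.ofReal q) F =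
      (∫⁻ t : ℝ, (∫⁻ x : Space d, ‖F (t, x)‖ₑ ^ q) ^ (p / q)) ^ (1 / p) := by
  rw [mixedNorm, eLpNorm_eq_lintegral_rpow_enorm_toReal (by simpa using hp) ENNReal.ofReal_ne_top,
    ENNReal.toReal_ofReal hp.le]
  congr 1
  refine lintegral_congr fun t => ?_
  rw [enorm_eq_self,
    eLpNorm_eq_lintegral_rpow_enorm_toReal (by simpa using hq) ENNReal.ofReal_ne_top,
    ENNReal.toReal_ofReal hq.le, ← ENNReal.rpow_mul, one_div_mul_eq_div]

theorem exists_weighted_mixedNorm_bound (hd : 1 ≤ d) (hp : 1 ≤ p)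
    (hpq : 2 / p + (d : ℝ) / q = 1) (hq : (d : ℝ) + 1 < q) :
    ∃ C : ℝ, 0 < C ∧ ∀ W : SpaceTime d → ℂ, AEStronglyMeasurable W volume → ∀ (n : ℕ)
      (f : Fin n → Lp ℂ 2 (volume : Measure (Space d))), Orthonormal ℂ f →
      ∑ j, (∫⁻ P, ‖W P * wave (f j) P‖ₑ ^ 2) ^ q ≤
        ENNReal.ofReal (C ^ q) *
          mixedNorm (ENNReal.ofReal p) (ENNReal.ofReal q) W ^ (2 * q) := by
  obtain ⟨C, hC0, hC⟩ := exists_weighted_bound hd hp hpq hq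
  have hp0 : 0 < p := by linarith
  have hq0 : 0 < q := by
    have : (0 : ℝ) ≤ d := Nat.cast_nonneg d
    linarith
  refine ⟨C, hC0, fun W hW n f hf => ?_⟩
  have key := hC (fun P => ‖hW.mk W P‖) hW.stronglyMeasurable_mk.measurable.norm
    (fun P => norm_nonneg _) n f hf
  simp only [ofReal_norm] at key
  rw [mixedNorm_congr_ae hW.ae_eq_mk, mixedNorm_ofReal hp0 hq0, ← ENNReal.rpow_mul,
    one_div_mul_eq_div]
  refine le_trans (le_of_eq ?_) key
  refine Finset.sum_congr rfl fun j _ => ?_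
  congr 1
  refine lintegral_congr_ae ?_
  filter_upwards [hW.ae_eq_mk] with P hP
  rw [enorm_mul, mul_pow, hP]

/-- A single normalized function is an orthonormal family, so boundedness of the weighted evolution
is the one-term case of the estimate. -/
theorem eLpNorm_mul_wave_le {W : SpaceTime d → ℂ} (hq : 0 < q) {N : ℝ} (hN : 0 ≤ N)
    (h : ∀ f : Fin 1 → Lp ℂ 2 (volume : Measure (Space d)), Orthonormal ℂ f →
      ∑ j, (∫⁻ P, ‖W P * wave (f j) P‖ₑ ^ 2) ^ q ≤ ENNReal.ofReal (N ^ (2 * q)))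
    (f : Lp ℂ 2 (volume : Measure (Space d))) :
    eLpNorm (fun P => W P * wave f P) 2 volume ≤ ENNReal.ofReal N * ‖f‖ₑ := by
  rcases eq_or_ne f 0 with rfl | hf
  · have h0 : (fun P => W P * wave (0 : Lp ℂ 2 (volume : Measure (Space d))) P) =ᵐ[volume] 0 := by
      have := wave_smul (0 : ℂ) (0 : Lp ℂ 2 (volume : Measure (Space d)))
      rw [zero_smul] at this
      filter_upwards [this] with P hP
      rw [hP, zero_mul, mul_zero, Pi.zero_apply]
    rw [eLpNorm_congr_ae h0, eLpNorm_zero]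
    exact zero_le
  · have hn : ‖f‖ ≠ 0 := norm_ne_zero_iff.2 hf
    set e : Lp ℂ 2 (volume : Measure (Space d)) := ((‖f‖ : ℂ))⁻¹ • f with he
    have hfe : f = (‖f‖ : ℂ) • e := by
      rw [he, smul_smul, mul_inv_cancel₀ (by exact_mod_cast hn), one_smul]
    have hen : ‖e‖ = 1 := by
      rw [he, norm_smul, norm_inv, Complex.norm_real, norm_norm, inv_mul_cancel₀ hn]
    have h1 := h (fun _ => e) ⟨fun _ => hen, fun i j hij => absurd (Subsingleton.elim i j) hij⟩
    simp only [Finset.univ_unique, Finset.sum_singleton] at h1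
    have h2 : eLpNorm (fun P => W P * wave e P) 2 volume ≤ ENNReal.ofReal N := by
      rw [eLpNorm_eq_lintegral_rpow_enorm_toReal (by norm_num) (by norm_num)]
      have h3 := ENNReal.rpow_le_rpow h1 (z := 1 / (2 * q)) (by positivity)
      rw [ENNReal.ofReal_rpow_of_nonneg (by positivity) (by positivity), ← Real.rpow_mul hN,
        ← ENNReal.rpow_mul, mul_one_div_cancel (by positivity), Real.rpow_one] at h3
      have h4 : q * (1 / (2 * q)) = 1 / 2 := by field_simp
      rw [h4] at h3
      simpa using h3
    have h5 : (fun P => W P * wave f P) =ᵐ[volume]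
        (‖f‖ : ℂ) • fun P => W P * wave e P := by
      have := wave_smul (‖f‖ : ℂ) e
      rw [← hfe] at this
      filter_upwards [this] with P hP
      rw [hP, Pi.smul_apply, smul_eq_mul]
      ring
    rw [eLpNorm_congr_ae h5, eLpNorm_const_smul, mul_comm]
    refine mul_le_mul' h2 (le_of_eq ?_)
    rw [← ofReal_norm, Complex.norm_real, norm_norm, ofReal_norm]

/-! ### The paraboloid in frequency coordinates -/

theorem measurable_paraboloidParam : Measurable (paraboloidParam (d := d)) := by
  unfold paraboloidParam
  fun_prop

/-- The area element and the density of `dμ` cancel, leaving Lebesgue measure in `ξ`. -/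
theorem paraboloidMeasure_eq_map :
    paraboloidMeasure d = (volume : Measure (Space d)).map paraboloidParam := by
  have hφ := measurable_paraboloidParam (d := d)
  ext s hs
  rw [paraboloidMeasure, surfaceMeasure, withDensity_apply _ hs,
    setLIntegral_map hs (by fun_prop) hφ,
    setLIntegral_withDensity_eq_setLIntegral_mul _ (by fun_prop)
      (by fun_prop) (hφ hs), Measure.map_apply hφ hs]
  refine (setLIntegral_congr_fun (g := 1) (hφ hs) fun ξ _ => ?_).trans (setLIntegral_one _)
  have h2 : 0 < Real.sqrt (1 + 4 * ‖ξ‖ ^ 2) := Real.sqrt_pos.2 (by positivity)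
  rw [Pi.mul_apply, paraboloidParam, ← ENNReal.ofReal_mul h2.le, mul_inv_cancel₀ h2.ne',
    ENNReal.ofReal_one, Pi.one_apply]

/-- The parametrization of the paraboloid in the frequency variable of Mathlib's Fourier
transform. -/
noncomputable def scaledParam (ξ : Space d) : SpaceTime d :=
  paraboloidParam ((2 * Real.pi) • ξ)

theorem measurable_scaledParam : Measurable (scaledParam (d := d)) :=
  measurable_paraboloidParam.comp (measurable_const_smul _)

theorem map_scaledParam : (volume : Measure (Space d)).map scaledParam =
    ENNReal.ofReal |((2 * Real.pi) ^ d)⁻¹| • paraboloidMeasure d := by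
  have h1 : (scaledParam (d := d)) = paraboloidParam ∘ fun ξ => (2 * Real.pi) • ξ := rfl
  rw [h1, ← Measure.map_map measurable_paraboloidParam (measurable_const_smul _),
    Measure.map_addHaar_smul _ (by positivity), Measure.map_smul, paraboloidMeasure_eq_map,
    finrank_euclideanSpace_fin]

/-- The substitution `ξ ↦ 2πξ` reconciles the kernel `e^{i x·ξ}` with the normalization `e^{2πi
x·ξ}` and contributes the Jacobian `(2π)^d`. -/
theorem extension_eq_waveIntegral (f : SpaceTime d → ℂ)
    (hf : AEStronglyMeasurable f (paraboloidMeasure d)) (z : SpaceTime d) :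
    extension f z = (((2 * Real.pi) ^ (-((d : ℝ) + 1) / 2) * |(2 * Real.pi) ^ d| : ℝ) : ℂ) *
      waveIntegral (fun ξ => f (scaledParam ξ)) z := by
  have hφ := measurable_paraboloidParam (d := d)
  set F : Space d → ℂ := fun ξ => Complex.exp (Complex.I *
    ((z.1 * (paraboloidParam ξ).1 + ⟪z.2, (paraboloidParam ξ).2⟫_ℝ : ℝ) : ℂ)) *
      f (paraboloidParam ξ) with hF
  have h1 : waveIntegral (fun ξ => f (scaledParam ξ)) z = ∫ ξ, F ((2 * Real.pi) • ξ) := by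
    refine integral_congr_ae (Filter.Eventually.of_forall fun ξ => ?_)
    simp only [hF, planeWave, scaledParam, paraboloidParam]
    rw [← Complex.exp_conj, map_mul, Complex.conj_ofReal, Complex.conj_I, norm_smul,
      inner_smul_right, Real.norm_of_nonneg (by positivity)]
    congr 2
    push_cast
    ring
  rw [extension, paraboloidMeasure_eq_map, integral_map hφ.aemeasurable, h1,
    Measure.integral_comp_smul, finrank_euclideanSpace_fin, Complex.real_smul, Complex.ofReal_mul,
    mul_assoc, ← mul_assoc (Complex.ofReal |_|), ← Complex.ofReal_mul, abs_inv,
    mul_inv_cancel₀ (by positivity), Complex.ofReal_one, one_mul]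
  rw [paraboloidMeasure_eq_map] at hf
  exact AEStronglyMeasurable.mul (Continuous.aestronglyMeasurable (by fun_prop)) hf

theorem exists_isometry_comp {α β : Type*} [MeasurableSpace α] [MeasurableSpace β]
    {μ : Measure α} {ν : Measure β} {ψ : α → β} (hψ : Measurable ψ) {k : ℝ} (hk : 0 < k)
    (hmap : μ.map ψ = ENNReal.ofReal (k ^ 2) • ν) :
    ∃ U : Lp ℂ 2 ν →ₗᵢ[ℂ] Lp ℂ 2 μ, ∀ f, U f =ᵐ[μ] fun a => ((k⁻¹ : ℝ) : ℂ) * f (ψ a) := by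
  have hk2 : ENNReal.ofReal (k ^ 2) ≠ 0 := by
    rw [Ne, ENNReal.ofReal_eq_zero, not_le]
    positivity
  have hac : μ.map ψ ≪ ν := by
    rw [hmap]
    exact Measure.smul_absolutelyContinuous
  have hae : ∀ {P : β → Prop}, (∀ᵐ b ∂ν, P b) → ∀ᵐ a ∂μ, P (ψ a) := fun h =>
    ae_of_ae_map hψ.aemeasurable (hac.ae_le h)
  have hnorm : ∀ f : Lp ℂ 2 ν, eLpNorm (((k⁻¹ : ℝ) : ℂ) • fun a => f (ψ a)) 2 μ = ‖f‖ₑ := by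
    intro f
    have h1 : eLpNorm (fun a => f (ψ a)) 2 μ = eLpNorm f 2 (μ.map ψ) :=
      (eLpNorm_map_measure ((Lp.aestronglyMeasurable f).mono_ac hac) hψ.aemeasurable).symm
    rw [eLpNorm_const_smul, h1, hmap, eLpNorm_smul_measure_of_ne_top (by norm_num),
      ← Lp.enorm_def, smul_eq_mul, ← mul_assoc]
    have h2 : ENNReal.ofReal (k ^ 2) ^ (1 / (2 : ℝ≥0∞)).toReal = ENNReal.ofReal k := by
      rw [ENNReal.ofReal_pow hk.le, ← ENNReal.rpow_natCast, ← ENNReal.rpow_mul]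
      norm_num
    rw [h2, ← ofReal_norm, Complex.norm_real, Real.norm_of_nonneg (by positivity),
      ← ENNReal.ofReal_mul (by positivity), inv_mul_cancel₀ hk.ne', ENNReal.ofReal_one, one_mul]
  have hmem : ∀ f : Lp ℂ 2 ν, MemLp (((k⁻¹ : ℝ) : ℂ) • fun a => f (ψ a)) 2 μ := fun f =>
    ⟨AEStronglyMeasurable.const_smul
      (((Lp.aestronglyMeasurable f).mono_ac hac).comp_measurable hψ) _, by
      rw [hnorm f]
      exact enorm_lt_top⟩
  refine ⟨{ toFun := fun f => (hmem f).toLp _, map_add' := fun f g => ?_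
            map_smul' := fun c f => ?_
            norm_map' := fun f => ?_ }, fun f => (hmem f).coeFn_toLp⟩
  · rw [← MemLp.toLp_add]
    refine MemLp.toLp_congr _ _ ?_
    filter_upwards [hae (Lp.coeFn_add f g)] with a ha
    simp only [Pi.smul_apply, Pi.add_apply, ha, smul_add]
  · rw [RingHom.id_apply, ← MemLp.toLp_const_smul]
    refine MemLp.toLp_congr _ _ ?_
    filter_upwards [hae (Lp.coeFn_smul c f)] with a ha
    simp only [Pi.smul_apply, ha]
    rw [smul_comm]
  · change ‖(hmem f).toLp _‖ = _
    rw [Lp.norm_toLp, hnorm f, toReal_enorm]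

/-- The Fourier-side identification of `L²(S, dμ)` with a subspace of `L²(ℝ^d)`. -/
theorem exists_extension_isometry (d : ℕ) :
    ∃ (U : Lp ℂ 2 (paraboloidMeasure d) →ₗᵢ[ℂ] Lp ℂ 2 (volume : Measure (Space d))) (b : ℝ), 0 < b ∧
      ∀ f : Lp ℂ 2 (paraboloidMeasure d), Integrable f (paraboloidMeasure d) →
        extension f =ᵐ[volume] fun z => (b : ℂ) * wave (U f) z := by
  -- `k²` is the factor by which `scaledParam` distorts the measure, so `f ↦ k⁻¹ f ∘ scaledParam` is
  -- isometric.
  set k : ℝ := Real.sqrt |((2 * Real.pi) ^ d)⁻¹| with hk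
  have hk0 : 0 < k := Real.sqrt_pos.2 (by positivity)
  have hmap : (volume : Measure (Space d)).map scaledParam =
      ENNReal.ofReal (k ^ 2) • paraboloidMeasure d := by
    rw [hk, Real.sq_sqrt (abs_nonneg _), map_scaledParam]
  obtain ⟨V, hV⟩ := exists_isometry_comp measurable_scaledParam hk0 hmap
  set a : ℝ := (2 * Real.pi) ^ (-((d : ℝ) + 1) / 2) * |(2 * Real.pi) ^ d| with ha
  refine ⟨(Lp.fourierTransformₗᵢ (Space d) ℂ).symm.toLinearIsometry.comp V, a * k, by positivity,
    fun f hf => ?_⟩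
  have hF : (𝓕 ((Lp.fourierTransformₗᵢ (Space d) ℂ).symm (V f)) :
      Lp ℂ 2 (volume : Measure (Space d))) = V f :=
    (Lp.fourierTransformₗᵢ (Space d) ℂ).apply_symm_apply _
  have hInt : Integrable (fun ξ => f (scaledParam ξ)) (volume : Measure (Space d)) := by
    have h1 : Integrable f ((volume : Measure (Space d)).map scaledParam) := by
      rw [hmap]
      exact hf.smul_measure ENNReal.ofReal_ne_top
    exact h1.comp_measurable measurable_scaledParam
  have h2 := wave_ae_eq_waveIntegral (f := (Lp.fourierTransformₗᵢ (Space d) ℂ).symm (V f))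
    (by rw [hF]; exact hV f) (hInt.const_mul _)
  filter_upwards [h2] with z hz
  rw [extension_eq_waveIntegral f hf.1 z]
  change _ = _ * wave ((Lp.fourierTransformₗᵢ (Space d) ℂ).symm (V f)) z
  rw [hz, ← ha]
  have h3 : waveIntegral (fun ξ => ((k⁻¹ : ℝ) : ℂ) * f (scaledParam ξ)) z =
      ((k⁻¹ : ℝ) : ℂ) * waveIntegral (fun ξ => f (scaledParam ξ)) z := by
    rw [waveIntegral, waveIntegral, ← integral_const_mul]
    refine integral_congr_ae (Filter.Eventually.of_forall fun ξ => ?_)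
    simp only
    ring
  rw [h3, ← mul_assoc, ← Complex.ofReal_mul, mul_assoc a, mul_inv_cancel₀ hk0.ne', mul_one]

/-- `W E_S` is `b` times the weighted evolution composed with the isometry `U`. Isometries preserve
orthonormality, so the sum bound carries over with no need for `U` to be onto. -/
theorem exists_weightedExtension {C : ℝ} (hC0 : 0 < C) (hq : 0 < q)
    (hC : ∀ W : SpaceTime d → ℂ, AEStronglyMeasurable W volume → ∀ (n : ℕ)
      (f : Fin n → Lp ℂ 2 (volume : Measure (Space d))), Orthonormal ℂ f →
      ∑ j, (∫⁻ P, ‖W P * wave (f j) P‖ₑ ^ 2) ^ q ≤ ENNReal.ofReal (C ^ q) *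
        mixedNorm (ENNReal.ofReal p) (ENNReal.ofReal q) W ^ (2 * q))
    {U : Lp ℂ 2 (paraboloidMeasure d) →ₗᵢ[ℂ] Lp ℂ 2 (volume : Measure (Space d))} {b : ℝ}
    (hb : 0 < b) (hU : ∀ f : Lp ℂ 2 (paraboloidMeasure d), Integrable f (paraboloidMeasure d) →
        extension f =ᵐ[volume] fun z => (b : ℂ) * wave (U f) z)
    {W : SpaceTime d → ℂ} (hW : MemMixedLp (ENNReal.ofReal p) (ENNReal.ofReal q) W) :
    ∃ A, IsWeightedExtension W A ∧ OrthoBound A (2 * q) ((b * (Real.sqrt C *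
      (mixedNorm (ENNReal.ofReal p) (ENNReal.ofReal q) W).toReal)) ^ (2 * q)) := by
  obtain ⟨hWm, hWfin⟩ := hW
  set M : ℝ := (mixedNorm (ENNReal.ofReal p) (ENNReal.ofReal q) W).toReal with hM
  have hM0 : 0 ≤ M := ENNReal.toReal_nonneg
  have hMof : mixedNorm (ENNReal.ofReal p) (ENNReal.ofReal q) W = ENNReal.ofReal M :=
    (ENNReal.ofReal_toReal hWfin.ne).symm
  have key : ∀ (n : ℕ) (f : Fin n → Lp ℂ 2 (volume : Measure (Space d))), Orthonormal ℂ f →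
      ∑ j, (∫⁻ P, ‖W P * wave (f j) P‖ₑ ^ 2) ^ q ≤
        ENNReal.ofReal ((Real.sqrt C * M) ^ (2 * q)) := by
    intro n f hf
    refine (hC W hWm n f hf).trans (le_of_eq ?_)
    rw [hMof, ENNReal.ofReal_rpow_of_nonneg hM0 (by positivity),
      ← ENNReal.ofReal_mul (by positivity), Real.mul_rpow (Real.sqrt_nonneg _) hM0,
      Real.rpow_mul (Real.sqrt_nonneg C) 2 q, Real.rpow_two, Real.sq_sqrt hC0.le]
  obtain ⟨A, hA⟩ := exists_weightedWave hWm (by positivity)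
    (eLpNorm_mul_wave_le hq (by positivity) (key 1))
  refine ⟨(b : ℂ) • A.comp U.toContinuousLinearMap, fun f hf => ?_, fun n g hg => ?_⟩
  · filter_upwards [hU f hf, hA (U f), Lp.coeFn_smul (b : ℂ) (A (U f))] with z h1 h2 h3
    change ((b : ℂ) • A (U f) : Lp ℂ 2 (volume : Measure (SpaceTime d))) z = _
    rw [h3, Pi.smul_apply, h2, h1, smul_eq_mul]
    ring
  · have h1 := key n (fun j => U (g j)) (hg.comp_linearIsometry U)
    have h2 : ∀ j, (∫⁻ P, ‖W P * wave (U (g j)) P‖ₑ ^ 2) ^ q =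
        ENNReal.ofReal (‖A (U (g j))‖ ^ (2 * q)) := by
      intro j
      rw [← ENNReal.ofReal_rpow_of_nonneg (norm_nonneg _) (by positivity), ofReal_norm,
        ENNReal.rpow_mul]
      congr 1
      rw [Lp.enorm_def, eLpNorm_congr_ae (hA (U (g j))),
        eLpNorm_eq_lintegral_rpow_enorm_toReal (by norm_num) (by norm_num), ← ENNReal.rpow_mul]
      norm_num
    simp_rw [h2] at h1
    rw [← ENNReal.ofReal_sum_of_nonneg fun j _ => Real.rpow_nonneg (norm_nonneg _) _,
      ENNReal.ofReal_le_ofReal_iff (by positivity)] at h1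
    rw [Real.mul_rpow hb.le (by positivity)]
    calc _ = b ^ (2 * q) * ∑ j, ‖A (U (g j))‖ ^ (2 * q) := by
          rw [Finset.mul_sum]
          refine Finset.sum_congr rfl fun j _ => ?_
          have h3 : ‖((b : ℂ) • A.comp U.toContinuousLinearMap) (g j)‖ = b * ‖A (U (g j))‖ := by
            rw [smul_apply, norm_smul, Complex.norm_real,
              Real.norm_of_nonneg hb.le]
            rfl
          rw [h3, Real.mul_rpow hb.le (norm_nonneg _)]
      _ ≤ _ := by gcongr

theorem mixedNorm_conj (p q : ℝ≥0∞) (W : SpaceTime d → ℂ) :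
    mixedNorm p q (fun z => starRingEnd ℂ (W z)) = mixedNorm p q W := by
  have : ∀ t : ℝ, eLpNorm (fun x : Space d => starRingEnd ℂ (W (t, x))) q volume =
      eLpNorm (fun x : Space d => W (t, x)) q volume := fun t =>
    eLpNorm_congr_norm_ae (Filter.Eventually.of_forall fun x => RCLike.norm_conj _)
  rw [mixedNorm, mixedNorm]
  simp_rw [this]

/-- The Schatten bound with space-time norms for the paraboloid. -/
theorem exists_schattenNorm_le (hd : 1 ≤ d) (hp : 1 ≤ p)
    (hpq : 2 / p + (d : ℝ) / q = 1) (hq : (d : ℝ) + 1 < q) :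
    ∃ C : ℝ, 0 < C ∧ ∀ W₁ W₂ : SpaceTime d → ℂ,
      MemMixedLp (ENNReal.ofReal p) (ENNReal.ofReal q) W₁ →
      MemMixedLp (ENNReal.ofReal p) (ENNReal.ofReal q) W₂ →
      ∃ B : Lp ℂ 2 (volume : Measure (SpaceTime d)) →L[ℂ] Lp ℂ 2 (volume : Measure (SpaceTime d)),
        IsSandwich W₁ W₂ B ∧ IsCompactOperator B ∧
        schattenNorm q B ≤ ENNReal.ofReal C *
          mixedNorm (ENNReal.ofReal p) (ENNReal.ofReal q) W₁ *
          mixedNorm (ENNReal.ofReal p) (ENNReal.ofReal q) W₂ := by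
  obtain ⟨C, hC0, hC⟩ := exists_weighted_mixedNorm_bound hd hp hpq hq
  obtain ⟨U, b, hb, hU⟩ := exists_extension_isometry d
  have hq1 : 1 ≤ q := by
    have : (0 : ℝ) ≤ d := Nat.cast_nonneg d
    linarith
  have hq0 : 0 < q := by linarith
  refine ⟨b ^ 2 * C, by positivity, fun W₁ W₂ h₁ h₂ => ?_⟩
  have h₂' : MemMixedLp (ENNReal.ofReal p) (ENNReal.ofReal q)
      (fun z => starRingEnd ℂ (W₂ z)) :=
    ⟨Complex.continuous_conj.comp_aestronglyMeasurable h₂.1, by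
      rw [mixedNorm_conj]
      exact h₂.2⟩
  obtain ⟨A₁, hA₁, hO₁⟩ := exists_weightedExtension hC0 hq0 hC hb hU h₁
  obtain ⟨A₂, hA₂, hO₂⟩ := exists_weightedExtension hC0 hq0 hC hb hU h₂'
  rw [mixedNorm_conj] at hO₂
  refine ⟨A₁.comp (ContinuousLinearMap.adjoint A₂), ⟨A₁, A₂, hA₁, hA₂, rfl⟩,
    (hO₁.isCompactOperator (by positivity)).comp_clm _,
    (schattenNorm_comp_adjoint_le hq1 hO₁ hO₂).trans (le_of_eq ?_)⟩
  obtain ⟨M₁, hM₁, e₁⟩ : ∃ M : ℝ, 0 ≤ M ∧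
      mixedNorm (ENNReal.ofReal p) (ENNReal.ofReal q) W₁ = ENNReal.ofReal M :=
    ⟨_, ENNReal.toReal_nonneg, (ENNReal.ofReal_toReal h₁.2.ne).symm⟩
  obtain ⟨M₂, hM₂, e₂⟩ : ∃ M : ℝ, 0 ≤ M ∧
      mixedNorm (ENNReal.ofReal p) (ENNReal.ofReal q) W₂ = ENNReal.ofReal M :=
    ⟨_, ENNReal.toReal_nonneg, (ENNReal.ofReal_toReal h₂.2.ne).symm⟩
  have hs : ∀ x : ℝ, 0 ≤ x → Real.sqrt (x ^ (2 * q)) = x ^ q := by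
    intro x hx
    rw [mul_comm, Real.rpow_mul hx, Real.rpow_two, Real.sqrt_sq (by positivity)]
  rw [e₁, e₂, ENNReal.toReal_ofReal hM₁, ENNReal.toReal_ofReal hM₂, hs _ (by positivity),
    hs _ (by positivity), ENNReal.ofReal_rpow_of_nonneg (by positivity) (by positivity),
    ← Real.mul_rpow (by positivity) (by positivity), ← Real.rpow_mul (by positivity),
    mul_one_div_cancel hq0.ne', Real.rpow_one, ← ENNReal.ofReal_mul (by positivity),
    ← ENNReal.ofReal_mul (by positivity)]
  congr 1
  calc _ = b ^ 2 * (Real.sqrt C * Real.sqrt C) * M₁ * M₂ := by ring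
    _ = _ := by rw [Real.mul_self_sqrt hC0.le]

end Paraboloid


/-! ### Duality of mixed norms -/

section Duality

variable {d : ℕ} {p q p' q' : ℝ}

/-- With `X` the integral to be bounded, the extremal multiplier `V` has pairing `X` with `σ` and
dual norm `X^{1/p'}`. Hence `X ≤ K X^{1/p'}`, and finiteness of `X` allows the division. -/
theorem lintegral_rpow_le_of_pairing_le_of_ne_top (hp : p.HolderConjugate p')
    (hq : q.HolderConjugate q') {ρ σ : SpaceTime d → ℝ≥0∞} (hσ : Measurable σ)
    (hσρ : ∀ P, σ P ≤ ρ P)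
    (hσfin : ∀ P, σ P ≠ ∞) (hr : ∀ t : ℝ, ∫⁻ x : Space d, σ (t, x) ^ q ≠ ∞)
    (hX : ∫⁻ t : ℝ, (∫⁻ x : Space d, σ (t, x) ^ q) ^ (p / q) ≠ ∞) {K : ℝ≥0∞}
    (hD : ∀ V : SpaceTime d → ℝ≥0∞, Measurable V → (∀ P, V P ≠ ∞) →
      ∫⁻ P, V P * ρ P ≤
        K * (∫⁻ t : ℝ, (∫⁻ x : Space d, V (t, x) ^ q') ^ (p' / q')) ^ (1 / p')) :
    ∫⁻ t : ℝ, (∫⁻ x : Space d, σ (t, x) ^ q) ^ (p / q) ≤ K ^ p := by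
  set r : ℝ → ℝ≥0∞ := fun t => ∫⁻ x : Space d, σ (t, x) ^ q with hrdef
  have hrm : Measurable r := Measurable.lintegral_prod_right' (f := fun P => σ P ^ q) (by fun_prop)
  -- The exponent `p/q - 1` may be negative, so times with vanishing slice are cut out to keep the
  -- multiplier finite.
  set u : ℝ → ℝ≥0∞ := {t | r t ≠ 0}.indicator fun t => r t ^ (p / q - 1) with hu
  have hum : Measurable u := Measurable.indicator (by fun_prop)
    (hrm (measurableSet_singleton 0)).compl
  have hufin : ∀ t, u t ≠ ∞ := by
    intro t
    by_cases ht : r t = 0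
    · rw [hu, Set.indicator_of_notMem (by simpa using ht)]
      exact ENNReal.zero_ne_top
    · rw [hu, Set.indicator_of_mem (by simpa using ht)]
      exact ENNReal.rpow_ne_top_of_ne_zero ht (hr t)
  have hq1 : 0 < q - 1 := hq.sub_one_pos
  have hpq : 0 < p / q := div_pos hp.pos hq.pos
  set V : SpaceTime d → ℝ≥0∞ := fun P => σ P ^ (q - 1) * u P.1 with hV
  have hVm : Measurable V := by fun_prop
  set X : ℝ≥0∞ := ∫⁻ t, r t ^ (p / q) with hXdef
  have h1 : ∫⁻ P, V P * σ P = X := by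
    rw [Measure.volume_eq_prod, lintegral_prod _ (by fun_prop)]
    refine lintegral_congr fun t => ?_
    have h2 : ∀ x : Space d, V (t, x) * σ (t, x) = u t * σ (t, x) ^ q := by
      intro x
      have h3 : σ (t, x) ^ q = σ (t, x) ^ (q - 1) * σ (t, x) := by
        conv_lhs => rw [← sub_add_cancel q 1]
        rw [ENNReal.rpow_add_of_nonneg _ _ hq1.le zero_le_one, ENNReal.rpow_one]
      rw [h3, hV]
      ring
    simp_rw [h2]
    rw [lintegral_const_mul' _ _ (hufin t)]
    change u t * r t = _
    by_cases ht : r t = 0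
    · rw [ht, mul_zero, ENNReal.zero_rpow_of_pos hpq]
    · rw [hu, Set.indicator_of_mem (by simpa using ht)]
      nth_rewrite 2 [← ENNReal.rpow_one (r t)]
      rw [← ENNReal.rpow_add _ _ ht (hr t), sub_add_cancel]
  have h2 : ∫⁻ t : ℝ, (∫⁻ x : Space d, V (t, x) ^ q') ^ (p' / q') = X := by
    refine lintegral_congr fun t => ?_
    have h3 : ∀ x : Space d, V (t, x) ^ q' = u t ^ q' * σ (t, x) ^ q := by
      intro x
      rw [hV, ENNReal.mul_rpow_of_nonneg _ _ hq.symm.nonneg, ← ENNReal.rpow_mul,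
        hq.sub_one_mul_conj, mul_comm]
    simp_rw [h3]
    rw [lintegral_const_mul' _ _ (ENNReal.rpow_ne_top_of_nonneg hq.symm.nonneg (hufin t))]
    change (u t ^ q' * r t) ^ (p' / q') = _
    by_cases ht : r t = 0
    · rw [ht, mul_zero, ENNReal.zero_rpow_of_pos hpq,
        ENNReal.zero_rpow_of_pos (div_pos hp.symm.pos hq.symm.pos)]
    · rw [hu, Set.indicator_of_mem (by simpa using ht), ← ENNReal.rpow_mul]
      nth_rewrite 2 [← ENNReal.rpow_one (r t)]
      rw [← ENNReal.rpow_add _ _ ht (hr t), ← ENNReal.rpow_mul]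
      congr 1
      have e1 := hp.mul_eq_add
      have e2 := hq.mul_eq_add
      have n1 := hq.ne_zero
      have n2 := hq.symm.ne_zero
      field_simp
      linear_combination (q' * e1 - p' * e2)
  have h3 := (lintegral_mono fun P => mul_le_mul' (le_refl (V P)) (hσρ P)).trans
    (hD V hVm fun P => ENNReal.mul_ne_top
      (ENNReal.rpow_ne_top_of_nonneg hq1.le (hσfin P)) (hufin P.1))
  rw [h1, h2] at h3
  rcases eq_or_ne X 0 with h0 | h0
  · rw [h0]
    exact zero_le
  · have h4 : X = X ^ (1 / p) * X ^ (1 / p') := by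
      rw [← ENNReal.rpow_add _ _ h0 hX, one_div, one_div, hp.inv_add_inv_eq_one, ENNReal.rpow_one]
    have h5 : X ^ (1 / p) ≤ K := by
      rw [h4] at h3
      have n0 : X ^ (1 / p') ≠ 0 := by
        simp [ENNReal.rpow_eq_zero_iff, h0, hX]
      refine (ENNReal.mul_le_mul_iff_left n0
        (ENNReal.rpow_ne_top_of_nonneg (by have := hp.symm.pos; positivity) hX)).1 ?_
      rwa [← h4] at h3 ⊢
    have h6 := ENNReal.rpow_le_rpow h5 hp.nonneg
    rwa [← ENNReal.rpow_mul, one_div_mul_cancel hp.ne_zero, ENNReal.rpow_one] at h6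

/-- The set of points with bounded coordinates. -/
def box (d n : ℕ) : Set (SpaceTime d) := {P | |P.1| ≤ n ∧ ‖P.2‖ ≤ n}

theorem measurableSet_box (n : ℕ) : MeasurableSet (box d n) := by
  have h1 : MeasurableSet {P : SpaceTime d | |P.1| ≤ n} :=
    measurableSet_le measurable_fst.norm measurable_const
  have h2 : MeasurableSet {P : SpaceTime d | ‖P.2‖ ≤ n} :=
    measurableSet_le measurable_snd.norm measurable_const
  exact h1.inter h2

/-- The truncation of a density in value and in space-time. -/
noncomputable def truncate (ρ : SpaceTime d → ℝ≥0∞) (n : ℕ) : SpaceTime d → ℝ≥0∞ :=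
  (box d n).indicator fun P => min (ρ P) n

theorem measurable_truncate {ρ : SpaceTime d → ℝ≥0∞} (hρ : Measurable ρ) (n : ℕ) :
    Measurable (truncate ρ n) :=
  Measurable.indicator (by fun_prop) (measurableSet_box n)

theorem truncate_le (ρ : SpaceTime d → ℝ≥0∞) (n : ℕ) (P : SpaceTime d) :
    truncate ρ n P ≤ ρ P :=
  (Set.indicator_le_self _ _ _).trans (min_le_left _ _)

theorem truncate_le_nat (ρ : SpaceTime d → ℝ≥0∞) (n : ℕ) (P : SpaceTime d) :
    truncate ρ n P ≤ n :=
  (Set.indicator_le_self _ _ _).trans (min_le_right _ _)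

theorem truncate_mono (ρ : SpaceTime d → ℝ≥0∞) (P : SpaceTime d) :
    Monotone fun n => truncate ρ n P := by
  intro m n hmn
  have hmn' : (m : ℝ) ≤ n := by exact_mod_cast hmn
  have hsub : box d m ⊆ box d n := fun P hP => ⟨hP.1.trans hmn', hP.2.trans hmn'⟩
  refine (Set.indicator_le_indicator_of_subset hsub (fun _ => zero_le) P).trans ?_
  refine Set.indicator_le_indicator (min_le_min le_rfl ?_)
  exact_mod_cast hmn

theorem tendsto_truncate (ρ : SpaceTime d → ℝ≥0∞) (P : SpaceTime d) :
    Filter.Tendsto (fun n => truncate ρ n P) Filter.atTop (nhds (ρ P)) := by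
  have h1 : Filter.Tendsto (fun n : ℕ => min (ρ P) (n : ℝ≥0∞)) Filter.atTop (nhds (ρ P)) := by
    have := (tendsto_const_nhds (x := ρ P)).min ENNReal.tendsto_nat_nhds_top
    rwa [min_eq_left le_top] at this
  refine h1.congr' ?_
  obtain ⟨n, hn⟩ := exists_nat_ge (max |P.1| ‖P.2‖)
  filter_upwards [Filter.eventually_ge_atTop n] with m hm
  have hm' : (n : ℝ) ≤ m := by exact_mod_cast hm
  rw [truncate, Set.indicator_of_mem]
  exact ⟨((le_max_left _ _).trans hn).trans hm', ((le_max_right _ _).trans hn).trans hm'⟩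

theorem lintegral_truncate_rpow_le (hq : 0 < q) (ρ : SpaceTime d → ℝ≥0∞) (n : ℕ) (t : ℝ) :
    ∫⁻ x : Space d, truncate ρ n (t, x) ^ q ≤ (Set.Icc (-(n : ℝ)) n).indicator
      (fun _ => (n : ℝ≥0∞) ^ q * volume (Metric.closedBall (0 : Space d) n)) t := by
  by_cases ht : t ∈ Set.Icc (-(n : ℝ)) n
  · rw [Set.indicator_of_mem ht,
      ← lintegral_indicator_const Metric.isClosed_closedBall.measurableSet]
    refine lintegral_mono fun x => ?_
    simp only
    by_cases hx : x ∈ Metric.closedBall (0 : Space d) n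
    · rw [Set.indicator_of_mem hx]
      exact ENNReal.rpow_le_rpow (truncate_le_nat ρ n _) hq.le
    · rw [truncate, Set.indicator_of_notMem, ENNReal.zero_rpow_of_pos hq]
      · exact zero_le
      · exact fun h => hx (by simpa using h.2)
  · refine le_of_eq_of_le ?_ zero_le
    have : (fun x : Space d => truncate ρ n (t, x) ^ q) = fun _ => 0 := by
      funext x
      rw [truncate, Set.indicator_of_notMem, ENNReal.zero_rpow_of_pos hq]
      exact fun h => ht (abs_le.1 h.1)
    rw [this, lintegral_zero]

/-- The converse of Hölder's inequality for mixed norms. -/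
theorem lintegral_rpow_le_of_pairing_le (hp : p.HolderConjugate p')
    (hq : q.HolderConjugate q') {ρ : SpaceTime d → ℝ≥0∞} (hρ : Measurable ρ) {K : ℝ≥0∞}
    (hD : ∀ V : SpaceTime d → ℝ≥0∞, Measurable V → (∀ P, V P ≠ ∞) →
      ∫⁻ P, V P * ρ P ≤
        K * (∫⁻ t : ℝ, (∫⁻ x : Space d, V (t, x) ^ q') ^ (p' / q')) ^ (1 / p')) :
    ∫⁻ t : ℝ, (∫⁻ x : Space d, ρ (t, x) ^ q) ^ (p / q) ≤ K ^ p := by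
  have hpq : 0 < p / q := div_pos hp.pos hq.pos
  have hB : ∀ n : ℕ, (n : ℝ≥0∞) ^ q * volume (Metric.closedBall (0 : Space d) n) ≠ ∞ := fun n =>
    ENNReal.mul_ne_top (ENNReal.rpow_ne_top_of_nonneg hq.nonneg (ENNReal.natCast_ne_top n))
      (isCompact_closedBall _ _).measure_lt_top.ne
  -- The truncations have finite norms and the same constant `K`, since the pairing hypothesis is
  -- kept for the untruncated `ρ`.
  have hbound : ∀ n, ∫⁻ t : ℝ, (∫⁻ x : Space d, truncate ρ n (t, x) ^ q) ^ (p / q) ≤ K ^ p := by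
    intro n
    refine lintegral_rpow_le_of_pairing_le_of_ne_top hp hq (measurable_truncate hρ n)
      (truncate_le ρ n)
      (fun P => ne_top_of_le_ne_top (ENNReal.natCast_ne_top n) (truncate_le_nat ρ n P))
      (fun t => ?_) ?_ hD
    · refine ne_top_of_le_ne_top (hB n) ((lintegral_truncate_rpow_le hq.pos ρ n t).trans ?_)
      exact Set.indicator_le_self _ _ _
    · have h1 : ∀ t : ℝ, (∫⁻ x : Space d, truncate ρ n (t, x) ^ q) ^ (p / q) ≤
          (Set.Icc (-(n : ℝ)) n).indicator (fun _ =>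
            ((n : ℝ≥0∞) ^ q * volume (Metric.closedBall (0 : Space d) n)) ^ (p / q)) t := by
        intro t
        refine (ENNReal.rpow_le_rpow (lintegral_truncate_rpow_le hq.pos ρ n t) hpq.le).trans
          (le_of_eq ?_)
        by_cases ht : t ∈ Set.Icc (-(n : ℝ)) n
        · rw [Set.indicator_of_mem ht, Set.indicator_of_mem ht]
        · rw [Set.indicator_of_notMem ht, Set.indicator_of_notMem ht, ENNReal.zero_rpow_of_pos hpq]
      refine ne_top_of_le_ne_top ?_ (lintegral_mono h1)
      rw [lintegral_indicator_const measurableSet_Icc, Real.volume_Icc]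
      exact ENNReal.mul_ne_top (ENNReal.rpow_ne_top_of_nonneg hpq.le (hB n)) ENNReal.ofReal_ne_top
  have hm : ∀ n, Measurable fun t : ℝ => ∫⁻ x : Space d, truncate ρ n (t, x) ^ q := fun n =>
    Measurable.lintegral_prod_right' (f := fun P => truncate ρ n P ^ q)
      ((measurable_truncate hρ n).pow_const q)
  refine le_of_tendsto' (lintegral_tendsto_of_tendsto_of_monotone
    (fun n => ((hm n).pow_const (p / q)).aemeasurable)
    (Filter.Eventually.of_forall fun t m n hmn => ?_)
    (Filter.Eventually.of_forall fun t => ?_)) hbound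
  · refine ENNReal.rpow_le_rpow (lintegral_mono fun x => ?_) hpq.le
    exact ENNReal.rpow_le_rpow (truncate_mono ρ _ hmn) hq.nonneg
  · refine (ENNReal.continuous_rpow_const.tendsto _).comp
      (lintegral_tendsto_of_tendsto_of_monotone (fun n => ?_)
        (Filter.Eventually.of_forall fun x m n hmn => ?_)
        (Filter.Eventually.of_forall fun x => ?_))
    · exact (((measurable_truncate hρ n).comp measurable_prodMk_left).pow_const q).aemeasurable
    · exact ENNReal.rpow_le_rpow (truncate_mono ρ _ hmn) hq.nonneg
    · exact (ENNReal.continuous_rpow_const.tendsto _).comp (tendsto_truncate ρ (t, x))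

end Duality


/-! ### Densities of orthonormal systems -/

section Density

universe u

variable {d : ℕ} {p q p' q' : ℝ} {ι : Type u}

/-- The density `∑ⱼ aⱼ |e^{itΔ} fⱼ|²` with values in `[0, ∞]`. -/
noncomputable def density (a : ι → ℝ≥0∞) (f : ι → Lp ℂ 2 (volume : Measure (Space d)))
    (P : SpaceTime d) : ℝ≥0∞ :=
  ∑' j, a j * ‖wave (f j) P‖ₑ ^ 2

theorem measurable_density [Countable ι] (a : ι → ℝ≥0∞)
    (f : ι → Lp ℂ 2 (volume : Measure (Space d))) : Measurable (density a f) := by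
  refine Measurable.tsum fun j => ?_
  have := measurable_wave (f j)
  fun_prop

theorem sum_lintegral_rpow_le_of_finset {F : SpaceTime d → ℝ≥0∞} {B : ℝ≥0∞} {s : ℝ}
    (h : ∀ (n : ℕ) (f : Fin n → Lp ℂ 2 (volume : Measure (Space d))), Orthonormal ℂ f →
      ∑ j, (∫⁻ P, F P * ‖wave (f j) P‖ₑ ^ 2) ^ s ≤ B)
    {f : ι → Lp ℂ 2 (volume : Measure (Space d))} (hf : Orthonormal ℂ f) (J : Finset ι) :
    ∑ j ∈ J, (∫⁻ P, F P * ‖wave (f j) P‖ₑ ^ 2) ^ s ≤ B := by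
  rw [← Finset.sum_coe_sort, ← J.equivFin.symm.sum_comp]
  exact h _ (fun i => f (J.equivFin.symm i))
    (hf.comp _ (Subtype.val_injective.comp J.equivFin.symm.injective))

/-- Pairing with the density gives `∑ a_j ∫ V |e^{itΔ} f_j|²`. The weight `√V`, with doubled
exponents `2p'` and `2q'`, bounds the integrals in `ℓ^{2q'}`, and Hölder's inequality in `j` does
the rest. -/
theorem lintegral_mul_density_le [Countable ι] (hp : p.HolderConjugate p')
    (hq : q.HolderConjugate q') {s : ℝ} (hs : s.HolderConjugate (2 * q')) {C : ℝ} (hC0 : 0 < C)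
    (hC : ∀ v : SpaceTime d → ℝ, Measurable v → (∀ P, 0 ≤ v P) → ∀ (n : ℕ)
      (f : Fin n → Lp ℂ 2 (volume : Measure (Space d))), Orthonormal ℂ f →
      ∑ j, (∫⁻ P, ENNReal.ofReal (v P) ^ 2 * ‖wave (f j) P‖ₑ ^ 2) ^ (2 * q') ≤
        ENNReal.ofReal (C ^ (2 * q')) *
          (∫⁻ t : ℝ, (∫⁻ x : Space d, ENNReal.ofReal (v (t, x)) ^ (2 * q')) ^
            (2 * p' / (2 * q'))) ^ (2 * (2 * q') / (2 * p')))
    (a : ι → ℝ≥0∞) {f : ι → Lp ℂ 2 (volume : Measure (Space d))} (hf : Orthonormal ℂ f)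
    {V : SpaceTime d → ℝ≥0∞} (hV : Measurable V) (hVfin : ∀ P, V P ≠ ∞) :
    ∫⁻ P, V P * density a f P ≤ (ENNReal.ofReal C * (∑' j, a j ^ s) ^ (1 / s)) *
      (∫⁻ t : ℝ, (∫⁻ x : Space d, V (t, x) ^ q') ^ (p' / q')) ^ (1 / p') := by
  have hp'0 := hp.symm.pos
  have hq'0 := hq.symm.pos
  set I : ℝ≥0∞ := ∫⁻ t : ℝ, (∫⁻ x : Space d, V (t, x) ^ q') ^ (p' / q') with hI
  have hsq : ∀ P, ENNReal.ofReal (Real.sqrt (V P).toReal) ^ 2 = V P := by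
    intro P
    rw [← ENNReal.ofReal_pow (Real.sqrt_nonneg _), Real.sq_sqrt ENNReal.toReal_nonneg,
      ENNReal.ofReal_toReal (hVfin P)]
  have hsq' : ∀ P, ENNReal.ofReal (Real.sqrt (V P).toReal) ^ (2 * q') = V P ^ q' := by
    intro P
    rw [ENNReal.rpow_mul, ENNReal.rpow_two, hsq]
  have key : ∀ (n : ℕ) (f : Fin n → Lp ℂ 2 (volume : Measure (Space d))), Orthonormal ℂ f →
      ∑ j, (∫⁻ P, V P * ‖wave (f j) P‖ₑ ^ 2) ^ (2 * q') ≤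
        ENNReal.ofReal (C ^ (2 * q')) * I ^ (2 * q' / p') := by
    intro n f hf
    have h1 := hC (fun P => Real.sqrt (V P).toReal) hV.ennreal_toReal.sqrt
      (fun P => Real.sqrt_nonneg _) n f hf
    simp only [hsq, hsq'] at h1
    rwa [mul_div_mul_left _ _ two_ne_zero, mul_div_mul_left _ _ two_ne_zero] at h1
  have hsum : ∫⁻ P, V P * density a f P = ∑' j, a j * ∫⁻ P, V P * ‖wave (f j) P‖ₑ ^ 2 := by
    simp_rw [density, ← ENNReal.tsum_mul_left]
    rw [lintegral_tsum fun j => by have := measurable_wave (f j); fun_prop]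
    refine tsum_congr fun j => ?_
    have := measurable_wave (f j)
    rw [← lintegral_const_mul _ (by fun_prop)]
    refine lintegral_congr fun P => ?_
    ring
  rw [hsum, ENNReal.tsum_eq_iSup_sum]
  refine iSup_le fun J => (ENNReal.inner_le_Lp_mul_Lq J _ _ hs).trans ?_
  rw [mul_comm (ENNReal.ofReal C), mul_assoc]
  refine mul_le_mul' (ENNReal.rpow_le_rpow (ENNReal.sum_le_tsum J)
    (by have := hs.pos; positivity)) ?_
  refine (ENNReal.rpow_le_rpow (sum_lintegral_rpow_le_of_finset key hf J) (by positivity)).trans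
    (le_of_eq ?_)
  rw [ENNReal.mul_rpow_of_nonneg _ _ (by positivity),
    ENNReal.ofReal_rpow_of_nonneg (by positivity) (by positivity), ← Real.rpow_mul hC0.le,
    mul_one_div_cancel (by positivity), Real.rpow_one, ← ENNReal.rpow_mul]
  congr 2
  field_simp

/-- The Strichartz estimate for orthonormal functions, for densities with values in `[0, ∞]`. -/
theorem exists_density_bound (hd : 1 ≤ d) (hp : p.HolderConjugate p')
    (hq : q.HolderConjugate q') (hpq : 1 / p' + (d : ℝ) / (2 * q') = 1)
    (hqd : (d : ℝ) + 1 < 2 * q') :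
    ∃ C : ℝ, 0 < C ∧ ∀ (ι : Type u) [Countable ι] (a : ι → ℝ≥0∞)
      (f : ι → Lp ℂ 2 (volume : Measure (Space d))), Orthonormal ℂ f →
      (∫⁻ t : ℝ, (∫⁻ x : Space d, density a f (t, x) ^ q) ^ (p / q)) ^ (1 / p) ≤
        ENNReal.ofReal C *
          (∑' j, a j ^ (2 * q / (q + 1))) ^ ((q + 1) / (2 * q)) := by
  have hq0 := hq.pos
  have hq'1 := hq.symm.lt
  obtain ⟨C, hC0, hC⟩ := exists_weighted_bound (p := 2 * p') (q := 2 * q') hd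
    (by have := hp.symm.lt; linarith) (by rw [← hpq]; congr 1; field_simp) hqd
  -- This is where the exponent `2q/(q+1)` of the theorem arises: it is the conjugate of `2q'`.
  have hs : (2 * q / (q + 1)).HolderConjugate (2 * q') := by
    refine Real.HolderConjugate.symm (Real.holderConjugate_iff.2 ⟨by linarith, ?_⟩)
    rw [hq.symm.conjugate_eq]
    have : q' - 1 ≠ 0 := by linarith
    have : q' / (q' - 1) + 1 ≠ 0 := by
      have h1 : 0 < q' / (q' - 1) := div_pos (by linarith) (by linarith)
      positivity
    have : q' + (q' - 1) ≠ 0 := by linarith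
    field_simp
    ring
  refine ⟨C, hC0, fun ι _ a f hf => ?_⟩
  have h1 := lintegral_rpow_le_of_pairing_le hp hq (measurable_density a f) fun V hV hVfin =>
    lintegral_mul_density_le hp hq hs hC0 hC a hf hV hVfin
  have h2 := ENNReal.rpow_le_rpow h1 (z := 1 / p) (by have := hp.pos; positivity)
  rw [← ENNReal.rpow_mul, mul_one_div_cancel hp.ne_zero, ENNReal.rpow_one, one_div_div] at h2
  exact h2

/-- Absolute convergence of the density, given that its majorant is finite almost everywhere. -/
theorem exists_hasSum_density [Countable ι] (ν : ι → ℂ)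
    (f : ι → Lp ℂ 2 (volume : Measure (Space d)))
    (hfin : ∀ᵐ t : ℝ, ∀ᵐ x : Space d, density (fun j => ‖ν j‖ₑ) f (t, x) < ∞) :
    ∃ ρ : SpaceTime d → ℂ, AEStronglyMeasurable ρ volume ∧
      (∀ᵐ t : ℝ, ∀ᵐ x : Space d,
        HasSum (fun j => ν j * ((‖schrodinger t (f j) x‖ ^ 2 : ℝ) : ℂ)) (ρ (t, x))) ∧
      ∀ P, ‖ρ P‖ₑ ≤ density (fun j => ‖ν j‖ₑ) f P := by
  have henorm : ∀ j P, ‖ν j * ((‖wave (f j) P‖ ^ 2 : ℝ) : ℂ)‖ₑ = ‖ν j‖ₑ * ‖wave (f j) P‖ₑ ^ 2 := by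
    intro j P
    rw [enorm_mul, ← ofReal_norm (Complex.ofReal _), Complex.norm_real,
      Real.norm_of_nonneg (by positivity), ENNReal.ofReal_pow (norm_nonneg _), ofReal_norm]
  have hsummable : ∀ P, density (fun j => ‖ν j‖ₑ) f P < ∞ →
      HasSum (fun j => ν j * ((‖wave (f j) P‖ ^ 2 : ℝ) : ℂ))
        (∑' j, ν j * ((‖wave (f j) P‖ ^ 2 : ℝ) : ℂ)) := by
    intro P hP
    refine Summable.hasSum (Summable.of_norm ?_)
    have h1 := ENNReal.summable_toReal hP.ne
    refine h1.congr fun j => ?_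
    rw [← henorm, toReal_enorm]
  refine ⟨fun P => ∑' j, ν j * ((‖wave (f j) P‖ ^ 2 : ℝ) : ℂ), ?_, ?_, fun P => ?_⟩
  · have hae : ∀ᵐ P : SpaceTime d, density (fun j => ‖ν j‖ₑ) f P < ∞ :=
      (Measure.ae_prod_mem_iff_ae_ae_mem (μ := (volume : Measure ℝ))
        (ν := (volume : Measure (Space d)))
        (measurableSet_lt (measurable_density _ f) measurable_const)).2 hfin
    refine aestronglyMeasurable_of_tendsto_ae Filter.atTop
      (f := fun (J : Finset ι) P => ∑ j ∈ J, ν j * ((‖wave (f j) P‖ ^ 2 : ℝ) : ℂ))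
      (fun J => Measurable.aestronglyMeasurable ?_) (hae.mono fun P hP => hsummable P hP)
    refine Finset.measurable_fun_sum J fun j _ => ?_
    have := measurable_wave (f j)
    fun_prop
  · filter_upwards [hfin] with t ht
    filter_upwards [ht, ae_all_iff.2 fun j => wave_ae_eq (f j) t] with x hx hw
    simp_rw [← hw]
    exact hsummable (t, x) hx
  · refine enorm_tsum_le_tsum_enorm.trans (le_of_eq ?_)
    exact tsum_congr fun j => henorm j P

theorem tsum_enorm_rpow_eq (ν : ι → ℂ) {s : ℝ} (hs : 0 < s)
    (h : Summable fun j => ‖ν j‖ ^ s) :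
    ∑' j, ‖ν j‖ₑ ^ s = ENNReal.ofReal (∑' j, ‖ν j‖ ^ s) := by
  rw [ENNReal.ofReal_tsum_of_nonneg (fun j => by positivity) h]
  refine tsum_congr fun j => ?_
  rw [← ENNReal.ofReal_rpow_of_nonneg (norm_nonneg _) hs.le, ofReal_norm]

theorem lintegral_density_slice [Countable ι] (a : ι → ℝ≥0∞)
    {f : ι → Lp ℂ 2 (volume : Measure (Space d))} (hf : Orthonormal ℂ f) (t : ℝ) :
    ∫⁻ x : Space d, density a f (t, x) = ∑' j, a j := by
  have hm : ∀ j, Measurable fun x : Space d => ‖wave (f j) (t, x)‖ₑ ^ 2 := fun j => by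
    have := measurable_wave (f j)
    fun_prop
  simp_rw [density]
  rw [lintegral_tsum fun j => ((hm j).const_mul _).aemeasurable]
  refine tsum_congr fun j => ?_
  rw [lintegral_const_mul _ (hm j), lintegral_wave_slice_sq, ← ofReal_norm, hf.1 j,
    ENNReal.ofReal_one, one_pow, mul_one]

/-- The conclusion of the Strichartz estimate for the system `(fⱼ)` with coefficients `(νⱼ)`. -/
def HasDensityBound (p q : ℝ≥0∞) (B : ℝ≥0∞) (ν : ι → ℂ)
    (f : ι → Lp ℂ 2 (volume : Measure (Space d))) : Prop :=
  ∃ ρ : SpaceTime d → ℂ, AEStronglyMeasurable ρ volume ∧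
    (∀ᵐ t : ℝ, ∀ᵐ x : Space d,
      HasSum (fun j => ν j * ((‖schrodinger t (f j) x‖ ^ 2 : ℝ) : ℂ)) (ρ (t, x))) ∧
    mixedNorm p q ρ ≤ B

theorem HasDensityBound.of_support {p q B : ℝ≥0∞} {ν : ι → ℂ}
    {f : ι → Lp ℂ 2 (volume : Measure (Space d))}
    (h : HasDensityBound p q B (fun j : Function.support ν => ν j) fun j => f j) :
    HasDensityBound p q B ν f := by
  obtain ⟨ρ, h1, h2, h3⟩ := h
  refine ⟨ρ, h1, ?_, h3⟩
  filter_upwards [h2] with t ht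
  filter_upwards [ht] with x hx
  refine (hasSum_subtype_iff_of_support_subset (s := Function.support ν) ?_).1 hx
  exact Function.support_mul_subset_left _ _

/-- Conservation of the `L²` norm at each time: the density `∑ |ν_j| |e^{itΔ} f_j|²` has spatial
integral `∑ |ν_j|`. -/
theorem hasDensityBound_one [Countable ι] {ν : ι → ℂ}
    {f : ι → Lp ℂ 2 (volume : Measure (Space d))} (hf : Orthonormal ℂ f)
    (hν : Summable fun j => ‖ν j‖ ^ (1 : ℝ)) :
    HasDensityBound ∞ 1 (ENNReal.ofReal (∑' j, ‖ν j‖ ^ (1 : ℝ))) ν f := by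
  have hsl := lintegral_density_slice (fun j => ‖ν j‖ₑ) hf
  have htot := tsum_enorm_rpow_eq ν one_pos hν
  simp only [ENNReal.rpow_one] at htot
  rw [htot] at hsl
  obtain ⟨ρ, h1, h2, h3⟩ := exists_hasSum_density ν f <| Filter.Eventually.of_forall fun t =>
    ae_lt_top ((measurable_density _ f).comp measurable_prodMk_left) (by
      rw [hsl t]
      exact ENNReal.ofReal_ne_top)
  refine ⟨ρ, h1, h2, ?_⟩
  rw [mixedNorm, eLpNorm_exponent_top]
  refine essSup_le_of_ae_le _ (Filter.Eventually.of_forall fun t => ?_)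
  simp only
  rw [enorm_eq_self, eLpNorm_one_eq_lintegral_enorm, ← hsl t]
  exact lintegral_mono fun x => h3 (t, x)

theorem hasDensityBound_of_lintegral_le [Countable ι] (hp : 0 < p) (hq : 0 < q) {ν : ι → ℂ}
    {f : ι → Lp ℂ 2 (volume : Measure (Space d))} {B : ℝ}
    (h : (∫⁻ t : ℝ, (∫⁻ x : Space d, density (fun j => ‖ν j‖ₑ) f (t, x) ^ q) ^ (p / q)) ^ (1 / p) ≤
      ENNReal.ofReal B) :
    HasDensityBound (ENNReal.ofReal p) (ENNReal.ofReal q) (ENNReal.ofReal B) ν f := by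
  have hm := measurable_density (fun j => ‖ν j‖ₑ) f
  have hfin : ∫⁻ t : ℝ, (∫⁻ x : Space d, density (fun j => ‖ν j‖ₑ) f (t, x) ^ q) ^ (p / q) ≠ ∞ := by
    intro htop
    rw [htop, ENNReal.top_rpow_of_pos (by positivity)] at h
    exact absurd h (by simp)
  have hm' : Measurable fun t : ℝ => ∫⁻ x : Space d, density (fun j => ‖ν j‖ₑ) f (t, x) ^ q :=
    Measurable.lintegral_prod_right' (f := fun P => density (fun j => ‖ν j‖ₑ) f P ^ q)
      (hm.pow_const q)
  have hae : ∀ᵐ t : ℝ, ∀ᵐ x : Space d, density (fun j => ‖ν j‖ₑ) f (t, x) < ∞ := by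
    filter_upwards [ae_lt_top (hm'.pow_const (p / q)) hfin] with t ht
    have h1 : ∫⁻ x : Space d, density (fun j => ‖ν j‖ₑ) f (t, x) ^ q ≠ ∞ := by
      intro htop
      rw [htop, ENNReal.top_rpow_of_pos (by positivity)] at ht
      exact lt_irrefl _ ht
    filter_upwards [ae_lt_top ((hm.comp measurable_prodMk_left).pow_const q) h1] with x hx
    by_contra hcon
    rw [not_lt, top_le_iff] at hcon
    simp only [Function.comp_def, hcon, ENNReal.top_rpow_of_pos hq] at hx
    exact lt_irrefl _ hx
  obtain ⟨ρ, h1, h2, h3⟩ := exists_hasSum_density ν f hae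
  refine ⟨ρ, h1, h2, le_trans ?_ h⟩
  rw [mixedNorm_ofReal hp hq]
  gcongr with t x
  exact h3 _

/-- Written as a product, the restriction on `q` covers `d = 1`, where it is void, together with all
other dimensions. -/
theorem sub_one_mul_lt_two (hd : 1 ≤ d)
    (h : ENNReal.ofReal q < 1 + 2 / ((d : ℝ≥0∞) - 1)) : ((d : ℝ) - 1) * (q - 1) < 2 := by
  rcases hd.eq_or_lt with rfl | hd
  · norm_num
  · have hd' : (0 : ℝ) < (d : ℝ) - 1 := by
      have : (1 : ℝ) < d := by exact_mod_cast hd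
      linarith
    have h1 : 1 + 2 / ((d : ℝ≥0∞) - 1) = ENNReal.ofReal (1 + 2 / ((d : ℝ) - 1)) := by
      rw [ENNReal.ofReal_add zero_le_one (by positivity), ENNReal.ofReal_div_of_pos hd',
        ENNReal.ofReal_sub _ zero_le_one, ENNReal.ofReal_one, ENNReal.ofReal_natCast,
        ENNReal.ofReal_ofNat]
    rw [h1, ENNReal.ofReal_lt_ofReal_iff (by positivity), ← sub_lt_iff_lt_add',
      lt_div_iff₀ hd'] at h
    linarith

/-- Translation of exponents: the relation for `(p, q)` becomes `2/(2p') + d/(2q') = 1`, and `(d -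
1)(q - 1) < 2` is equivalent to `2q' > d + 1`. -/
theorem exists_density_bound_of_scaling (hd : 1 ≤ d) (hp : 0 < p) (hq : 1 < q)
    (hpq : 2 / p + (d : ℝ) / q = d) (hqd : ((d : ℝ) - 1) * (q - 1) < 2) :
    ∃ C : ℝ, 0 < C ∧ ∀ (ι : Type u) [Countable ι] (a : ι → ℝ≥0∞)
      (f : ι → Lp ℂ 2 (volume : Measure (Space d))), Orthonormal ℂ f →
      (∫⁻ t : ℝ, (∫⁻ x : Space d, density a f (t, x) ^ q) ^ (p / q)) ^ (1 / p) ≤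
        ENNReal.ofReal C *
          (∑' j, a j ^ (2 * q / (q + 1))) ^ ((q + 1) / (2 * q)) := by
  have hq0 : 0 < q := by linarith
  have hpq' : 2 * q = p * (d * (q - 1)) := by
    field_simp at hpq
    linarith
  -- If `p ≤ 1`, scaling would give `2q ≤ d(q - 1) < q + 1`, contrary to `q > 1`.
  have hp1 : 1 < p := by
    by_contra! hcon
    have hd' : (1 : ℝ) ≤ d := by exact_mod_cast hd
    have h1 : 0 ≤ (d : ℝ) * (q - 1) := mul_nonneg (by linarith) (by linarith)
    nlinarith
  have hP := Real.HolderConjugate.conjExponent hp1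
  have hQ := Real.HolderConjugate.conjExponent hq
  refine exists_density_bound hd hP hQ ?_ ?_
  · rw [Real.conjExponent, Real.conjExponent]
    have n1 : p - 1 ≠ 0 := by linarith
    have n2 : q - 1 ≠ 0 := by linarith
    field_simp
    linarith
  · rw [Real.conjExponent, ← mul_div_assoc, lt_div_iff₀ (by linarith)]
    linarith

/-- The Strichartz estimate for orthonormal functions. -/
theorem exists_hasDensityBound (hd : 1 ≤ d) {p q : ℝ≥0∞} (hp : 1 ≤ p) (hq : 1 ≤ q)
    (hpq : 2 / p + (d : ℝ≥0∞) / q = (d : ℝ≥0∞)) (hqd : q < 1 + 2 / ((d : ℝ≥0∞) - 1)) :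
    ∃ C : ℝ, 0 < C ∧ ∀ (ι : Type u) (f : ι → Lp ℂ 2 (volume : Measure (Space d))) (ν : ι → ℂ),
      Orthonormal ℂ f → Summable (fun j => ‖ν j‖ ^ (2 * q.toReal / (q.toReal + 1))) →
      HasDensityBound p q (ENNReal.ofReal (C *
        (∑' j, ‖ν j‖ ^ (2 * q.toReal / (q.toReal + 1))) ^
          ((q.toReal + 1) / (2 * q.toReal)))) ν f := by
  have hqtop : q ≠ ∞ := ne_top_of_lt hqd
  have hq1 : 1 ≤ q.toReal := by
    rw [← ENNReal.toReal_one]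
    exact ENNReal.toReal_mono hqtop hq
  set s : ℝ := 2 * q.toReal / (q.toReal + 1) with hs
  have hs0 : 0 < s := by positivity
  -- Summability makes the support of `ν` countable, and indices outside it affect neither side;
  -- countability is needed for measurability of the density.
  suffices hcount : ∃ C : ℝ, 0 < C ∧ ∀ (ι : Type u) [Countable ι]
      (f : ι → Lp ℂ 2 (volume : Measure (Space d))) (ν : ι → ℂ),
      Orthonormal ℂ f → Summable (fun j => ‖ν j‖ ^ s) →
      HasDensityBound p q (ENNReal.ofReal (C * (∑' j, ‖ν j‖ ^ s) ^
        ((q.toReal + 1) / (2 * q.toReal)))) ν f by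
    obtain ⟨C, hC0, hC⟩ := hcount
    refine ⟨C, hC0, fun ι f ν hf hν => HasDensityBound.of_support ?_⟩
    have hsupp : Function.support (fun j => ‖ν j‖ ^ s) = Function.support ν := by
      ext j
      simp [Real.rpow_eq_zero (norm_nonneg _) hs0.ne']
    have : Countable (Function.support ν) := by
      rw [← hsupp]
      exact hν.countable_support.to_subtype
    have h1 := hC (Function.support ν) (fun j => f j) (fun j => ν j)
      (hf.comp _ Subtype.val_injective) (hν.subtype _)
    rwa [tsum_subtype_eq_of_support_subset (f := fun j => ‖ν j‖ ^ s) hsupp.le] at h1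
  rcases hq1.eq_or_lt with hq1 | hq1
  · have hqone : q = 1 := by
      rw [← ENNReal.ofReal_toReal hqtop, ← hq1, ENNReal.ofReal_one]
    subst hqone
    -- For `q = 1` the scaling relation leaves `2/p = 0`.
    have hptop : p = ∞ := by
      rw [div_one] at hpq
      have h1 : 2 / p = 0 := by
        have h2 : 2 / p + (d : ℝ≥0∞) = 0 + d := by rw [hpq, zero_add]
        exact (ENNReal.add_left_inj (ENNReal.natCast_ne_top d)).1 h2
      rcases ENNReal.div_eq_zero_iff.1 h1 with h2 | h2
      · exact absurd h2 two_ne_zero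
      · exact h2
    subst hptop
    have hs1 : s = 1 := by
      rw [hs, ENNReal.toReal_one]
      norm_num
    refine ⟨1, one_pos, fun ι _ f ν hf hν => ?_⟩
    rw [hs1] at hν ⊢
    have h1 := hasDensityBound_one hf hν
    have h2 : ((1 : ℝ≥0∞).toReal + 1) / (2 * (1 : ℝ≥0∞).toReal) = 1 := by
      rw [ENNReal.toReal_one]
      norm_num
    rwa [h2, one_mul, Real.rpow_one]
  · have hd0 : (0 : ℝ) < d := by exact_mod_cast hd
    have hreal : 2 / p.toReal + (d : ℝ) / q.toReal = d := by
      have h1 := congrArg ENNReal.toReal hpq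
      have h2 : 2 / p ≠ ∞ := ENNReal.div_ne_top (by norm_num) (by positivity)
      have h3 : (d : ℝ≥0∞) / q ≠ ∞ :=
        ENNReal.div_ne_top (ENNReal.natCast_ne_top d) (by positivity)
      rw [ENNReal.toReal_add h2 h3, ENNReal.toReal_div, ENNReal.toReal_div] at h1
      simpa using h1
    have hptop : p ≠ ∞ := by
      rintro rfl
      rw [ENNReal.toReal_top, div_zero, zero_add, div_eq_iff (by positivity)] at hreal
      nlinarith
    have hp0 : 0 < p.toReal := ENNReal.toReal_pos (by positivity) hptop
    have hlt : ((d : ℝ) - 1) * (q.toReal - 1) < 2 :=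
      sub_one_mul_lt_two hd (by rwa [ENNReal.ofReal_toReal hqtop])
    obtain ⟨C, hC0, hC⟩ := exists_density_bound_of_scaling hd hp0 hq1 hreal hlt
    refine ⟨C, hC0, fun ι _ f ν hf hν => ?_⟩
    have h1 := hC ι (fun j => ‖ν j‖ₑ) f hf
    have hnn : 0 ≤ ∑' j, ‖ν j‖ ^ s := tsum_nonneg fun j => by positivity
    rw [← hs, tsum_enorm_rpow_eq ν hs0 hν, ENNReal.ofReal_rpow_of_nonneg hnn (by positivity),
      ← ENNReal.ofReal_mul hC0.le] at h1
    have h2 := hasDensityBound_of_lintegral_le hp0 (by linarith) h1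
    rwa [ENNReal.ofReal_toReal hptop, ENNReal.ofReal_toReal hqtop] at h2

end Density

end OrthonormalStrichartz

theorem mainTheorem2 (d : ℕ) (hd : 1 ≤ d) :
    -- Strichartz estimates for orthonormal functions.
    -- In `ℝ≥0∞`, `2 / ∞ = 0` and, for `d = 1`, `1 + 2 / (d - 1) = ∞`.
    (∀ p q : ℝ≥0∞, 1 ≤ p → 1 ≤ q → 2 / p + (d : ℝ≥0∞) / q = (d : ℝ≥0∞) →
      q < 1 + 2 / ((d : ℝ≥0∞) - 1) →
      ∃ C : ℝ, 0 < C ∧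
        ∀ (ι : Type*) (f : ι → Lp ℂ 2 (volume : Measure (OrthonormalStrichartz.Space d)))
          (ν : ι → ℂ), Orthonormal ℂ f →
          Summable (fun j => ‖ν j‖ ^ (2 * q.toReal / (q.toReal + 1))) →
          ∃ ρ : OrthonormalStrichartz.SpaceTime d → ℂ,
            AEStronglyMeasurable ρ volume ∧
            (∀ᵐ t : ℝ, ∀ᵐ x : OrthonormalStrichartz.Space d,
              HasSum
                (fun j => ν j * ((‖OrthonormalStrichartz.schrodinger t (f j) x‖ ^ 2 : ℝ) : ℂ))
                (ρ (t, x))) ∧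
            OrthonormalStrichartz.mixedNorm p q ρ ≤
              ENNReal.ofReal (C * (∑' j, ‖ν j‖ ^ (2 * q.toReal / (q.toReal + 1))) ^
                ((q.toReal + 1) / (2 * q.toReal)))) ∧
    -- The Schatten bound with space-time norms for the paraboloid.
    (∀ p q : ℝ, 1 ≤ p → 1 ≤ q → 2 / p + (d : ℝ) / q = 1 → (d : ℝ) + 1 < q →
      ∃ C : ℝ, 0 < C ∧
        ∀ W₁ W₂ : OrthonormalStrichartz.SpaceTime d → ℂ,
          OrthonormalStrichartz.MemMixedLp (ENNReal.ofReal p) (ENNReal.ofReal q) W₁ →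
          OrthonormalStrichartz.MemMixedLp (ENNReal.ofReal p) (ENNReal.ofReal q) W₂ →
          ∃ B : Lp ℂ 2 (volume : Measure (OrthonormalStrichartz.SpaceTime d)) →L[ℂ]
              Lp ℂ 2 (volume : Measure (OrthonormalStrichartz.SpaceTime d)),
            OrthonormalStrichartz.IsSandwich W₁ W₂ B ∧
            IsCompactOperator B ∧
            OrthonormalStrichartz.schattenNorm q B ≤
              ENNReal.ofReal C *
                OrthonormalStrichartz.mixedNorm (ENNReal.ofReal p) (ENNReal.ofReal q) W₁ *
                OrthonormalStrichartz.mixedNorm (ENNReal.ofReal p) (ENNReal.ofReal q) W₂) := by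
  refine ⟨fun p q hp hq hpq hqd => ?_, fun p q hp _ hpq hq => ?_⟩
  · obtain ⟨C, hC0, hC⟩ := OrthonormalStrichartz.exists_hasDensityBound hd hp hq hpq hqd
    exact ⟨C, hC0, fun ι f ν hf hν => hC ι f ν hf hν⟩
  · exact OrthonormalStrichartz.exists_schattenNorm_le hd hp hpq hq
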